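/- Let $X$ be an infinite, connected, locally finite graph with a symmetric weight $\mu_{xy}\ge 0$ ($x,y\in X$) such that $\mu_{xy}>0$ if and only if $x$ and $y$ are neighbours (written $x\sim y$). Put $\mu(x)=\sum_{y\sim x}\mu_{xy}$ and $\mu(A)=\sum_{x\in A}\mu(x)$ for $A\subset X$, let $d$ be the graph distance, $B(x,r)=\{y\in X: d(x,y)\le r\}$ and $V(x,r)=\mu(B(x,r))$. Assume that there is $C_\mu\ge 1$ with $C_\mu^{-1}\le \mu(x)\le C_\mu$ for all $x\in X$, and that there are $d_f>0$ and $C_V>0$ with $$C_V^{-1}r^{d_f}\le V(x,r)\le C_V r^{d_f}\qquad\text{for all } x\in X,\ r\ge 1 .$$ A Markov operator $K$ on $X$ is given by transition probabilities $K(x,y)\ge 0$ with $\sum_{y}K(x,y)=1$, acting by $Kf(x)=\sum_y K(x,y)f(y)$; it is $\mu$-symmetric if $\mu(x)K(x,y)=\mu(y)K(y,x)$ for all $x,y$. For $n\ge 1$ let $k_n(x,y)=(K^n\mathbf 1_{\{y\}})(x)/\mu(y)$ be the kernel of $K^n$ with respect to $\mu$, and $k=k_1$. For $\beta>0$ we say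 that * $K$ satisfies $J(\beta)$ if there is $C>0$ such that for all $x,y\in X$ $$\frac{C^{-1}}{(1+d(x,y))^{d_f+\beta}}\le k(x,y)=k(y,x)\le \frac{C}{(1+d(x,y))^{d_f+\beta}};$$ * $K$ satisfies $\mathrm{HKP}(d_f,\beta)$ if there is $C>0$ such that for all $x,y\in X$ and all integers $n\ge 1$ $$C^{-1}\min\Big(\frac1{n^{d_f/\beta}},\frac{n}{d(x,y)^{d_f+\beta}}\Big)\le k_n(x,y)\le C\min\Big(\frac1{n^{d_f/\beta}},\frac{n}{d(x,y)^{d_f+\beta}}\Big),$$ where for $x=y$ the second entry of the minimum is read as $+\infty$. Let $\beta\ge 2$ and let $K_1$ and $K_2$ be two $\mu$-symmetric Markov operators on $X$ that both satisfy $J(\beta)$. Then $K_1$ satisfies $\mathrm{HKP}(d_f,\beta)$ if and only if $K_2$ satisfies $\mathrm{HKP}(d_f,\beta)$. -/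

import Mathlib

/-- The graph underlying an edge weight: distinct vertices `x`, `y` are adjacent iff the weight
of the pair is positive. (Loops `w x x > 0` are permitted; they do not influence distances.) -/
def edgeGraph {X : Type*} (w : X → X → ℝ) : SimpleGraph X :=
  SimpleGraph.fromRel fun x y => 0 < w x y

/-- A connected, locally finite graph on the vertex set `X`, endowed with a symmetric
non-negative weight which is positive exactly on neighbouring pairs. -/
structure WeightedGraph (X : Type*) where
  weight : X → X → ℝ
  weight_nonneg : ∀ x y, 0 ≤ weight x y
  weight_symm : ∀ x y, weight x y = weight y x
  locallyFinite : ∀ x, {y | 0 < weight x y}.Finite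
  connected : (edgeGraph weight).Connected

namespace WeightedGraph

variable {X : Type*} (G : WeightedGraph X)

/-- The vertex weight `μ(x) = ∑_{y ∼ x} μ_{xy}`. -/
noncomputable def mass (x : X) : ℝ :=
  ∑ y ∈ (G.locallyFinite x).toFinset, G.weight x y

/-- The graph distance, as a real number. -/
noncomputable def d (x y : X) : ℝ :=
  ((edgeGraph G.weight).dist x y : ℝ)

/-- The closed ball `B(x, r)`. -/
def ball (x : X) (r : ℝ) : Set X :=
  {y | G.d x y ≤ r}

/-- The volume `V(x, r) = μ(B(x, r))` (a finite sum, as the graph is connected and locally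
finite). -/
noncomputable def vol (x : X) (r : ℝ) : ℝ :=
  ∑' y : G.ball x r, G.mass y

/-- The measure `μ` is comparable to the counting measure. -/
def ComparableToCounting : Prop :=
  ∃ C : ℝ, 1 ≤ C ∧ ∀ x, C⁻¹ ≤ G.mass x ∧ G.mass x ≤ C

/-- Polynomial volume growth `V(d_f)`. -/
def VolumeGrowth (df : ℝ) : Prop :=
  ∃ C : ℝ, 0 < C ∧ ∀ (x : X) (r : ℝ), 1 ≤ r →
    C⁻¹ * r ^ df ≤ G.vol x r ∧ G.vol x r ≤ C * r ^ df

end WeightedGraph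

/-- A Markov operator on functions on the discrete space `X`, given by its one-step transition
probabilities. -/
structure MarkovOperator (X : Type*) where
  prob : X → X → ℝ
  prob_nonneg : ∀ x y, 0 ≤ prob x y
  hasSum_prob : ∀ x, HasSum (fun y => prob x y) 1

namespace MarkovOperator

variable {X : Type*} (K : MarkovOperator X) (G : WeightedGraph X)

/-- The action `(K f)(x) = ∑_y K(x, y) f(y)` (absolutely convergent for bounded `f`). -/
noncomputable def op (f : X → ℝ) : X → ℝ :=
  fun x => ∑' y, K.prob x y * f y

open Classical in
/-- The kernel `k_n` of the power `K^n` with respect to the measure `μ`: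
`k_n(x, y) = (K^n 1_{y})(x) / μ(y)`. -/
noncomputable def kernel (n : ℕ) (x y : X) : ℝ :=
  K.op^[n] (Pi.single y 1) x / G.mass y

/-- `K` is symmetric with respect to `μ`. -/
def IsSymmetric : Prop :=
  ∀ x y, G.mass x * K.prob x y = G.mass y * K.prob y x

/-- The condition `J(β)` on the kernel `k = k_1`, relative to the volume growth exponent `df`. -/
def SatisfiesJ (df β : ℝ) : Prop :=
  (∀ x y, K.kernel G 1 x y = K.kernel G 1 y x) ∧
  ∃ C : ℝ, 0 < C ∧ ∀ x y,
    C⁻¹ * (1 / (1 + G.d x y) ^ (df + β)) ≤ K.kernel G 1 x y ∧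
    K.kernel G 1 x y ≤ C * (1 / (1 + G.d x y) ^ (df + β))

open Classical in
/-- The profile `min (n^{-df/β}, n / r^{df+β})`; at `r = 0` the second entry is `+∞`, so that the
minimum is the first entry. -/
noncomputable def hkpProfile (df β : ℝ) (n : ℕ) (r : ℝ) : ℝ :=
  if r = 0 then 1 / (n : ℝ) ^ (df / β)
  else min (1 / (n : ℝ) ^ (df / β)) ((n : ℝ) / r ^ (df + β))

/-- The two-sided heat kernel estimate `HKP(df, β)`. -/
def SatisfiesHKP (df β : ℝ) : Prop :=
  ∃ C : ℝ, 0 < C ∧ ∀ (n : ℕ), 1 ≤ n → ∀ x y : X,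
    C⁻¹ * hkpProfile df β n (G.d x y) ≤ K.kernel G n x y ∧
    K.kernel G n x y ≤ C * hkpProfile df β n (G.d x y)

end MarkovOperator

/-! The jump condition alone fixes the on-diagonal decay: the lower bound on the kernel gives a Nash
type inequality (`pairing_contract`), hence `k_n ≤ C n^{-df/β}` (`exists_diagonal_bound`). What it
does not control is how fast the walk leaves a ball, and this is the information that must be
carried from `K₁` to `K₂`.

The estimate for `K₁` is used only through tightness (`exists_tight`): within `m` steps a
displacement larger than `s` has probability `O(m s^{-β})`. Averaging the semigroup over about `s^β`
steps turns this into cutoff functions `h` on annuli of width `s` with `h - K₁ h ≤ C s^{-β}`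
(`Tight.exists_cutoff`). Integration by parts then bounds `∑ J₁ f² (h(x) - h(y))²` by the energy of
`f` plus `s^{-β} ‖f‖²`. In this form the information is stable: only energies and the squared
increments of `h` occur, so comparable jump kernels can be exchanged, up to the long jumps, whose
rate is also `O(s^{-β})`.

For `K₂` truncated at jump length `s`, add up smoothed steps over `N` disjoint annuli to obtain a
function `θ` and test a subsolution with weight `e^θ - 1`. Its `L²` norm on the inner ball is then
of order `e^{-ηN}` (`exp_weight_bound`, `exists_weighted_bound`). Combined with the on-diagonal
bound this controls averages of discounted exit functions. The pointwise bound follows by induction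
over scales (`exists_exitBound`): the value at the centre of a ball is at most an average inside the
ball of radius `R / 4`, plus the estimate at scale `R / 2` times the probability of leaving the ball
of radius `R / 4` early, which the estimate at scale `R / 4` makes small.

The exit estimate yields both remaining bounds. Above: remove the jumps longer than a small multiple
of `d(x,y)`; covering the distance by short jumps requires many successive exits, and the removed
jumps contribute `n d^{-(df+β)}` (`exists_offDiagonal_bound`). Below: the walk may stay near `x`,
make one jump of size about `r`, and stay near `y`; the jump can occur at any of `n` times
(`exists_lower_bound_radius`). -/

open scoped ENNReal

/-! ### Operators with non-negative kernels -/

namespace KernelOp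

variable {X : Type*}

/-- The action of a non-negative kernel on non-negative functions. -/
noncomputable def act (p : X → X → ℝ≥0∞) (f : X → ℝ≥0∞) : X → ℝ≥0∞ :=
  fun x => ∑' y, p x y * f y

open Classical in
/-- The indicator function of a point. -/
noncomputable def dirac (y : X) : X → ℝ≥0∞ := Pi.single y 1

/-- The pairing of two non-negative functions with respect to the weight `m`. -/
noncomputable def pairing (m f g : X → ℝ≥0∞) : ℝ≥0∞ := ∑' x, m x * (f x * g x)

/-- Symmetry of a kernel with respect to the weight `m`. -/
def Symm (m : X → ℝ≥0∞) (p : X → X → ℝ≥0∞) : Prop := ∀ x y, m x * p x y = m y * p y x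

variable {p p' q : X → X → ℝ≥0∞} {f g : X → ℝ≥0∞} {m : X → ℝ≥0∞}

theorem act_mono (hp : ∀ x y, p x y ≤ p' x y) (hf : ∀ y, f y ≤ g y) (x : X) :
    act p f x ≤ act p' g x :=
  ENNReal.tsum_le_tsum fun y => mul_le_mul' (hp x y) (hf y)

theorem act_mono_right (hf : ∀ y, f y ≤ g y) (x : X) : act p f x ≤ act p g x :=
  act_mono (fun _ _ => le_rfl) hf x

theorem act_add_right (f g : X → ℝ≥0∞) (x : X) :
    act p (fun y => f y + g y) x = act p f x + act p g x := by
  simp only [act, mul_add, ENNReal.tsum_add]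

theorem act_add_left (f : X → ℝ≥0∞) (x : X) :
    act (fun x y => p x y + q x y) f x = act p f x + act q f x := by
  simp only [act, add_mul, ENNReal.tsum_add]

theorem act_const_mul (c : ℝ≥0∞) (f : X → ℝ≥0∞) (x : X) :
    act p (fun y => c * f y) x = c * act p f x := by
  simp only [act, ← ENNReal.tsum_mul_left]
  exact tsum_congr fun y => by ring

theorem act_sum {ι : Type*} (s : Finset ι) (F : ι → X → ℝ≥0∞) (x : X) :
    act p (fun y => ∑ i ∈ s, F i y) x = ∑ i ∈ s, act p (F i) x := by
  simp only [act, Finset.mul_sum]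
  exact Summable.tsum_finsetSum fun _ _ => ENNReal.summable

theorem act_const_le (hp : ∀ x, ∑' y, p x y ≤ 1) (c : ℝ≥0∞) (x : X) :
    act p (fun _ => c) x ≤ c := by
  simp only [act, ENNReal.tsum_mul_right]
  exact mul_le_of_le_one_left' (hp x)

theorem act_const (hp : ∀ x, ∑' y, p x y = 1) (c : ℝ≥0∞) (x : X) :
    act p (fun _ => c) x = c := by
  simp only [act, ENNReal.tsum_mul_right, hp, one_mul]

theorem act_dirac (x y : X) : act p (dirac y) x = p x y := by
  classical
  rw [act, tsum_eq_single y]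
  · simp [dirac]
  · intro z hz
    simp [dirac, hz]

theorem iter_mono (hp : ∀ x y, p x y ≤ p' x y) (hf : ∀ y, f y ≤ g y) (n : ℕ) (x : X) :
    (act p)^[n] f x ≤ (act p')^[n] g x := by
  induction n generalizing x with
  | zero => exact hf x
  | succ n ih =>
    rw [Function.iterate_succ_apply', Function.iterate_succ_apply']
    exact act_mono hp ih x

theorem iter_le_const (hp : ∀ x, ∑' y, p x y ≤ 1) {c : ℝ≥0∞} (hf : ∀ x, f x ≤ c) (n : ℕ) (x : X) :
    (act p)^[n] f x ≤ c := by
  induction n generalizing x with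
  | zero => exact hf x
  | succ n ih =>
    rw [Function.iterate_succ_apply']
    exact (act_mono_right ih x).trans (act_const_le hp c x)

theorem iter_one (hp : ∀ x, ∑' y, p x y = 1) (n : ℕ) (x : X) :
    (act p)^[n] (fun _ => 1) x = 1 := by
  induction n generalizing x with
  | zero => rfl
  | succ n ih =>
    rw [Function.iterate_succ_apply', funext ih]
    exact act_const hp 1 x

theorem iter_add (f g : X → ℝ≥0∞) (n : ℕ) (x : X) :
    (act p)^[n] (fun y => f y + g y) x = (act p)^[n] f x + (act p)^[n] g x := by
  induction n generalizing x with
  | zero => rfl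
  | succ n ih =>
    simp only [Function.iterate_succ_apply']
    rw [funext ih, act_add_right]

theorem tsum_dirac_mul (f : X → ℝ≥0∞) (x : X) : ∑' y, dirac y x * f y = f x := by
  classical
  rw [tsum_eq_single x]
  · simp [dirac]
  · intro z hz
    simp [dirac, hz.symm]

theorem iter_eq_tsum (f : X → ℝ≥0∞) (n : ℕ) (x : X) :
    (act p)^[n] f x = ∑' y, (act p)^[n] (dirac y) x * f y := by
  induction n generalizing x with
  | zero => exact (tsum_dirac_mul f x).symm
  | succ n ih =>
    simp only [Function.iterate_succ_apply']
    rw [funext ih]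
    simp only [act, ← ENNReal.tsum_mul_left, ← ENNReal.tsum_mul_right]
    rw [ENNReal.tsum_comm]
    exact tsum_congr fun y => tsum_congr fun z => by ring

theorem dirac_comm (x y : X) : dirac x y = dirac y x := by
  classical
  by_cases h : x = y
  · rw [h]
  · simp [dirac, Ne.symm h, h]

theorem pairing_dirac (f : X → ℝ≥0∞) (x : X) : pairing m (dirac x) f = m x * f x := by
  rw [← tsum_dirac_mul (fun y => m y * f y) x, pairing]
  exact tsum_congr fun y => by rw [dirac_comm y x]; ring

theorem pairing_comm (f g : X → ℝ≥0∞) : pairing m f g = pairing m g f :=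
  tsum_congr fun x => by rw [mul_comm (f x)]

theorem pairing_mono {f' g' : X → ℝ≥0∞} (hf : ∀ x, f x ≤ f' x) (hg : ∀ x, g x ≤ g' x) :
    pairing m f g ≤ pairing m f' g' :=
  ENNReal.tsum_le_tsum fun x => mul_le_mul' le_rfl (mul_le_mul' (hf x) (hg x))

theorem pairing_act (hs : Symm m p) (f g : X → ℝ≥0∞) :
    pairing m f (act p g) = pairing m (act p f) g := by
  simp only [pairing, act, ← ENNReal.tsum_mul_left, ← ENNReal.tsum_mul_right]
  rw [ENNReal.tsum_comm]
  refine tsum_congr fun y => tsum_congr fun x => ?_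
  calc m x * (f x * (p x y * g y)) = (m x * p x y) * (f x * g y) := by ring
    _ = (m y * p y x) * (f x * g y) := by rw [hs x y]
    _ = _ := by ring

theorem pairing_iter (hs : Symm m p) (f g : X → ℝ≥0∞) (n : ℕ) :
    pairing m f ((act p)^[n] g) = pairing m ((act p)^[n] f) g := by
  induction n generalizing f with
  | zero => rfl
  | succ n ih =>
    rw [Function.iterate_succ_apply', pairing_act hs, ih, Function.iterate_succ_apply]

theorem symm_iter (hs : Symm m p) (n : ℕ) :
    Symm m fun x y => (act p)^[n] (dirac y) x := by
  intro x y
  rw [← pairing_dirac, pairing_iter hs, pairing_comm, pairing_dirac]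

/-! ### Exit functions -/

open Classical in
/-- The discounted probability `E_x [q ^ τ_B ; τ_B ≤ j]` of leaving `B` within `j` steps. -/
noncomputable def exitFn (q : ℝ≥0∞) (p : X → X → ℝ≥0∞) (B : Set X) : ℕ → X → ℝ≥0∞
  | 0 => fun x => if x ∈ B then 0 else 1
  | j + 1 => fun x => if x ∈ B then q * act p (exitFn q p B j) x else 1

variable {t : ℝ≥0∞} {B B' : Set X}

theorem exitFn_of_notMem {x : X} (hx : x ∉ B) (j : ℕ) : exitFn t p B j x = 1 := by
  cases j <;> simp [exitFn, hx]

theorem exitFn_zero {x : X} (hx : x ∈ B) : exitFn t p B 0 x = 0 := by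
  simp [exitFn, hx]

theorem exitFn_succ {x : X} (hx : x ∈ B) (j : ℕ) :
    exitFn t p B (j + 1) x = t * act p (exitFn t p B j) x := by
  simp [exitFn, hx]

theorem exitFn_le_one (ht : t ≤ 1) (hp : ∀ x, ∑' y, p x y ≤ 1) (j : ℕ) (x : X) :
    exitFn t p B j x ≤ 1 := by
  induction j generalizing x with
  | zero => by_cases hx : x ∈ B <;> simp [exitFn, hx]
  | succ j ih =>
    by_cases hx : x ∈ B
    · rw [exitFn_succ hx]
      exact mul_le_one' ht ((act_mono_right ih x).trans (act_const_le hp 1 x))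
    · rw [exitFn_of_notMem hx]

theorem exitFn_le_discount (ht : t ≤ 1) (hp : ∀ x, ∑' y, p x y ≤ 1) (j : ℕ) {x : X} (hx : x ∈ B) :
    exitFn t p B j x ≤ t := by
  cases j with
  | zero => simp [exitFn, hx]
  | succ j =>
    rw [exitFn_succ hx]
    exact mul_le_of_le_one_right'
      ((act_mono_right (exitFn_le_one ht hp j) x).trans (act_const_le hp 1 x))

theorem exitFn_le_succ (j : ℕ) (x : X) : exitFn t p B j x ≤ exitFn t p B (j + 1) x := by
  induction j generalizing x with
  | zero => by_cases hx : x ∈ B <;> simp [exitFn, hx]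
  | succ j ih =>
    by_cases hx : x ∈ B
    · rw [exitFn_succ hx, exitFn_succ hx]
      exact mul_le_mul' le_rfl (act_mono_right ih x)
    · rw [exitFn_of_notMem hx, exitFn_of_notMem hx]

theorem exitFn_mono_time {i j : ℕ} (h : i ≤ j) (x : X) : exitFn t p B i x ≤ exitFn t p B j x :=
  monotone_nat_of_le_succ (f := fun j => exitFn t p B j x) (fun j => exitFn_le_succ j x) h

theorem exitFn_subsolution (j : ℕ) {x : X} (hx : x ∈ B) :
    exitFn t p B j x ≤ t * act p (exitFn t p B j) x := by
  cases j with
  | zero => simp [exitFn, hx]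
  | succ j =>
    conv_lhs => rw [exitFn_succ hx]
    exact mul_le_mul' le_rfl (act_mono_right (exitFn_le_succ j) x)

theorem exitFn_mono (ht : t ≤ 1) (hp' : ∀ x, ∑' y, p' x y ≤ 1) (hp : ∀ x y, p x y ≤ p' x y)
    (hB : B' ⊆ B) (j : ℕ) (x : X) : exitFn t p B j x ≤ exitFn t p' B' j x := by
  have hp1 : ∀ x, ∑' y, p x y ≤ 1 := fun x => (ENNReal.tsum_le_tsum (hp x)).trans (hp' x)
  induction j generalizing x with
  | zero =>
    by_cases hx : x ∈ B'
    · rw [exitFn_zero (hB hx)]; exact zero_le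
    · rw [exitFn_of_notMem hx]; exact exitFn_le_one ht hp1 _ _
  | succ j ih =>
    by_cases hx : x ∈ B'
    · rw [exitFn_succ (hB hx), exitFn_succ hx]
      exact mul_le_mul' le_rfl (act_mono hp ih x)
    · rw [exitFn_of_notMem hx]; exact exitFn_le_one ht hp1 _ _

/-- Removing the discount. -/
theorem exitFn_one_le {a : ℝ≥0∞} (ha : 1 ≤ a) (hat : 1 ≤ a * t) (j : ℕ) (x : X) :
    exitFn 1 p B j x ≤ a ^ j * exitFn t p B j x := by
  induction j generalizing x with
  | zero => by_cases hx : x ∈ B <;> simp [exitFn, hx]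
  | succ j ih =>
    by_cases hx : x ∈ B
    · rw [exitFn_succ hx, exitFn_succ hx, one_mul]
      calc act p (exitFn 1 p B j) x ≤ a ^ j * act p (exitFn t p B j) x := by
            rw [← act_const_mul]; exact act_mono_right ih x
        _ ≤ (a * t) * (a ^ j * act p (exitFn t p B j) x) := le_mul_of_one_le_left' hat
        _ = _ := by ring
    · rw [exitFn_of_notMem hx, exitFn_of_notMem hx, mul_one]
      exact one_le_pow₀ ha

theorem iter_indicator_compl_le (hp : ∀ x, ∑' y, p x y ≤ 1) (j : ℕ) (x : X) :
    (act p)^[j] (Set.indicator Bᶜ 1) x ≤ exitFn 1 p B j x := by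
  induction j generalizing x with
  | zero => by_cases hx : x ∈ B <;> simp [exitFn, hx]
  | succ j ih =>
    rw [Function.iterate_succ_apply']
    by_cases hx : x ∈ B
    · rw [exitFn_succ hx, one_mul]
      exact act_mono_right ih x
    · rw [exitFn_of_notMem hx]
      exact (act_mono_right (fun y => (ih y).trans (exitFn_le_one le_rfl hp j y)) x).trans
        (act_const_le hp 1 x)

/-- A subsolution in `B'` is controlled by its average inside `B'` and by its size just
outside `B'`. -/
theorem subsolution_le {N : Set X} {S : ℝ≥0∞} {v : X → ℝ≥0∞}
    (hN : ∀ x ∈ B', ∀ y, y ∉ N → p x y = 0)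
    (hsub : ∀ x ∈ B', v x ≤ act p v x) (hS : ∀ x ∈ N, v x ≤ S) (n : ℕ) {x : X} (hx : x ∈ N) :
    v x ≤ (act p)^[n] (Set.indicator B' v) x + S * exitFn 1 p B' n x := by
  induction n generalizing x with
  | zero =>
    by_cases hxB : x ∈ B'
    · simp [hxB]
    · rw [exitFn_of_notMem hxB, mul_one]
      exact (hS x hx).trans le_add_self
  | succ n ih =>
    by_cases hxB : x ∈ B'
    · rw [exitFn_succ hxB, one_mul, Function.iterate_succ_apply', ← act_const_mul,
        ← act_add_right]
      refine (hsub x hxB).trans (ENNReal.tsum_le_tsum fun y => ?_)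
      by_cases hy : y ∈ N
      · exact mul_le_mul' le_rfl (ih hy)
      · simp [hN x hxB y hy]
    · rw [exitFn_of_notMem hxB, mul_one]
      exact (hS x hx).trans le_add_self

/-- Strong Markov property at the exit from `B'`: a step from `B'` lands in `N`, so leaving `B`
means first leaving `B'` and then leaving `B` from a point of `N` outside `B'`. -/
theorem exitFn_le_mul {N : Set X} {S : ℝ≥0∞} (hN : ∀ x ∈ B', ∀ y, y ∉ N → p x y = 0)
    (hB : B' ⊆ B) (M : ℕ) (hS : ∀ x ∈ N, x ∉ B' → exitFn 1 p B M x ≤ S) {n : ℕ} (hn : n ≤ M)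
    {x : X} (hx : x ∈ N) : exitFn 1 p B n x ≤ S * exitFn 1 p B' n x := by
  induction n generalizing x with
  | zero =>
    by_cases hxB : x ∈ B'
    · simp [exitFn_zero (hB hxB)]
    · rw [exitFn_of_notMem hxB, mul_one]
      exact (exitFn_mono_time (Nat.zero_le M) x).trans (hS x hx hxB)
  | succ n ih =>
    by_cases hxB : x ∈ B'
    · rw [exitFn_succ hxB, exitFn_succ (hB hxB), one_mul, one_mul, ← act_const_mul]
      refine ENNReal.tsum_le_tsum fun y => ?_
      by_cases hy : y ∈ N
      · exact mul_le_mul' le_rfl (ih (by omega) hy)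
      · simp [hN x hxB y hy]
    · rw [exitFn_of_notMem hxB, mul_one]
      exact (exitFn_mono_time hn x).trans (hS x hx hxB)

/-- Comparison of the exit functions of a kernel `p + q` and of `p`. -/
theorem exitFn_add_le {W : ℝ≥0∞} (hpq : ∀ x, ∑' y, (p x y + q x y) ≤ 1) (ht : t ≤ 1)
    (hW : ∀ x, t * (W + ∑' y, q x y) ≤ W) (j : ℕ) (x : X) :
    exitFn t (fun x y => p x y + q x y) B j x ≤ exitFn t p B j x + W := by
  induction j generalizing x with
  | zero => by_cases hx : x ∈ B <;> simp [exitFn, hx]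
  | succ j ih =>
    by_cases hx : x ∈ B
    · rw [exitFn_succ hx, exitFn_succ hx, act_add_left]
      have h1 : act p (exitFn t (fun x y => p x y + q x y) B j) x
          ≤ act p (exitFn t p B j) x + W := by
        refine (act_mono_right ih x).trans ?_
        rw [act_add_right]
        gcongr
        refine act_const_le (fun x => (ENNReal.tsum_le_tsum fun y => ?_).trans (hpq x)) W x
        exact le_self_add
      have h2 : act q (exitFn t (fun x y => p x y + q x y) B j) x ≤ ∑' y, q x y := by
        refine ENNReal.tsum_le_tsum fun y => ?_
        exact mul_le_of_le_one_right' (exitFn_le_one ht hpq j y)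
      -- A jump of type `q` is counted as an immediate exit. The hypothesis `hW` says that the
      -- constant `W` dominates the discounted cost of all such jumps, so the same `W` survives each
      -- step.
      calc t * (act p (exitFn t (fun x y => p x y + q x y) B j) x
            + act q (exitFn t (fun x y => p x y + q x y) B j) x)
          ≤ t * ((act p (exitFn t p B j) x + W) + ∑' y, q x y) := by gcongr
        _ = t * act p (exitFn t p B j) x + t * (W + ∑' y, q x y) := by ring
        _ ≤ _ := by gcongr; exact hW x
    · rw [exitFn_of_notMem hx, exitFn_of_notMem hx]
      exact le_self_add

end KernelOp

/-! ### Energy inequalities on finite sets -/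

section Energy

variable {X : Type*}

theorem sum_sum_le_of_symm {Ω : Finset X} {F H : X → X → ℝ}
    (h : ∀ x ∈ Ω, ∀ y ∈ Ω, F x y + F y x ≤ H x y + H y x) :
    ∑ x ∈ Ω, ∑ y ∈ Ω, F x y ≤ ∑ x ∈ Ω, ∑ y ∈ Ω, H x y := by
  have h1 : ∑ x ∈ Ω, ∑ y ∈ Ω, (F x y + F y x) ≤ ∑ x ∈ Ω, ∑ y ∈ Ω, (H x y + H y x) :=
    Finset.sum_le_sum fun x hx => Finset.sum_le_sum fun y hy => h x hx y hy
  simp only [Finset.sum_add_distrib] at h1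
  rw [Finset.sum_comm (f := fun x y => F y x), Finset.sum_comm (f := fun x y => H y x)] at h1
  linarith

/-- `(a²s - b²t)(s - t)` is `(a² + b²)(s - t)²/2` plus the cross term `(a² - b²)(s² - t²)/2`; the
cross term is absorbed by completing a square, with `s + t ≤ 2`. -/
theorem cutoff_pointwise {a b s t : ℝ} (hs0 : 0 ≤ s) (hs1 : s ≤ 1) (ht0 : 0 ≤ t) (ht1 : t ≤ 1) :
    (a ^ 2 + b ^ 2) * (s - t) ^ 2 ≤
      4 * (a ^ 2 * s * (s - t) + b ^ 2 * t * (t - s)) + 8 * (a - b) ^ 2 := by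
  have key : 0 ≤ (((s + t) / 2) * (2 * (a - b)) + (a + b) * (s - t) / 2) ^ 2 := sq_nonneg _
  have h1 : ((s + t) / 2) ^ 2 ≤ 1 := by nlinarith
  nlinarith [sq_nonneg (a - b), sq_nonneg (s - t), mul_nonneg (sq_nonneg (a - b)) (sq_nonneg (s - t)),
    mul_nonneg (sq_nonneg (a - b)) (sub_nonneg.2 h1)]

open Classical in
/-- The cutoff inequality behind all off-diagonal estimates. -/
theorem energy_cutoff {Ω : Finset X} {J : X → X → ℝ} (hJ : ∀ x y, 0 ≤ J x y)
    (hs : ∀ x y, J x y = J y x) {h : X → ℝ} (h0 : ∀ x, 0 ≤ h x) (h1 : ∀ x, h x ≤ 1) (f : X → ℝ) :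
    ∑ x ∈ Ω, ∑ y ∈ Ω, J x y * (f x ^ 2 * (h x - h y) ^ 2) ≤
      ∑ x ∈ Ω, ∑ y ∈ Ω, (4 * (J x y * (f x ^ 2 * h x * (h x - h y))) +
        4 * (if h x = h y then 0 else J x y * (f x - f y) ^ 2)) := by
  refine sum_sum_le_of_symm fun x _ y _ => ?_
  rw [hs y x]
  -- Pairs on which `h` does not vary contribute nothing. Recording this in the energy term is what
  -- later lets many cutoffs be summed at the price of one energy.
  by_cases hxy : h x = h y
  · simp [hxy]
  · rw [if_neg hxy, if_neg (Ne.symm hxy)]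
    have := mul_le_mul_of_nonneg_left
      (cutoff_pointwise (a := f x) (b := f y) (h0 x) (h1 x) (h0 y) (h1 y)) (hJ x y)
    nlinarith [this]

/-- Integration by parts with test function `ψ² v`: the first term on the right is governed by the
equation for `v`, the second sees only the oscillation of `ψ`. -/
theorem energy_weight {Ω : Finset X} {J : X → X → ℝ} (hs : ∀ x y, J x y = J y x) (v ψ : X → ℝ) :
    ∑ x ∈ Ω, ∑ y ∈ Ω, J x y * (ψ x * v x - ψ y * v y) ^ 2 =
      ∑ x ∈ Ω, ∑ y ∈ Ω, (2 * (J x y * (ψ x ^ 2 * v x * (v x - v y))) +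
        J x y * (v x * v y * (ψ x - ψ y) ^ 2)) := by
  apply le_antisymm
  all_goals
    refine sum_sum_le_of_symm fun x _ y _ => le_of_eq ?_
    rw [hs y x]
    ring

theorem exp_sub_exp_sq_le {a b : ℝ} (h : |a - b| ≤ 1) :
    (Real.exp a - Real.exp b) ^ 2 ≤ 4 * (a - b) ^ 2 * (Real.exp a * Real.exp b) := by
  have key : ∀ a b : ℝ, b ≤ a → a - b ≤ 1 →
      (Real.exp a - Real.exp b) ^ 2 ≤ 4 * (a - b) ^ 2 * (Real.exp a * Real.exp b) := by
    intro a b hba hab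
    have hb := Real.exp_pos b
    have e1 : Real.exp a = Real.exp b * Real.exp (a - b) := by rw [← Real.exp_add]; ring_nf
    have h0 : 0 ≤ a - b := by linarith
    have h1 : Real.exp (a - b) - 1 ≤ 2 * (a - b) := by
      have := Real.abs_exp_sub_one_le (x := a - b) (by rw [abs_of_nonneg h0]; exact hab)
      rw [abs_of_nonneg h0] at this
      exact (le_abs_self _).trans this
    have h2 : 1 ≤ Real.exp (a - b) := Real.one_le_exp h0
    have h3 : (Real.exp (a - b) - 1) ^ 2 ≤ 4 * (a - b) ^ 2 * Real.exp (a - b) := by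
      nlinarith [sq_nonneg (a - b)]
    rw [e1]
    nlinarith [mul_le_mul_of_nonneg_left h3 (sq_nonneg (Real.exp b))]
  rcases le_total b a with hab | hab
  · exact key a b hab ((le_abs_self _).trans h)
  · have := key b a hab (by rw [abs_sub_comm] at h; exact (le_abs_self _).trans h)
    nlinarith [this]

/-- Testing with an exponential weight. -/
theorem exp_weight_pointwise {a b s t : ℝ} (h : |s - t| ≤ 1) (ha0 : 0 ≤ a) (ha1 : a ≤ 1)
    (hb0 : 0 ≤ b) (hb1 : b ≤ 1) :
    a * b * ((Real.exp s - 1) - (Real.exp t - 1)) ^ 2 ≤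
      4 * (s - t) ^ 2 * (((Real.exp s - 1) * a) ^ 2 + ((Real.exp t - 1) * b) ^ 2) +
        8 * (s - t) ^ 2 := by
  have h1 := exp_sub_exp_sq_le h
  have h2 : a * Real.exp s * (b * Real.exp t) ≤
      ((Real.exp s - 1) * a) ^ 2 + ((Real.exp t - 1) * b) ^ 2 + 2 := by
    have e1 : (a * Real.exp s) ^ 2 ≤ 2 * ((Real.exp s - 1) * a) ^ 2 + 2 := by
      nlinarith [sq_nonneg ((Real.exp s - 1) * a - a)]
    have e2 : (b * Real.exp t) ^ 2 ≤ 2 * ((Real.exp t - 1) * b) ^ 2 + 2 := by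
      nlinarith [sq_nonneg ((Real.exp t - 1) * b - b)]
    nlinarith [sq_nonneg (a * Real.exp s - b * Real.exp t)]
  have h3 := mul_le_mul_of_nonneg_left h1 (mul_nonneg ha0 hb0)
  have h4 := mul_le_mul_of_nonneg_left h2 (mul_nonneg (by norm_num : (0 : ℝ) ≤ 4) (sq_nonneg (s - t)))
  nlinarith [h3, h4]

end Energy

/-! ### Geometry of the graph -/

namespace WeightedGraph

variable {X : Type*} {G : WeightedGraph X}

theorem d_nonneg (x y : X) : 0 ≤ G.d x y := Nat.cast_nonneg _

theorem d_self (x : X) : G.d x x = 0 := by simp [d]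

theorem d_comm (x y : X) : G.d x y = G.d y x := by simp [d, SimpleGraph.dist_comm]

theorem d_triangle (x y z : X) : G.d x z ≤ G.d x y + G.d y z := by
  have := G.connected.dist_triangle (u := x) (v := y) (w := z)
  unfold d
  exact_mod_cast this

theorem one_le_d {x y : X} (h : x ≠ y) : 1 ≤ G.d x y := by
  have := G.connected.pos_dist_of_ne h
  unfold d
  exact_mod_cast this

theorem mem_ball {x y : X} {r : ℝ} : y ∈ G.ball x r ↔ G.d x y ≤ r := Iff.rfl

/-- Uniform form of the assumptions on the measure. -/
structure Regular (G : WeightedGraph X) (df c : ℝ) : Prop where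
  df_pos : 0 < df
  one_le : 1 ≤ c
  inv_le_mass : ∀ x, c⁻¹ ≤ G.mass x
  mass_le : ∀ x, G.mass x ≤ c
  ball_finite : ∀ x r, (G.ball x r).Finite
  le_vol : ∀ x r, 1 ≤ r → c⁻¹ * r ^ df ≤ G.vol x r
  vol_le : ∀ x r, 1 ≤ r → G.vol x r ≤ c * r ^ df

theorem Regular.mass_pos {df c : ℝ} (h : G.Regular df c) (x : X) : 0 < G.mass x :=
  (inv_pos.2 (by linarith [h.one_le])).trans_le (h.inv_le_mass x)

theorem exists_regular (hcount : G.ComparableToCounting) {df : ℝ} (hdf : 0 < df)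
    (hV : G.VolumeGrowth df) : ∃ c, G.Regular df c := by
  obtain ⟨c₁, h1, hm⟩ := hcount
  obtain ⟨c₂, h2, hv⟩ := hV
  -- The volume is a `tsum`, equal to `0` when not summable. Its positive lower bound forces
  -- summability, and masses bounded below then leave room for finitely many points only.
  have hfin1 : ∀ x r, 1 ≤ r → (G.ball x r).Finite := by
    intro x r hr
    by_contra hinf
    have hpos : 0 < G.vol x r :=
      lt_of_lt_of_le (mul_pos (inv_pos.2 h2) (Real.rpow_pos_of_pos (by linarith) _)) (hv x r hr).1
    have hs : Summable fun y : G.ball x r => G.mass y := by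
      by_contra hns
      rw [vol, tsum_eq_zero_of_not_summable hns] at hpos
      exact lt_irrefl _ hpos
    have hinf' : Infinite (G.ball x r) := Set.infinite_coe_iff.2 hinf
    have hc : Summable fun _ : G.ball x r => c₁⁻¹ :=
      hs.of_nonneg_of_le (fun _ => inv_nonneg.2 (by linarith)) (fun y => (hm y).1)
    rw [summable_const_iff] at hc
    exact (inv_ne_zero (by linarith : c₁ ≠ 0)) hc
  refine ⟨max c₁ c₂, hdf, le_max_of_le_left h1, fun x => le_trans ?_ (hm x).1,
    fun x => (hm x).2.trans (le_max_left _ _), fun x r => ?_, fun x r hr => le_trans ?_ (hv x r hr).1,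
    fun x r hr => (hv x r hr).2.trans ?_⟩
  · exact inv_anti₀ (by linarith) (le_max_left _ _)
  · exact (hfin1 x (max r 1) (le_max_right _ _)).subset fun y hy => le_trans hy (le_max_left r 1)
  · exact mul_le_mul_of_nonneg_right (inv_anti₀ h2 (le_max_right _ _))
      (Real.rpow_nonneg (by linarith) _)
  · exact mul_le_mul_of_nonneg_right (le_max_right _ _) (Real.rpow_nonneg (by linarith) _)

/-- The vertex weight with values in `[0, ∞]`. -/
noncomputable def emass (G : WeightedGraph X) (x : X) : ℝ≥0∞ := ENNReal.ofReal (G.mass x)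

namespace Regular

variable {df c : ℝ}

/-- The closed ball as a finite set. -/
noncomputable def ballFinset (h : G.Regular df c) (x : X) (r : ℝ) : Finset X :=
  (h.ball_finite x r).toFinset

theorem mem_ballFinset (h : G.Regular df c) {x y : X} {r : ℝ} :
    y ∈ h.ballFinset x r ↔ G.d x y ≤ r := by
  simp [ballFinset, mem_ball]

theorem vol_eq_sum (h : G.Regular df c) (x : X) (r : ℝ) :
    G.vol x r = ∑ y ∈ h.ballFinset x r, G.mass y := by
  rw [vol, ← Finset.tsum_subtype]
  have : (h.ballFinset x r : Set X) = G.ball x r := by simp [ballFinset]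
  rw [← this]
  rfl

open Classical in
theorem tsum_emass_ball (h : G.Regular df c) (x : X) (r : ℝ) :
    ∑' y, (if G.d x y ≤ r then G.emass y else 0) = ENNReal.ofReal (G.vol x r) := by
  rw [h.vol_eq_sum, ENNReal.ofReal_sum_of_nonneg fun y _ => (h.mass_pos y).le,
    tsum_eq_sum (s := h.ballFinset x r)]
  · exact Finset.sum_congr rfl fun y hy => by rw [if_pos (h.mem_ballFinset.1 hy)]; rfl
  · intro y hy
    rw [if_neg fun hy' => hy (h.mem_ballFinset.2 hy')]

open Classical in
theorem card_ball_le (h : G.Regular df c) (x : X) {r : ℝ} (hr : 1 ≤ r) :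
    ∑' y, (if G.d x y ≤ r then (1 : ℝ≥0∞) else 0) ≤ ENNReal.ofReal (c ^ 2 * r ^ df) := by
  have hc := h.one_le
  calc ∑' y, (if G.d x y ≤ r then (1 : ℝ≥0∞) else 0)
      ≤ ∑' y, ENNReal.ofReal c * (if G.d x y ≤ r then G.emass y else 0) := by
        refine ENNReal.tsum_le_tsum fun y => ?_
        split_ifs
        · rw [emass, ← ENNReal.ofReal_mul (by linarith), ← ENNReal.ofReal_one]
          apply ENNReal.ofReal_le_ofReal
          have := h.inv_le_mass y
          rwa [inv_le_iff_one_le_mul₀' (by linarith)] at this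
        · simp
    _ = ENNReal.ofReal (c * G.vol x r) := by
        rw [ENNReal.tsum_mul_left, h.tsum_emass_ball, ENNReal.ofReal_mul (by linarith)]
    _ ≤ _ := by
        apply ENNReal.ofReal_le_ofReal
        nlinarith [h.vol_le x r hr]

open Classical in
/-- Summation of a polynomially decaying function outside of a ball. -/
theorem exists_tail_bound (h : G.Regular df c) {β : ℝ} (hβ : 0 < β) :
    ∃ C, 0 < C ∧ ∀ (x : X) (s : ℝ), 1 ≤ s →
      ∑' y, (if s < G.d x y then ENNReal.ofReal (G.d x y ^ (-(df + β))) else 0) ≤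
        ENNReal.ofReal (C * s ^ (-β)) := by
  have hc := h.one_le
  have hdf := h.df_pos
  set ρ : ℝ := 2 ^ (-β) with hρ
  have hρ0 : 0 < ρ := by positivity
  have hρ1 : ρ < 1 := Real.rpow_lt_one_of_one_lt_of_neg (by norm_num) (by linarith)
  refine ⟨c ^ 2 * 2 ^ df * (1 - ρ)⁻¹, by have := sub_pos.2 hρ1; positivity, fun x s hs => ?_⟩
  have hs0 : 0 < s := by linarith
  -- Dyadic shells: the volume `(2^i s)^df` of a ball against the decay `(2^i s)^{-(df+β)}` leaves a
  -- geometric series of ratio `2^{-β}`.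
  calc ∑' y, (if s < G.d x y then ENNReal.ofReal (G.d x y ^ (-(df + β))) else 0)
      ≤ ∑' y, ∑' i : ℕ, ENNReal.ofReal ((2 ^ i * s) ^ (-(df + β))) *
          (if G.d x y ≤ 2 ^ (i + 1) * s then 1 else 0) := by
        refine ENNReal.tsum_le_tsum fun y => ?_
        split_ifs with hy
        · have h1 : 1 ≤ G.d x y / s := by rw [le_div_iff₀ hs0]; linarith
          obtain ⟨i, hi1, hi2⟩ := exists_nat_pow_near h1 (by norm_num : (1 : ℝ) < 2)
          refine le_trans ?_ (ENNReal.le_tsum i)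
          rw [le_div_iff₀ hs0] at hi1
          rw [div_lt_iff₀ hs0] at hi2
          rw [if_pos hi2.le, mul_one]
          apply ENNReal.ofReal_le_ofReal
          exact Real.rpow_le_rpow_of_nonpos (by positivity) hi1 (by linarith)
        · exact zero_le
    _ = ∑' i : ℕ, ENNReal.ofReal ((2 ^ i * s) ^ (-(df + β))) *
          ∑' y, (if G.d x y ≤ 2 ^ (i + 1) * s then 1 else 0) := by
        rw [ENNReal.tsum_comm]
        exact tsum_congr fun i => ENNReal.tsum_mul_left
    _ ≤ ∑' i : ℕ, ENNReal.ofReal (c ^ 2 * 2 ^ df * s ^ (-β) * ρ ^ i) := by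
        refine ENNReal.tsum_le_tsum fun i => ?_
        have h2 : (1 : ℝ) ≤ 2 ^ (i + 1) * s := by
          have := one_le_pow₀ (M₀ := ℝ) (a := 2) (by norm_num) (n := i + 1)
          nlinarith
        refine (mul_le_mul' le_rfl (h.card_ball_le x h2)).trans ?_
        rw [← ENNReal.ofReal_mul (by positivity)]
        apply ENNReal.ofReal_le_ofReal
        apply le_of_eq
        have e1 : (2 : ℝ) ^ (i + 1) * s = 2 * (2 ^ i * s) := by ring
        rw [e1, Real.mul_rpow (by norm_num : (0 : ℝ) ≤ 2) (by positivity : (0 : ℝ) ≤ 2 ^ i * s)]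
        have e2 : ρ ^ i = ((2 : ℝ) ^ i) ^ (-β) := by
          rw [hρ, ← Real.rpow_natCast, ← Real.rpow_natCast, ← Real.rpow_mul (by norm_num),
            ← Real.rpow_mul (by norm_num), mul_comm]
        rw [e2]
        have e3 : (2 ^ i * s) ^ (-(df + β)) * (2 ^ i * s) ^ df = (2 ^ i) ^ (-β) * s ^ (-β) := by
          rw [← Real.rpow_add (by positivity), ← Real.mul_rpow (by positivity) hs0.le]
          congr 1; ring
        linear_combination (c ^ 2 * 2 ^ df) * e3
    _ = ENNReal.ofReal (∑' i : ℕ, c ^ 2 * 2 ^ df * s ^ (-β) * ρ ^ i) := by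
        rw [ENNReal.ofReal_tsum_of_nonneg]
        · intro i; positivity
        · exact (summable_geometric_of_lt_one hρ0.le hρ1).mul_left _
    _ = _ := by
        rw [tsum_mul_left, tsum_geometric_of_lt_one hρ0.le hρ1]
        congr 1; ring

end Regular

end WeightedGraph

/-! ### Transition kernels with values in `[0, ∞]` and the rate of long jumps -/

namespace MarkovOperator

open KernelOp

variable {X : Type*} {K : MarkovOperator X} {G : WeightedGraph X} {df β c : ℝ}

/-- Uniform form of the assumptions on the jump kernel. -/
structure JumpBound (K : MarkovOperator X) (G : WeightedGraph X) (df β c : ℝ) : Prop where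
  one_le : 1 ≤ c
  symm : K.IsSymmetric G
  le_prob : ∀ x y, c⁻¹ * (1 + G.d x y) ^ (-(df + β)) ≤ K.prob x y
  prob_le : ∀ x y, K.prob x y ≤ c * (1 + G.d x y) ^ (-(df + β))

/-- The transition probabilities with values in `[0, ∞]`. -/
noncomputable def eprob (K : MarkovOperator X) (x y : X) : ℝ≥0∞ := ENNReal.ofReal (K.prob x y)

theorem tsum_eprob (x : X) : ∑' y, K.eprob x y = 1 := by
  simp only [eprob]
  rw [← ENNReal.ofReal_tsum_of_nonneg (K.prob_nonneg x) (K.hasSum_prob x).summable,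
    (K.hasSum_prob x).tsum_eq, ENNReal.ofReal_one]

theorem tsum_eprob_le (x : X) : ∑' y, K.eprob x y ≤ 1 := (tsum_eprob x).le

theorem symm_eprob (h : G.Regular df c) (hK : K.IsSymmetric G) : Symm G.emass K.eprob := by
  intro x y
  rw [WeightedGraph.emass, WeightedGraph.emass, eprob, eprob,
    ← ENNReal.ofReal_mul (h.mass_pos x).le, ← ENNReal.ofReal_mul (h.mass_pos y).le, hK x y]

open Classical in
-- The passage from real series to series in `[0, ∞]`. The bounds `0` and `1` are part of the
-- induction because they give the summability without which the real `tsum` would be a default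
-- value.
theorem op_iterate_aux (n : ℕ) (x y : X) :
    0 ≤ K.op^[n] (Pi.single y 1) x ∧ K.op^[n] (Pi.single y 1) x ≤ 1 ∧
      (act K.eprob)^[n] (dirac y) x = ENNReal.ofReal (K.op^[n] (Pi.single y 1) x) := by
  induction n generalizing x with
  | zero =>
    by_cases h : x = y
    · subst h; simp [dirac]
    · simp [dirac, h]
  | succ n ih =>
    simp only [Function.iterate_succ_apply']
    have hle : ∀ z, K.prob x z * K.op^[n] (Pi.single y 1) z ≤ K.prob x z := fun z =>
      mul_le_of_le_one_right (K.prob_nonneg x z) (ih z).2.1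
    have h0 : ∀ z, 0 ≤ K.prob x z * K.op^[n] (Pi.single y 1) z := fun z =>
      mul_nonneg (K.prob_nonneg x z) (ih z).1
    have hs : Summable fun z => K.prob x z * K.op^[n] (Pi.single y 1) z :=
      (K.hasSum_prob x).summable.of_nonneg_of_le h0 hle
    refine ⟨tsum_nonneg h0, ?_, ?_⟩
    · exact (hs.tsum_le_tsum hle (K.hasSum_prob x).summable).trans (K.hasSum_prob x).tsum_eq.le
    · rw [op, ENNReal.ofReal_tsum_of_nonneg h0 hs, act]
      refine tsum_congr fun z => ?_
      rw [(ih z).2.2, eprob, ENNReal.ofReal_mul (K.prob_nonneg x z)]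

theorem kernel_nonneg (h : G.Regular df c) (n : ℕ) (x y : X) : 0 ≤ K.kernel G n x y :=
  div_nonneg (op_iterate_aux n x y).1 (h.mass_pos y).le

theorem iter_dirac_eq (h : G.Regular df c) (n : ℕ) (x y : X) :
    (act K.eprob)^[n] (dirac y) x = ENNReal.ofReal (K.kernel G n x y * G.mass y) := by
  rw [(op_iterate_aux n x y).2.2, kernel, div_mul_cancel₀ _ (h.mass_pos y).ne']

theorem prob_eq (h : G.Regular df c) (x y : X) : K.prob x y = K.kernel G 1 x y * G.mass y := by
  have h1 := iter_dirac_eq (K := K) h 1 x y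
  rw [Function.iterate_one, act_dirac, eprob,
    ENNReal.ofReal_eq_ofReal_iff (K.prob_nonneg x y)
      (mul_nonneg (kernel_nonneg h 1 x y) (h.mass_pos y).le)] at h1
  exact h1

theorem exists_jumpBound (h : G.Regular df c) (hK : K.IsSymmetric G)
    (hJ : K.SatisfiesJ G df β) : ∃ a, K.JumpBound G df β a := by
  obtain ⟨-, C, hC, hb⟩ := hJ
  have hc := h.one_le
  have e : ∀ x y : X, 1 / (1 + G.d x y) ^ (df + β) = (1 + G.d x y) ^ (-(df + β)) := fun x y => by
    rw [Real.rpow_neg (by linarith [G.d_nonneg x y]), one_div]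
  have hp : ∀ x y : X, 0 < (1 + G.d x y) ^ (-(df + β)) := fun x y =>
    Real.rpow_pos_of_pos (by linarith [G.d_nonneg x y]) _
  refine ⟨max 1 (C * c), le_max_left _ _, hK, fun x y => ?_, fun x y => ?_⟩
  · rw [prob_eq h]
    calc (max 1 (C * c))⁻¹ * (1 + G.d x y) ^ (-(df + β))
        ≤ (C * c)⁻¹ * (1 + G.d x y) ^ (-(df + β)) := by
          gcongr
          · exact (hp x y).le
          · exact le_max_right _ _
      _ = (C⁻¹ * (1 / (1 + G.d x y) ^ (df + β))) * c⁻¹ := by rw [e, mul_inv]; ring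
      _ ≤ _ := by
          gcongr
          · exact kernel_nonneg h 1 x y
          · exact (hb x y).1
          · exact h.inv_le_mass y
  · rw [prob_eq h]
    calc K.kernel G 1 x y * G.mass y ≤ (C * (1 / (1 + G.d x y) ^ (df + β))) * c := by
          gcongr
          · exact (h.mass_pos y).le
          · rw [e]; exact mul_nonneg hC.le (hp x y).le
          · exact (hb x y).2
          · exact h.mass_le y
      _ = (C * c) * (1 + G.d x y) ^ (-(df + β)) := by rw [e]; ring
      _ ≤ _ := mul_le_mul_of_nonneg_right (le_max_right _ _) (hp x y).le

open Classical in
/-- The probability of a long jump. -/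
theorem JumpBound.exists_tail_bound {a : ℝ} (hJ : K.JumpBound G df β a) (h : G.Regular df c)
    (hβ : 0 < β) : ∃ C, 0 < C ∧ ∀ (x : X) (s : ℝ), 1 ≤ s →
      ∑' y, (if s < G.d x y then K.eprob x y else 0) ≤ ENNReal.ofReal (C * s ^ (-β)) := by
  obtain ⟨C, hC, hb⟩ := h.exists_tail_bound hβ
  have ha := hJ.one_le
  have hdf := h.df_pos
  refine ⟨a * C, by positivity, fun x s hs => ?_⟩
  rw [mul_assoc, ENNReal.ofReal_mul (by linarith)]
  refine le_trans ?_ (mul_le_mul' le_rfl (hb x s hs))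
  rw [← ENNReal.tsum_mul_left]
  refine ENNReal.tsum_le_tsum fun y => ?_
  split_ifs with hy
  · rw [← ENNReal.ofReal_mul (by linarith)]
    refine ENNReal.ofReal_le_ofReal ((hJ.prob_le x y).trans ?_)
    gcongr a * ?_
    exact Real.rpow_le_rpow_of_nonpos (by linarith) (by linarith) (by linarith)
  · exact zero_le

end MarkovOperator

/-! ### The on-diagonal upper bound -/

namespace KernelOp

variable {X : Type*}

theorem ennreal_two_mul_le (a b : ℝ≥0∞) : 2 * (a * b) ≤ a * a + b * b := by
  wlog h : a ≤ b generalizing a b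
  · rw [mul_comm a b, add_comm]
    exact this b a (le_of_not_ge h)
  obtain ⟨e, rfl⟩ := exists_add_of_le h
  calc 2 * (a * (a + e)) ≤ 2 * (a * (a + e)) + e * e := le_self_add
    _ = _ := by ring

theorem two_mul_pairing_le (m f g : X → ℝ≥0∞) :
    2 * pairing m f g ≤ pairing m f f + pairing m g g := by
  simp only [pairing]
  rw [← ENNReal.tsum_mul_left, ← ENNReal.tsum_add]
  refine ENNReal.tsum_le_tsum fun x => ?_
  calc 2 * (m x * (f x * g x)) = m x * (2 * (f x * g x)) := by ring
    _ ≤ m x * (f x * f x + g x * g x) := by gcongr; exact ennreal_two_mul_le _ _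
    _ = _ := by ring

/-- Schur's test: `2 f(x) f(y) ≤ f(x)² + f(y)²`, and symmetry makes both halves equal. -/
theorem pairing_act_le {m : X → ℝ≥0∞} {p : X → X → ℝ≥0∞} (hs : Symm m p) (f : X → ℝ≥0∞) :
    pairing m f (act p f) ≤ ∑' x, m x * (f x * f x) * ∑' y, p x y := by
  have h2 : 2 * pairing m f (act p f) ≤ 2 * ∑' x, m x * (f x * f x) * ∑' y, p x y := by
    have e : ∑' x, ∑' y, m x * p x y * (f y * f y) = ∑' x, ∑' y, m x * p x y * (f x * f x) := by
      rw [ENNReal.tsum_comm]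
      exact tsum_congr fun y => tsum_congr fun x => by rw [hs x y]
    calc 2 * pairing m f (act p f)
        = ∑' x, ∑' y, m x * p x y * (2 * (f x * f y)) := by
          simp only [pairing, act, ← ENNReal.tsum_mul_left]
          exact tsum_congr fun x => tsum_congr fun y => by ring
      _ ≤ ∑' x, ∑' y, m x * p x y * (f x * f x + f y * f y) :=
          ENNReal.tsum_le_tsum fun x => ENNReal.tsum_le_tsum fun y =>
            mul_le_mul' le_rfl (ennreal_two_mul_le _ _)
      _ = 2 * ∑' x, ∑' y, m x * p x y * (f x * f x) := by
          simp only [mul_add, ENNReal.tsum_add]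
          rw [e, two_mul]
      _ = _ := by
          congr 1
          refine tsum_congr fun x => ?_
          rw [← ENNReal.tsum_mul_left]
          exact tsum_congr fun y => by ring
  exact (ENNReal.mul_le_mul_iff_right (by norm_num) (by norm_num)).1 h2

/-- A Nash type inequality: a symmetric Markov operator contracts the `L²` norm as soon as its
kernel dominates a kernel with large row sums. -/
theorem pairing_contract {m : X → ℝ≥0∞} (hm : ∀ x, m x ≠ ∞) {Q b : X → X → ℝ≥0∞} (hs : Symm m Q)
    (hsb : Symm m b) (hQ : ∀ x, ∑' y, Q x y = 1) (hbQ : ∀ x y, b x y ≤ Q x y) {V : ℝ≥0∞}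
    (hV : ∀ x, V ≤ ∑' y, b x y) (f : X → ℝ≥0∞) :
    pairing m f (act Q f) + V * pairing m f f ≤ pairing m f f + pairing m f (act b f) := by
  have hsplit : ∀ x y, Q x y = (Q x y - b x y) + b x y := fun x y =>
    (tsub_add_cancel_of_le (hbQ x y)).symm
  have hsq : Symm m fun x y => Q x y - b x y := by
    intro x y
    rw [ENNReal.mul_sub fun _ _ => hm x, ENNReal.mul_sub fun _ _ => hm y, hs x y, hsb x y]
  have e1 : pairing m f (act Q f) =
      pairing m f (act (fun x y => Q x y - b x y) f) + pairing m f (act b f) := by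
    have : ∀ x, act Q f x = act (fun x y => Q x y - b x y) f x + act b f x := fun x => by
      rw [← act_add_left]
      exact tsum_congr fun y => by simp only [← hsplit]
    simp only [pairing]
    rw [← ENNReal.tsum_add]
    exact tsum_congr fun x => by rw [this x]; ring
  -- Schur's test for `Q - b`: its row sums are those of `Q`, namely `1`, less those of `b`, which
  -- are at least `V`.
  have e2 : pairing m f (act (fun x y => Q x y - b x y) f) + V * pairing m f f ≤
      pairing m f f := by
    refine (add_le_add_left (pairing_act_le hsq f) _).trans ?_
    simp only [pairing]
    rw [← ENNReal.tsum_mul_left, ← ENNReal.tsum_add]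
    refine ENNReal.tsum_le_tsum fun x => ?_
    calc m x * (f x * f x) * ∑' y, (Q x y - b x y) + V * (m x * (f x * f x))
        ≤ m x * (f x * f x) * ∑' y, (Q x y - b x y) + (∑' y, b x y) * (m x * (f x * f x)) := by
          gcongr; exact hV x
      _ = m x * (f x * f x) * ∑' y, ((Q x y - b x y) + b x y) := by
          rw [ENNReal.tsum_add]; ring
      _ = m x * (f x * f x) := by
          simp only [← hsplit]
          rw [hQ, mul_one]
  calc pairing m f (act Q f) + V * pairing m f f
      = (pairing m f (act (fun x y => Q x y - b x y) f) + V * pairing m f f)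
        + pairing m f (act b f) := by rw [e1]; ring
    _ ≤ _ := by gcongr

end KernelOp

/-- A discrete Nash argument with `ν = df / β`. Choosing `r^β = n / κ` with `κ = 2ν / k₁` makes the
contraction factor `1 - 2ν/n`, whereas `n^{-ν}` loses at most a factor `1 - ν/n` per step; the spare
`ν/n` absorbs the forcing term, which is of order `n^{-1-ν}`. Small `n` are covered by the a priori
bound `B`. -/
theorem decay_of_recursion {df β k₁ k₂ B : ℝ} (hdf : 0 < df) (hβ : 0 < β) (hk₁ : 0 < k₁)
    (hk₂ : 0 < k₂) (hB : 0 < B) : ∃ C, 0 < C ∧ ∀ a : ℕ → ℝ, (∀ n, 0 ≤ a n) → (∀ n, a n ≤ B) →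
      (∀ n r, 1 ≤ r → a (n + 1) ≤ (1 - k₁ * r ^ (-β)) * a n + k₂ * r ^ (-(df + β))) →
      ∀ n : ℕ, 1 ≤ n → a n ≤ C * (n : ℝ) ^ (-(df / β)) := by
  set ν := df / β with hν
  have hν0 : 0 < ν := div_pos hdf hβ
  set κ := 2 * ν / k₁ with hκ
  have hκ0 : 0 < κ := by positivity
  set n₀ := max κ (2 * ν) with hn₀
  have hn₀0 : 0 < n₀ := lt_max_of_lt_left hκ0
  set C := B * (n₀ + 1) ^ ν + k₂ * κ ^ (1 + ν) / ν with hC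
  have hC0 : 0 < C := by positivity
  refine ⟨C, hC0, fun a ha0 haB hrec n hn => ?_⟩
  induction n, hn using Nat.le_induction with
  | base =>
    simp only [Nat.cast_one, Real.one_rpow, mul_one]
    refine (haB 1).trans ?_
    have : 1 ≤ (n₀ + 1) ^ ν := Real.one_le_rpow (by linarith) hν0.le
    have h2 : 0 ≤ k₂ * κ ^ (1 + ν) / ν := by positivity
    nlinarith
  | succ n hn ih =>
    have hnpos : (0 : ℝ) < n := by exact_mod_cast hn
    rcases le_total n₀ n with hbig | hsmall
    · have hκn : κ ≤ n := (le_max_left _ _).trans hbig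
      have hνn : 2 * ν ≤ n := (le_max_right _ _).trans hbig
      have hr : 1 ≤ ((n : ℝ) / κ) ^ (1 / β) :=
        Real.one_le_rpow (by rwa [one_le_div hκ0]) (by positivity)
      have h1 := hrec n _ hr
      have e1 : (((n : ℝ) / κ) ^ (1 / β)) ^ (-β) = κ / n := by
        rw [← Real.rpow_mul (by positivity)]
        have : 1 / β * -β = -1 := by field_simp
        rw [this, Real.rpow_neg_one, inv_div]
      have e2 : (((n : ℝ) / κ) ^ (1 / β)) ^ (-(df + β)) = κ ^ (1 + ν) / n * (n : ℝ) ^ (-ν) := by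
        rw [← Real.rpow_mul (by positivity)]
        have : 1 / β * -(df + β) = -(1 + ν) := by rw [hν]; field_simp; ring
        rw [this, Real.rpow_neg (by positivity), Real.div_rpow hnpos.le hκ0.le, inv_div,
          Real.rpow_add hnpos, Real.rpow_one, Real.rpow_neg hnpos.le]
        field_simp
      rw [e1, e2] at h1
      have hk : k₁ * (κ / n) = 2 * ν / n := by rw [hκ]; field_simp
      rw [hk] at h1
      have hfac : 0 ≤ 1 - 2 * ν / n := by
        rw [sub_nonneg, div_le_one hnpos]; exact hνn
      have hP : 0 < (n : ℝ) ^ (-ν) := Real.rpow_pos_of_pos hnpos _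
      have hbern : (1 - ν / n) * (n : ℝ) ^ (-ν) ≤ ((n + 1 : ℕ) : ℝ) ^ (-ν) := by
        have e3 : ((n + 1 : ℕ) : ℝ) = n * (1 + 1 / n) := by push_cast; field_simp
        rw [e3, Real.mul_rpow hnpos.le (by positivity), mul_comm]
        refine mul_le_mul_of_nonneg_left ?_ hP.le
        have hpos1 : (0 : ℝ) < 1 + 1 / n := by positivity
        rw [Real.rpow_def_of_pos hpos1]
        have hlog : Real.log (1 + 1 / n) ≤ 1 / n := by
          have := Real.log_le_sub_one_of_pos hpos1
          linarith
        have h5 := Real.add_one_le_exp (Real.log (1 + 1 / (n : ℝ)) * -ν)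
        have h6 : ν / n = ν * (1 / n) := by ring
        rw [h6]
        nlinarith
      have hCk : k₂ * κ ^ (1 + ν) ≤ C * ν := by
        rw [hC, add_mul, div_mul_cancel₀ _ hν0.ne']
        have : 0 ≤ B * (n₀ + 1) ^ ν * ν := by positivity
        linarith
      calc a (n + 1) ≤ (1 - 2 * ν / n) * a n + k₂ * (κ ^ (1 + ν) / n * (n : ℝ) ^ (-ν)) := h1
        _ ≤ (1 - 2 * ν / n) * (C * (n : ℝ) ^ (-ν)) + (C * ν) / n * (n : ℝ) ^ (-ν) := by
            have : k₂ * (κ ^ (1 + ν) / n * (n : ℝ) ^ (-ν)) =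
              (k₂ * κ ^ (1 + ν)) / n * (n : ℝ) ^ (-ν) := by ring
            rw [this]
            gcongr
        _ = C * ((1 - ν / n) * (n : ℝ) ^ (-ν)) := by ring
        _ ≤ _ := mul_le_mul_of_nonneg_left hbern hC0.le
    · refine (haB _).trans ?_
      have h1 : (n₀ + 1) ^ (-ν) ≤ ((n + 1 : ℕ) : ℝ) ^ (-ν) := by
        apply Real.rpow_le_rpow_of_nonpos (by positivity) _ (by linarith)
        push_cast
        linarith
      have h2 : B * (n₀ + 1) ^ ν * (n₀ + 1) ^ (-ν) = B := by
        rw [mul_assoc, ← Real.rpow_add (by linarith)]; simp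
      calc B = B * (n₀ + 1) ^ ν * (n₀ + 1) ^ (-ν) := h2.symm
        _ ≤ C * (n₀ + 1) ^ (-ν) := by
            gcongr
            rw [hC]
            have : 0 ≤ k₂ * κ ^ (1 + ν) / ν := by positivity
            linarith
        _ ≤ _ := by gcongr

/-! ### Decay of the `L²` norm and the on-diagonal bound -/

namespace MarkovOperator

open KernelOp WeightedGraph

variable {X : Type*} {K : MarkovOperator X} {G : WeightedGraph X} {df β c a : ℝ}

theorem emass_ne_top (x : X) : G.emass x ≠ ∞ := ENNReal.ofReal_ne_top

/-- Conservation of mass: `K` fixes the constant `1`, and by symmetry so does its adjoint. -/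
theorem pairing_one_iter (h : G.Regular df c) (hK : K.IsSymmetric G) (n : ℕ) (y : X) :
    ∑' x, G.emass x * (act K.eprob)^[n] (dirac y) x = G.emass y := by
  have h1 := pairing_iter (symm_eprob h hK) (fun _ => 1) (dirac y) n
  rw [funext (iter_one (p := K.eprob) tsum_eprob n), pairing_comm (g := dirac y),
    pairing_dirac, mul_one] at h1
  rw [← h1]
  exact tsum_congr fun x => by rw [one_mul]

open Classical in
-- The contraction inequality for `Q = K²`, whose pairing with `u n` is the squared norm of `u (n +
-- 1)`. The comparison kernel `b` is flat on balls of radius `r`: its row sums are of order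
-- `r^{-β}`, and its quadratic form is at most `ε` times the squared `L¹` norm, which is conserved.
theorem l2_recursion (h : G.Regular df c) (hJ : K.JumpBound G df β a) (hβ : 0 < β) (y : X) (n : ℕ)
    {r : ℝ} (hr : 1 ≤ r) {u : ℕ → X → ℝ≥0∞} (hu : ∀ n, u n = (act K.eprob)^[n] (dirac y)) :
    pairing G.emass (u (n + 1)) (u (n + 1)) +
        ENNReal.ofReal (c⁻¹ ^ 2 * a⁻¹ ^ 2 * 2 ^ (-(df + β)) * r ^ (-β)) *
          pairing G.emass (u n) (u n) ≤
      pairing G.emass (u n) (u n) +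
        ENNReal.ofReal (c * a⁻¹ ^ 2 * 2 ^ (-(df + β)) * r ^ (-(df + β))) := by
  have hc := h.one_le
  have ha := hJ.one_le
  have hdf := h.df_pos
  have hs := symm_eprob h hJ.symm
  set γ := df + β with hγ
  set ε : ℝ := c⁻¹ * a⁻¹ ^ 2 * 2 ^ (-γ) * r ^ (-γ) with hε
  have hε0 : 0 ≤ ε := by positivity
  set Q : X → X → ℝ≥0∞ := fun x y => (act K.eprob)^[2] (dirac y) x with hQ
  set b : X → X → ℝ≥0∞ := fun x y => if G.d x y ≤ r then ENNReal.ofReal ε * G.emass y else 0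
    with hb
  have hactQ : ∀ f x, act Q f x = (act K.eprob)^[2] f x := fun f x =>
    (iter_eq_tsum f 2 x).symm
  have hQ1 : ∀ x, ∑' y, Q x y = 1 := fun x => by
    have h1 := hactQ (fun _ => 1) x
    rw [iter_one tsum_eprob 2 x] at h1
    simpa [act] using h1
  have hsb : Symm G.emass b := by
    intro x z
    simp only [hb, G.d_comm z x]
    split_ifs
    · ring
    · simp
  have hbQ : ∀ x z, b x z ≤ Q x z := by
    intro x z
    simp only [hb]
    split_ifs with hxz
    · have h1 : K.eprob x x * K.eprob x z ≤ Q x z := by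
        have : Q x z = ∑' w, K.eprob x w * K.eprob w z := by
          simp only [hQ]
          rw [Function.iterate_succ_apply', Function.iterate_one]
          exact tsum_congr fun w => by rw [act_dirac]
        rw [this]
        exact ENNReal.le_tsum (f := fun w => K.eprob x w * K.eprob w z) x
      refine le_trans ?_ h1
      rw [eprob, eprob, emass, ← ENNReal.ofReal_mul hε0, ← ENNReal.ofReal_mul (K.prob_nonneg _ _)]
      apply ENNReal.ofReal_le_ofReal
      have h2 : a⁻¹ ≤ K.prob x x := by
        have := hJ.le_prob x x
        rwa [G.d_self, add_zero, Real.one_rpow, mul_one] at this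
      have h3 : a⁻¹ * (2 ^ (-γ) * r ^ (-γ)) ≤ K.prob x z := by
        refine le_trans ?_ (hJ.le_prob x z)
        rw [← Real.mul_rpow (by norm_num) (by linarith)]
        refine mul_le_mul_of_nonneg_left ?_ (by positivity)
        exact Real.rpow_le_rpow_of_nonpos (by linarith [G.d_nonneg x z]) (by linarith)
          (by linarith)
      calc ε * G.mass z ≤ ε * c := by gcongr; exact h.mass_le z
        _ = a⁻¹ * (a⁻¹ * (2 ^ (-γ) * r ^ (-γ))) := by rw [hε]; field_simp
        _ ≤ _ := mul_le_mul h2 h3 (by positivity) (K.prob_nonneg x x)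
    · exact zero_le
  have hV : ∀ x, ENNReal.ofReal (c⁻¹ ^ 2 * a⁻¹ ^ 2 * 2 ^ (-γ) * r ^ (-β)) ≤ ∑' z, b x z := by
    intro x
    have e1 : ∑' z, b x z = ENNReal.ofReal ε * ENNReal.ofReal (G.vol x r) := by
      rw [← h.tsum_emass_ball, ← ENNReal.tsum_mul_left]
      exact tsum_congr fun z => by simp only [hb]; split_ifs <;> simp
    rw [e1, ← ENNReal.ofReal_mul hε0]
    apply ENNReal.ofReal_le_ofReal
    calc c⁻¹ ^ 2 * a⁻¹ ^ 2 * 2 ^ (-γ) * r ^ (-β) = ε * (c⁻¹ * r ^ df) := by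
          have : r ^ (-β) = r ^ (-γ) * r ^ df := by
            rw [← Real.rpow_add (by linarith)]; congr 1; rw [hγ]; ring
          rw [this, hε]; ring
      _ ≤ _ := by gcongr; exact h.le_vol x r hr
  have key := pairing_contract (m := G.emass) emass_ne_top (symm_iter hs 2) hsb hQ1 hbQ hV (u n)
  have e2 : pairing G.emass (u n) (act Q (u n)) = pairing G.emass (u (n + 1)) (u (n + 1)) := by
    rw [funext (hactQ (u n)), Function.iterate_succ_apply', Function.iterate_one, pairing_act hs,
      hu (n + 1), Function.iterate_succ_apply', hu n]
  rw [e2] at key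
  refine key.trans ?_
  gcongr
  have h4 : ∀ x, act b (u n) x ≤ ENNReal.ofReal ε * G.emass y := by
    intro x
    rw [← pairing_one_iter h hJ.symm n y, ← ENNReal.tsum_mul_left, act]
    refine ENNReal.tsum_le_tsum fun z => ?_
    rw [hu n, ← mul_assoc]
    gcongr
    simp only [hb]
    split_ifs
    · exact le_rfl
    · exact zero_le
  calc pairing G.emass (u n) (act b (u n))
      ≤ pairing G.emass (u n) (fun _ => ENNReal.ofReal ε * G.emass y) :=
        pairing_mono (fun _ => le_rfl) h4
    _ = G.emass y * (ENNReal.ofReal ε * G.emass y) := by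
        simp only [pairing, ← mul_assoc, ENNReal.tsum_mul_right]
        rw [hu n, pairing_one_iter h hJ.symm n y]
    _ ≤ ENNReal.ofReal c * (ENNReal.ofReal ε * ENNReal.ofReal c) := by
        have : G.emass y ≤ ENNReal.ofReal c := ENNReal.ofReal_le_ofReal (h.mass_le y)
        gcongr
    _ = _ := by
        rw [← ENNReal.ofReal_mul hε0, ← ENNReal.ofReal_mul (by linarith)]
        congr 1
        rw [hε]; field_simp

/-- The on-diagonal upper bound. -/
theorem JumpBound.exists_diagonal_bound (hJ : K.JumpBound G df β a) (h : G.Regular df c)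
    (hβ : 0 < β) : ∃ C, 0 < C ∧ ∀ n : ℕ, 1 ≤ n → ∀ x y,
      (act K.eprob)^[n] (dirac y) x ≤ ENNReal.ofReal (C * (n : ℝ) ^ (-(df / β))) := by
  have hc := h.one_le
  have ha := hJ.one_le
  have hdf := h.df_pos
  have hs := symm_eprob h hJ.symm
  have hν : 0 < df / β := div_pos hdf hβ
  obtain ⟨C, hC, hrec⟩ := decay_of_recursion (k₁ := c⁻¹ ^ 2 * a⁻¹ ^ 2 * 2 ^ (-(df + β)))
    (k₂ := c * a⁻¹ ^ 2 * 2 ^ (-(df + β))) (B := c) hdf hβ (by positivity) (by positivity)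
    (by positivity)
  have hd1 : ∀ y z : X, dirac y z ≤ 1 := fun y z => by
    classical
    by_cases hz : z = y
    · subst hz; simp [dirac]
    · simp [dirac, hz]
  have hsq : ∀ n y, pairing G.emass ((act K.eprob)^[n] (dirac y)) ((act K.eprob)^[n] (dirac y)) ≤
      ENNReal.ofReal c := by
    intro n y
    rw [← pairing_iter hs, pairing_dirac]
    refine (mul_le_of_le_one_right' ?_).trans (ENNReal.ofReal_le_ofReal (h.mass_le y))
    exact iter_le_const tsum_eprob_le (iter_le_const tsum_eprob_le (hd1 y) n) n y
  have hL2 : ∀ n : ℕ, 1 ≤ n → ∀ y,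
      pairing G.emass ((act K.eprob)^[n] (dirac y)) ((act K.eprob)^[n] (dirac y)) ≤
        ENNReal.ofReal (C * (n : ℝ) ^ (-(df / β))) := by
    intro n hn y
    have hfin : ∀ n, pairing G.emass ((act K.eprob)^[n] (dirac y)) ((act K.eprob)^[n] (dirac y)) ≠ ∞ :=
      fun n => ne_top_of_le_ne_top ENNReal.ofReal_ne_top (hsq n y)
    have h1 := hrec (fun n => (pairing G.emass ((act K.eprob)^[n] (dirac y))
      ((act K.eprob)^[n] (dirac y))).toReal) (fun n => ENNReal.toReal_nonneg)
      (fun n => ENNReal.toReal_le_of_le_ofReal (by linarith) (hsq n y)) ?_ n hn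
    · rw [← ENNReal.ofReal_toReal (hfin n)]
      exact ENNReal.ofReal_le_ofReal h1
    · intro n r hr
      have h2 := l2_recursion h hJ hβ y n hr (u := fun n => (act K.eprob)^[n] (dirac y))
        (fun n => rfl)
      have hr0 : 0 < r := by linarith
      have h3 := ENNReal.toReal_mono (ENNReal.add_ne_top.2 ⟨hfin n, ENNReal.ofReal_ne_top⟩) h2
      rw [ENNReal.toReal_add (hfin _) (ENNReal.mul_ne_top ENNReal.ofReal_ne_top (hfin _)),
        ENNReal.toReal_add (hfin _) ENNReal.ofReal_ne_top, ENNReal.toReal_mul,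
        ENNReal.toReal_ofReal (by positivity), ENNReal.toReal_ofReal (by positivity)] at h3
      linarith
  -- At time `2n` the kernel is the pairing of two functions at time `n`, so the `L²` bounds
  -- suffice.
  have heven : ∀ n : ℕ, 1 ≤ n → ∀ x y, (act K.eprob)^[n + n] (dirac y) x ≤
      ENNReal.ofReal (c * C * (n : ℝ) ^ (-(df / β))) := by
    intro n hn x y
    have h1 : 2 * (G.emass x * (act K.eprob)^[n + n] (dirac y) x) ≤
        2 * ENNReal.ofReal (C * (n : ℝ) ^ (-(df / β))) := by
      rw [← pairing_dirac, Function.iterate_add_apply, pairing_iter hs, two_mul (ENNReal.ofReal _)]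
      exact (two_mul_pairing_le _ _ _).trans (add_le_add (hL2 n hn x) (hL2 n hn y))
    have h2 := (ENNReal.mul_le_mul_iff_right (by norm_num) (by norm_num)).1 h1
    have h3 : 1 ≤ ENNReal.ofReal c * G.emass x := by
      rw [emass, ← ENNReal.ofReal_mul (by linarith), ← ENNReal.ofReal_one]
      apply ENNReal.ofReal_le_ofReal
      have := h.inv_le_mass x
      rwa [inv_le_iff_one_le_mul₀' (by linarith)] at this
    calc (act K.eprob)^[n + n] (dirac y) x
        ≤ (ENNReal.ofReal c * G.emass x) * (act K.eprob)^[n + n] (dirac y) x :=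
          le_mul_of_one_le_left' h3
      _ = ENNReal.ofReal c * (G.emass x * (act K.eprob)^[n + n] (dirac y) x) := by ring
      _ ≤ ENNReal.ofReal c * ENNReal.ofReal (C * (n : ℝ) ^ (-(df / β))) := by gcongr
      _ = _ := by rw [← ENNReal.ofReal_mul (by linarith), mul_assoc]
  refine ⟨1 + c * C * 3 ^ (df / β), by positivity, fun n hn x y => ?_⟩
  rcases Nat.lt_or_ge n 2 with h2 | h2
  · obtain rfl : n = 1 := by omega
    refine (iter_le_const tsum_eprob_le (hd1 y) 1 x).trans ?_
    rw [← ENNReal.ofReal_one]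
    apply ENNReal.ofReal_le_ofReal
    have : 0 ≤ c * C * 3 ^ (df / β) := by positivity
    simpa using this
  · have hk : 1 ≤ n / 2 := by omega
    have hle : ∀ x, (act K.eprob)^[n / 2 + n / 2] (dirac y) x ≤
        ENNReal.ofReal ((1 + c * C * 3 ^ (df / β)) * (n : ℝ) ^ (-(df / β))) := by
      intro x
      refine (heven _ hk x y).trans (ENNReal.ofReal_le_ofReal ?_)
      have h3 : (n : ℝ) / 3 ≤ ((n / 2 : ℕ) : ℝ) := by
        rw [div_le_iff₀ (by norm_num)]
        have : n ≤ n / 2 * 3 := by omega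
        exact_mod_cast this
      have hn0 : (0 : ℝ) < n := by positivity
      have h4 : ((n / 2 : ℕ) : ℝ) ^ (-(df / β)) ≤ 3 ^ (df / β) * (n : ℝ) ^ (-(df / β)) := by
        refine (Real.rpow_le_rpow_of_nonpos (by positivity) h3 (by linarith)).trans ?_
        rw [Real.div_rpow hn0.le (by norm_num), Real.rpow_neg (by norm_num : (0 : ℝ) ≤ 3), div_inv_eq_mul,
          mul_comm]
      have h5 : 0 ≤ (n : ℝ) ^ (-(df / β)) := by positivity
      calc c * C * ((n / 2 : ℕ) : ℝ) ^ (-(df / β))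
          ≤ c * C * (3 ^ (df / β) * (n : ℝ) ^ (-(df / β))) := by gcongr
        _ ≤ _ := by nlinarith
    rcases Nat.even_or_odd' n with ⟨k, hk' | hk'⟩
    · have : n / 2 + n / 2 = n := by omega
      have h6 := hle x
      rwa [this] at h6
    -- At odd times one further step does not increase the supremum.
    · have e : n = (n / 2 + n / 2) + 1 := by omega
      have h6 : (act K.eprob)^[n] (dirac y) x =
          act K.eprob ((act K.eprob)^[n / 2 + n / 2] (dirac y)) x := by
        conv_lhs => rw [e]
        rw [Function.iterate_succ_apply']
      rw [h6]
      exact (act_mono_right hle x).trans (act_const_le tsum_eprob_le _ x)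

end MarkovOperator

/-! ### Cutoff functions -/

open Classical in
-- Since the supports are disjoint, at most two of the cutoffs can distinguish a given pair `x`,
-- `y`. Hence the energy is counted twice, giving `8 = 2 · 4`, and the constant does not depend on
-- the number of cutoffs.
theorem sum_energy_cutoff {X ι : Type*} {Ω : Finset X} {I : Finset ι} {J : X → X → ℝ}
    (hJ : ∀ x y, 0 ≤ J x y) (hs : ∀ x y, J x y = J y x) {h : ι → X → ℝ}
    (h0 : ∀ k x, 0 ≤ h k x) (h1 : ∀ k x, h k x ≤ 1)
    (hdisj : ∀ x, ∀ k ∈ I, ∀ l ∈ I, h k x ≠ 0 → h l x ≠ 0 → k = l) {w : X → ℝ}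
    (hw : ∀ x, 0 ≤ w x) {E : ℝ} (hE : 0 ≤ E)
    (hsol : ∀ k ∈ I, ∀ x ∈ Ω, ∑ y ∈ Ω, J x y * (h k x - h k y) ≤ E * w x) (f : X → ℝ) :
    ∑ k ∈ I, ∑ x ∈ Ω, ∑ y ∈ Ω, J x y * (f x ^ 2 * (h k x - h k y) ^ 2) ≤
      8 * ∑ x ∈ Ω, ∑ y ∈ Ω, J x y * (f x - f y) ^ 2 + 4 * E * ∑ x ∈ Ω, w x * f x ^ 2 := by
  have hcard : ∀ x, (∑ k ∈ I, if h k x ≠ 0 then (1 : ℝ) else 0) ≤ 1 := by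
    intro x
    rw [← Finset.sum_filter, Finset.sum_const, nsmul_eq_mul, mul_one]
    have : (I.filter fun k => h k x ≠ 0).card ≤ 1 := by
      rw [Finset.card_le_one]
      intro k hk l hl
      rw [Finset.mem_filter] at hk hl
      exact hdisj x k hk.1 l hl.1 hk.2 hl.2
    exact_mod_cast this
  have hsum1 : ∀ x, ∑ k ∈ I, h k x ≤ 1 := fun x =>
    (Finset.sum_le_sum fun k _ => by
      by_cases hk : h k x = 0
      · simp [hk]
      · simpa [hk] using h1 k x).trans (hcard x)
  have hne : ∀ x y, (∑ k ∈ I, if h k x = h k y then (0 : ℝ) else 1) ≤ 2 := by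
    intro x y
    have : (∑ k ∈ I, if h k x = h k y then (0 : ℝ) else 1) ≤
        ∑ k ∈ I, ((if h k x ≠ 0 then (1 : ℝ) else 0) + if h k y ≠ 0 then (1 : ℝ) else 0) := by
      refine Finset.sum_le_sum fun k _ => ?_
      by_cases hxy : h k x = h k y
      · rw [if_pos hxy]
        split_ifs <;> norm_num
      · rw [if_neg hxy]
        by_cases hx : h k x = 0
        · have hy : h k y ≠ 0 := fun hy => hxy (hx.trans hy.symm)
          rw [if_pos hy]
          split_ifs <;> norm_num
        · rw [if_pos hx]
          split_ifs <;> norm_num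
    rw [Finset.sum_add_distrib] at this
    linarith [hcard x, hcard y]
  have step : ∀ k ∈ I, ∑ x ∈ Ω, ∑ y ∈ Ω, J x y * (f x ^ 2 * (h k x - h k y) ^ 2) ≤
      4 * ∑ x ∈ Ω, E * w x * f x ^ 2 * h k x +
      4 * ∑ x ∈ Ω, ∑ y ∈ Ω, J x y * (f x - f y) ^ 2 * (if h k x = h k y then 0 else 1) := by
    intro k hk
    refine (energy_cutoff hJ hs (h0 k) (h1 k) f).trans ?_
    simp only [Finset.sum_add_distrib, ← Finset.mul_sum]
    gcongr 4 * ?_ + 4 * ?_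
    · refine Finset.sum_le_sum fun x hx => ?_
      calc ∑ y ∈ Ω, J x y * (f x ^ 2 * h k x * (h k x - h k y))
          = (f x ^ 2 * h k x) * ∑ y ∈ Ω, J x y * (h k x - h k y) := by
            rw [Finset.mul_sum]; exact Finset.sum_congr rfl fun y _ => by ring
        _ ≤ (f x ^ 2 * h k x) * (E * w x) :=
            mul_le_mul_of_nonneg_left (hsol k hk x hx) (mul_nonneg (sq_nonneg _) (h0 k x))
        _ = _ := by ring
    · refine Finset.sum_le_sum fun x _ => Finset.sum_le_sum fun y _ => ?_
      split_ifs <;> simp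
  refine (Finset.sum_le_sum step).trans ?_
  rw [Finset.sum_add_distrib, ← Finset.mul_sum, ← Finset.mul_sum, add_comm]
  have e1 : ∑ k ∈ I, ∑ x ∈ Ω, E * w x * f x ^ 2 * h k x ≤ E * ∑ x ∈ Ω, w x * f x ^ 2 := by
    rw [Finset.sum_comm, Finset.mul_sum]
    refine Finset.sum_le_sum fun x _ => ?_
    rw [← Finset.mul_sum]
    have : 0 ≤ E * w x * f x ^ 2 := mul_nonneg (mul_nonneg hE (hw x)) (sq_nonneg _)
    nlinarith [hsum1 x]
  have e2 : ∑ k ∈ I, ∑ x ∈ Ω, ∑ y ∈ Ω, J x y * (f x - f y) ^ 2 *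
      (if h k x = h k y then 0 else 1) ≤ 2 * ∑ x ∈ Ω, ∑ y ∈ Ω, J x y * (f x - f y) ^ 2 := by
    rw [Finset.sum_comm, Finset.mul_sum]
    refine Finset.sum_le_sum fun x _ => ?_
    rw [Finset.sum_comm, Finset.mul_sum]
    refine Finset.sum_le_sum fun y _ => ?_
    rw [← Finset.mul_sum]
    have : 0 ≤ J x y * (f x - f y) ^ 2 := mul_nonneg (hJ x y) (sq_nonneg _)
    nlinarith [hne x y]
  linarith

namespace MarkovOperator

open KernelOp WeightedGraph

variable {X : Type*} {K : MarkovOperator X} {G : WeightedGraph X} {df β c a : ℝ}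

/-- Tightness: within `m` steps the walk moves by more than `s` with probability `O(m / s ^ β)`. -/
def Tight (K : MarkovOperator X) (G : WeightedGraph X) (β C : ℝ) : Prop :=
  ∀ (x : X) (s : ℝ) (m : ℕ), 1 ≤ s →
    (act K.eprob)^[m] (Set.indicator (G.ball x s)ᶜ 1) x ≤ ENNReal.ofReal (C * m * s ^ (-β))

/-- Summing the off-diagonal upper bound outside the ball; the lower bound of the estimate plays no
part. -/
theorem SatisfiesHKP.exists_tight (h : G.Regular df c) (hβ : 0 < β)
    (hK : K.SatisfiesHKP G df β) : ∃ C, 0 < C ∧ K.Tight G β C := by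
  classical
  obtain ⟨A, hA, hb⟩ := hK
  obtain ⟨T, hT, htail⟩ := h.exists_tail_bound hβ
  have hc := h.one_le
  refine ⟨A * c * T, by positivity, fun x s m hs => ?_⟩
  rcases Nat.eq_zero_or_pos m with rfl | hm
  · simp [mem_ball, G.d_self, show (0 : ℝ) ≤ s by linarith]
  have e : A * c * T * m * s ^ (-β) = (A * c * m) * (T * s ^ (-β)) := by ring
  rw [iter_eq_tsum, e, ENNReal.ofReal_mul (by positivity)]
  refine le_trans ?_ (mul_le_mul' le_rfl (htail x s hs))
  rw [← ENNReal.tsum_mul_left]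
  refine ENNReal.tsum_le_tsum fun y => ?_
  by_cases hy : s < G.d x y
  · have hy' : y ∈ (G.ball x s)ᶜ := by simpa [mem_ball] using hy
    rw [if_pos hy, Set.indicator_of_mem hy', Pi.one_apply, mul_one, iter_dirac_eq h,
      ← ENNReal.ofReal_mul (by positivity)]
    apply ENNReal.ofReal_le_ofReal
    have hd : 0 < G.d x y := by linarith
    have h1 : K.kernel G m x y ≤ A * (m * G.d x y ^ (-(df + β))) := by
      refine (hb m hm x y).2.trans ?_
      rw [hkpProfile, if_neg hd.ne']
      gcongr
      refine (min_le_right _ _).trans (le_of_eq ?_)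
      rw [Real.rpow_neg hd.le, div_eq_mul_inv]
    calc K.kernel G m x y * G.mass y ≤ (A * (m * G.d x y ^ (-(df + β)))) * c := by
          gcongr
          · exact (h.mass_pos y).le
          · exact h.mass_le y
      _ = _ := by ring
  · have hy' : y ∉ (G.ball x s)ᶜ := by simpa [mem_ball] using hy
    rw [Set.indicator_of_notMem hy', mul_zero]
    exact zero_le

/-- A function on an annulus with bounded generator. -/
theorem Tight.exists_cutoff {C : ℝ} (hC : 0 < C) (hT : K.Tight G β C) (hβ : 0 < β) :
    ∃ s₀ C₀ : ℝ, 1 ≤ s₀ ∧ 0 < C₀ ∧ ∀ s, s₀ ≤ s → ∀ (x₀ : X) (b : ℝ), ∃ h : X → ℝ,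
      (∀ x, 0 ≤ h x) ∧ (∀ x, h x ≤ 1) ∧ (∀ x, h x ≠ 0 → |G.d x₀ x - b| ≤ 3 * s) ∧
      (∀ x, |G.d x₀ x - b| ≤ s → 1 / 2 ≤ h x) ∧
      ∀ Ω : Finset X, (∀ x, h x ≠ 0 → x ∈ Ω) → ∀ x,
        h x ≤ ∑ y ∈ Ω, K.prob x y * h y + C₀ * s ^ (-β) := by
  refine ⟨max 1 ((4 * C) ^ (1 / β)), 8 * C, le_max_left _ _, by positivity,
    fun s hs x₀ b => ?_⟩
  have hs1 : 1 ≤ s := (le_max_left _ _).trans hs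
  have hs0 : 0 < s := by linarith
  have hsβ : 4 * C ≤ s ^ β := by
    have := Real.rpow_le_rpow (by positivity) ((le_max_right _ _).trans hs) hβ.le
    rwa [← Real.rpow_mul (by positivity), one_div_mul_cancel hβ.ne', Real.rpow_one] at this
  -- The averaging time: up to it a displacement beyond `s` has probability at most `1/4`, while
  -- `1/n` is still `O(s^{-β})`. The choice of `s₀` ensures `n ≥ 1`.
  set t := s ^ β / (4 * C) with ht
  have ht1 : 1 ≤ t := by rwa [ht, one_le_div (by positivity)]
  set n := ⌊t⌋₊ with hn
  have hn1 : 1 ≤ n := Nat.le_floor (by simpa using ht1)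
  have hnt : (n : ℝ) ≤ t := Nat.floor_le (by linarith)
  have htn : t ≤ 2 * n := by
    have h1 : t < n + 1 := Nat.lt_floor_add_one t
    have h2 : (1 : ℝ) ≤ n := by exact_mod_cast hn1
    linarith
  have hninv : (n : ℝ)⁻¹ ≤ 8 * C * s ^ (-β) := by
    have h1 : (2 * (n : ℝ))⁻¹ ≤ t⁻¹ := inv_anti₀ (by linarith) htn
    rw [ht, inv_div, mul_inv] at h1
    rw [Real.rpow_neg hs0.le]
    have : 4 * C / s ^ β = 4 * C * (s ^ β)⁻¹ := div_eq_mul_inv _ _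
    linarith
  set q : ℝ≥0∞ := ENNReal.ofReal (1 / 4) with hq
  have hsmall : ∀ x, ∀ m < n,
      (act K.eprob)^[m] (Set.indicator (G.ball x s)ᶜ 1) x ≤ q := by
    intro x m hm
    refine (hT x s m hs1).trans (ENNReal.ofReal_le_ofReal ?_)
    have h1 : (m : ℝ) ≤ t := le_trans (by exact_mod_cast hm.le) hnt
    have h2 : C * t * s ^ (-β) = 1 / 4 := by
      rw [ht, Real.rpow_neg hs0.le]
      field_simp
    rw [← h2]
    gcongr
  set M : Set X := {x | |G.d x₀ x - b| ≤ 2 * s} with hM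
  set F : ℕ → X → ℝ≥0∞ := fun m => (act K.eprob)^[m] (Set.indicator M 1) with hF
  set u : X → ℝ≥0∞ := fun x => (n : ℝ≥0∞)⁻¹ * ∑ m ∈ Finset.range n, F m x with hu
  have hn0 : (n : ℝ≥0∞) ≠ 0 := by simpa using (by omega : n ≠ 0)
  have hntop : (n : ℝ≥0∞) ≠ ∞ := ENNReal.natCast_ne_top n
  have hind1 : ∀ x, Set.indicator M (1 : X → ℝ≥0∞) x ≤ 1 := fun x =>
    Set.indicator_le_self' (fun _ _ => zero_le) x
  have hF1 : ∀ m x, F m x ≤ 1 := fun m x => iter_le_const tsum_eprob_le hind1 m x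
  have havg : ∀ (x : X) (B : ℝ≥0∞), (∀ m < n, F m x ≤ B) → u x ≤ B := by
    intro x B hB
    have h1 : ∑ m ∈ Finset.range n, F m x ≤ n * B := by
      refine (Finset.sum_le_sum fun m hm => hB m (Finset.mem_range.1 hm)).trans ?_
      simp
    calc u x ≤ (n : ℝ≥0∞)⁻¹ * (n * B) := by simp only [hu]; gcongr
      _ = B := by rw [← mul_assoc, ENNReal.inv_mul_cancel hn0 hntop, one_mul]
  have havg' : ∀ (x : X) (B : ℝ≥0∞), (∀ m < n, B ≤ F m x) → B ≤ u x := by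
    intro x B hB
    have h1 : n * B ≤ ∑ m ∈ Finset.range n, F m x := by
      refine le_trans ?_ (Finset.sum_le_sum fun m hm => hB m (Finset.mem_range.1 hm))
      simp
    calc B = (n : ℝ≥0∞)⁻¹ * (n * B) := by
          rw [← mul_assoc, ENNReal.inv_mul_cancel hn0 hntop, one_mul]
      _ ≤ _ := by simp only [hu]; gcongr
  have hu1 : ∀ x, u x ≤ 1 := fun x => havg x 1 fun m _ => hF1 m x
  -- The sums for `u` and `K u` telescope up to the first term, which is at most `1`; dividing by
  -- `n` gives the bounded generator.
  have hsol : ∀ x, u x ≤ act K.eprob u x + (n : ℝ≥0∞)⁻¹ := by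
    intro x
    have e1 : act K.eprob u x = (n : ℝ≥0∞)⁻¹ * ∑ m ∈ Finset.range n, F (m + 1) x := by
      simp only [hu]
      rw [act_const_mul, act_sum]
      congr 1
      refine Finset.sum_congr rfl fun m _ => ?_
      simp only [hF]
      rw [Function.iterate_succ_apply']
    have e2 : ∑ m ∈ Finset.range n, F m x ≤ ∑ m ∈ Finset.range n, F (m + 1) x + 1 := by
      refine (Finset.sum_le_sum_of_subset (Finset.range_mono (Nat.le_succ n))).trans ?_
      rw [Finset.sum_range_succ']
      gcongr
      exact hF1 0 x
    rw [e1]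
    calc u x ≤ (n : ℝ≥0∞)⁻¹ * (∑ m ∈ Finset.range n, F (m + 1) x + 1) := by
          simp only [hu]; gcongr
      _ = _ := by rw [mul_add, mul_one]
  -- The function `u` is at least `3/4` within `s` of the sphere and at most `1/4` beyond distance
  -- `3s`. Truncated subtraction of `1/4` gives bounded support and keeps the generator bound, as
  -- `K` preserves constants.
  set e : X → ℝ≥0∞ := fun x => u x - q with he
  have he1 : ∀ x, e x ≤ 1 := fun x => tsub_le_self.trans (hu1 x)
  have hetop : ∀ x, e x ≠ ∞ := fun x => ne_top_of_le_ne_top ENNReal.one_ne_top (he1 x)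
  have hesol : ∀ x, e x ≤ act K.eprob e x + (n : ℝ≥0∞)⁻¹ := by
    intro x
    refine tsub_le_iff_right.2 ((hsol x).trans ?_)
    have h1 : act K.eprob u x ≤ act K.eprob e x + q := by
      have : act K.eprob u x ≤ act K.eprob (fun y => e y + q) x :=
        act_mono_right (fun y => le_tsub_add) x
      rw [act_add_right, act_const tsum_eprob] at this
      exact this
    calc act K.eprob u x + (n : ℝ≥0∞)⁻¹ ≤ (act K.eprob e x + q) + (n : ℝ≥0∞)⁻¹ := by gcongr
      _ = _ := by ring
  have hdist : ∀ x y, |G.d x₀ x - G.d x₀ y| ≤ G.d x y := fun x y => by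
    rw [abs_le]
    have h1 := G.d_triangle x₀ x y
    have h2 := G.d_triangle x₀ y x
    rw [G.d_comm y x] at h2
    constructor <;> linarith
  refine ⟨fun x => (e x).toReal, fun x => ENNReal.toReal_nonneg,
    fun x => ENNReal.toReal_le_of_le_ofReal zero_le_one (by simpa using he1 x), ?_, ?_, ?_⟩
  · intro x hx
    by_contra hfar
    apply hx
    have : e x = 0 := by
      refine tsub_eq_zero_of_le (havg x q fun m hm => (iter_mono (fun _ _ => le_rfl)
        (fun y => ?_) m x).trans (hsmall x m hm))
      refine Set.indicator_le_indicator_of_subset (fun z hz => ?_) (fun _ => zero_le) y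
      simp only [Set.mem_compl_iff, mem_ball, not_le]
      simp only [hM, Set.mem_ofPred_eq] at hz
      have h1 := hdist x z
      have h2 := abs_sub_le (G.d x₀ x) (G.d x₀ z) b
      push Not at hfar
      linarith
    simp [this]
  · intro x hx
    have h1 : 1 - q ≤ u x := by
      refine havg' x _ fun m hm => tsub_le_iff_right.2 ?_
      rw [← iter_one (p := K.eprob) tsum_eprob m x]
      calc (act K.eprob)^[m] (fun _ => 1) x
          ≤ (act K.eprob)^[m] (fun y => Set.indicator M 1 y +
              Set.indicator (G.ball x s)ᶜ 1 y) x := by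
            refine iter_mono (fun _ _ => le_rfl) (fun y => ?_) m x
            by_cases hy : y ∈ M
            · rw [Set.indicator_of_mem hy]; exact le_self_add
            · have hy2 : y ∈ (G.ball x s)ᶜ := by
                simp only [Set.mem_compl_iff, mem_ball, not_le]
                simp only [hM, Set.mem_ofPred_eq, not_le] at hy
                have h1 := hdist x y
                have h2 := abs_sub_le (G.d x₀ y) (G.d x₀ x) b
                rw [abs_sub_comm (G.d x₀ y) (G.d x₀ x)] at h2
                linarith
              rw [Set.indicator_of_mem hy2]; exact le_add_self
        _ = F m x + (act K.eprob)^[m] (Set.indicator (G.ball x s)ᶜ 1) x := iter_add _ _ m x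
        _ ≤ _ := by gcongr; exact hsmall x m hm
    have h2 : ENNReal.ofReal (1 / 2) ≤ e x := by
      have : ENNReal.ofReal (1 / 2) = 1 - q - q := by
        rw [hq, ← ENNReal.ofReal_one, ← ENNReal.ofReal_sub _ (by norm_num),
          ← ENNReal.ofReal_sub _ (by norm_num)]
        norm_num
      rw [this]
      exact tsub_le_tsub_right h1 q
    exact (ENNReal.ofReal_le_iff_le_toReal (hetop x)).1 h2
  · intro Ω hΩ x
    have h1 : act K.eprob e x = ENNReal.ofReal (∑ y ∈ Ω, K.prob x y * (e y).toReal) := by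
      rw [act, tsum_eq_sum (s := Ω), ENNReal.ofReal_sum_of_nonneg]
      · refine Finset.sum_congr rfl fun y _ => ?_
        rw [ENNReal.ofReal_mul (K.prob_nonneg x y), ENNReal.ofReal_toReal (hetop y), eprob]
      · exact fun y _ => mul_nonneg (K.prob_nonneg x y) ENNReal.toReal_nonneg
      · intro y hy
        have : (e y).toReal = 0 := by
          by_contra hne
          exact hy (hΩ y hne)
        rw [ENNReal.toReal_eq_zero_iff] at this
        rw [this.resolve_right (hetop y), mul_zero]
    have h0 : 0 ≤ ∑ y ∈ Ω, K.prob x y * (e y).toReal :=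
      Finset.sum_nonneg fun y _ => mul_nonneg (K.prob_nonneg x y) ENNReal.toReal_nonneg
    have h2 := hesol x
    rw [h1] at h2
    have h3 : (n : ℝ≥0∞)⁻¹ = ENNReal.ofReal ((n : ℝ)⁻¹) := by
      rw [ENNReal.ofReal_inv_of_pos (by exact_mod_cast hn1), ENNReal.ofReal_natCast]
    rw [h3, ← ENNReal.ofReal_add h0 (by positivity)] at h2
    have h4 := ENNReal.toReal_le_of_le_ofReal (by positivity) h2
    linarith

end MarkovOperator

/-! ### Staircase functions built from cutoffs on disjoint annuli -/

namespace MarkovOperator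

open KernelOp WeightedGraph

variable {X : Type*} {K K₁ K₂ : MarkovOperator X} {G : WeightedGraph X} {df β c a a₁ a₂ : ℝ}

theorem JumpBound.prob_le_mul (hJ₁ : K₁.JumpBound G df β a₁) (hJ₂ : K₂.JumpBound G df β a₂)
    (x y : X) : K₁.prob x y ≤ a₁ * a₂ * K₂.prob x y := by
  have h1 := hJ₁.one_le
  have h2 := hJ₂.one_le
  have h3 := hJ₂.le_prob x y
  calc K₁.prob x y ≤ a₁ * (1 + G.d x y) ^ (-(df + β)) := hJ₁.prob_le x y
    _ = a₁ * a₂ * (a₂⁻¹ * (1 + G.d x y) ^ (-(df + β))) := by field_simp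
    _ ≤ _ := by gcongr

open Classical in
theorem sum_prob_long_le {T s : ℝ} {x : X} (hT : 0 ≤ T)
    (h : ∑' y, (if s < G.d x y then K.eprob x y else 0) ≤ ENNReal.ofReal T) (Ω : Finset X) :
    ∑ y ∈ Ω, (if s < G.d x y then K.prob x y else 0) ≤ T := by
  have h1 := (ENNReal.sum_le_tsum Ω).trans h
  have h2 : ∑ y ∈ Ω, (if s < G.d x y then K.eprob x y else 0) =
      ENNReal.ofReal (∑ y ∈ Ω, (if s < G.d x y then K.prob x y else 0)) := by
    rw [ENNReal.ofReal_sum_of_nonneg]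
    · refine Finset.sum_congr rfl fun y _ => ?_
      split_ifs
      · rfl
      · simp
    · intro y _
      split_ifs
      · exact K.prob_nonneg x y
      · exact le_rfl
  rw [h2] at h1
  exact (ENNReal.ofReal_le_ofReal_iff hT).1 h1

theorem sum_prob_le_one (Ω : Finset X) (x : X) : ∑ y ∈ Ω, K.prob x y ≤ 1 :=
  sum_le_hasSum Ω (fun y _ => K.prob_nonneg x y) (K.hasSum_prob x)

/-- The smoothed step functions obtained from cutoff functions on the annuli around `b k`. -/
noncomputable def stepFn (G : WeightedGraph X) (x₀ : X) (b : ℕ → ℝ) (h : ℕ → X → ℝ) (k : ℕ)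
    (x : X) : ℝ :=
  open Classical in if G.d x₀ x ≤ b k then 1 / 2 else min (1 / 2) (h k x)

theorem abs_d_sub_le (x₀ x y : X) : |G.d x₀ x - G.d x₀ y| ≤ G.d x y := by
  rw [abs_le]
  have h1 := G.d_triangle x₀ x y
  have h2 := G.d_triangle x₀ y x
  rw [G.d_comm y x] at h2
  constructor <;> linarith

section Step

variable {x₀ : X} {b : ℕ → ℝ} {h : ℕ → X → ℝ} {s : ℝ}

theorem stepFn_mem (h0 : ∀ k x, 0 ≤ h k x) (k : ℕ) (x : X) :
    0 ≤ stepFn G x₀ b h k x ∧ stepFn G x₀ b h k x ≤ 1 / 2 := by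
  unfold stepFn
  split_ifs
  · norm_num
  · exact ⟨le_min (by norm_num) (h0 k x), min_le_left _ _⟩

theorem stepFn_eq_zero (hs : 0 ≤ s) (hsupp : ∀ k x, h k x ≠ 0 → |G.d x₀ x - b k| ≤ 3 * s) {k : ℕ}
    {x : X} (hx : b k + 3 * s < G.d x₀ x) : stepFn G x₀ b h k x = 0 := by
  unfold stepFn
  rw [if_neg (by linarith)]
  have : h k x = 0 := by
    by_contra hne
    have := (le_abs_self _).trans (hsupp k x hne)
    linarith
  rw [this]
  norm_num

/-- The apparent jump of the step function at radius `b k` is harmless: `h k` is at least `1/2`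
within distance `s` of that sphere, so a move of length at most `s` across it starts and ends at the
value `1/2`. -/
theorem abs_stepFn_sub_le (hmid : ∀ k x, |G.d x₀ x - b k| ≤ s → 1 / 2 ≤ h k x) (k : ℕ) {x y : X}
    (hxy : G.d x y ≤ s) :
    |stepFn G x₀ b h k x - stepFn G x₀ b h k y| ≤ |h k x - h k y| := by
  have hd := (abs_le.1 ((abs_d_sub_le x₀ x y).trans hxy))
  unfold stepFn
  split_ifs with hx hy hy
  · simp
  · have h1 : 1 / 2 ≤ h k y := hmid k y (by rw [abs_le]; constructor <;> linarith)
    rw [min_eq_left h1]; simp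
  · have h1 : 1 / 2 ≤ h k x := hmid k x (by rw [abs_le]; constructor <;> linarith)
    rw [min_eq_left h1]; simp
  · exact (abs_min_sub_min_le_max _ _ _ _).trans (by simp)

/-- A move of length at most `s` is felt by at most one step, because the radii are `10 s` apart and
each step varies in a band of width about `4 s`. -/
theorem stepFn_sum_sub (hs : 0 < s) (hb : ∀ k l, k < l → b k + 10 * s ≤ b l)
    (h0 : ∀ k x, 0 ≤ h k x)
    (hsupp : ∀ k x, h k x ≠ 0 → |G.d x₀ x - b k| ≤ 3 * s)
    (hmid : ∀ k x, |G.d x₀ x - b k| ≤ s → 1 / 2 ≤ h k x) (I : Finset ℕ) {x y : X}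
    (hxy : G.d x y ≤ s) :
    |∑ k ∈ I, stepFn G x₀ b h k x - ∑ k ∈ I, stepFn G x₀ b h k y| ≤ 1 ∧
    (∑ k ∈ I, stepFn G x₀ b h k x - ∑ k ∈ I, stepFn G x₀ b h k y) ^ 2 ≤
      ∑ k ∈ I, (h k x - h k y) ^ 2 := by
  have hd := (abs_le.1 ((abs_d_sub_le x₀ x y).trans hxy))
  rw [← Finset.sum_sub_distrib]
  by_cases hall : ∀ k ∈ I, stepFn G x₀ b h k x - stepFn G x₀ b h k y = 0
  · rw [Finset.sum_eq_zero hall]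
    simp only [abs_zero, zero_le_one, true_and]
    rw [zero_pow two_ne_zero]
    exact Finset.sum_nonneg fun k _ => sq_nonneg _
  · push Not at hall
    obtain ⟨k, hk, hne⟩ := hall
    have loc : ∀ k, stepFn G x₀ b h k x - stepFn G x₀ b h k y ≠ 0 →
        b k < G.d x₀ x + s ∧ G.d x₀ x ≤ b k + 4 * s := by
      intro k hk
      constructor
      · by_contra hle
        apply hk
        unfold stepFn
        rw [if_pos (by linarith), if_pos (by linarith), sub_self]
      · by_contra hlt
        apply hk
        rw [stepFn_eq_zero hs.le hsupp (by linarith), stepFn_eq_zero hs.le hsupp (by linarith),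
          sub_self]
    have hsingle : ∑ k ∈ I, (stepFn G x₀ b h k x - stepFn G x₀ b h k y) =
        stepFn G x₀ b h k x - stepFn G x₀ b h k y := by
      refine Finset.sum_eq_single_of_mem k hk fun l _ hlk => ?_
      by_contra hl
      have h1 := loc k hne
      have h2 := loc l hl
      rcases lt_or_gt_of_ne hlk with hlt | hlt
      · linarith [hb l k hlt]
      · linarith [hb k l hlt]
    rw [hsingle]
    constructor
    · have h1 := stepFn_mem (G := G) (x₀ := x₀) (b := b) h0 k x
      have h2 := stepFn_mem (G := G) (x₀ := x₀) (b := b) h0 k y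
      rw [abs_le]
      constructor <;> linarith [h1.1, h1.2, h2.1, h2.2]
    · calc (stepFn G x₀ b h k x - stepFn G x₀ b h k y) ^ 2 ≤ (h k x - h k y) ^ 2 :=
            sq_le_sq.2 (abs_stepFn_sub_le hmid k hxy)
        _ ≤ _ := Finset.single_le_sum (f := fun k => (h k x - h k y) ^ 2)
            (fun k _ => sq_nonneg _) hk

end Step

end MarkovOperator

/-! ### The weighted `L²` estimate -/

theorem sum_sum_mul_sum {X ι : Type*} (Ω : Finset X) (I : Finset ι) (c : ℝ) (F : ι → X → X → ℝ) :
    ∑ x ∈ Ω, ∑ y ∈ Ω, c * ∑ k ∈ I, F k x y = c * ∑ k ∈ I, ∑ x ∈ Ω, ∑ y ∈ Ω, F k x y := by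
  simp only [← Finset.mul_sum]
  congr 1
  calc ∑ x ∈ Ω, ∑ y ∈ Ω, ∑ k ∈ I, F k x y = ∑ x ∈ Ω, ∑ k ∈ I, ∑ y ∈ Ω, F k x y :=
        Finset.sum_congr rfl fun x _ => Finset.sum_comm
    _ = _ := Finset.sum_comm

/-- An Agmon type estimate. Testing with `ψ² v`, `ψ = e^θ - 1`, gives the energy of `g = ψ v` plus
`2 lam ‖g‖²` on one side and the oscillation of `ψ` on the other. As `v ≤ 1`, one has `(e^θ v)² ≤ 2
g² + 2`, so this oscillation is bounded by that of `θ` weighted by `g² + 1`. The factor `(64 κ)⁻¹`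
makes the energy of `g` reappear with coefficient exactly `1`; it cancels, and the remaining mass
terms are absorbed by `lam ≥ 5 E`. -/
theorem exp_weight_bound {X : Type*} {Ω : Finset X} {J₁ J : X → X → ℝ} {w v θ : X → ℝ}
    {κ E lam : ℝ} (hJ : ∀ x y, 0 ≤ J x y) (hs : ∀ x y, J x y = J y x) (hw : ∀ x, 0 ≤ w x)
    (hκ : 1 ≤ κ) (hE : 0 < E) (hlam : 5 * E ≤ lam) (hv0 : ∀ x, 0 ≤ v x) (hv1 : ∀ x, v x ≤ 1)
    (hθ1 : ∀ x y, J x y ≠ 0 → |θ x - θ y| ≤ 1)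
    (hθ : ∀ f : X → ℝ, ∑ x ∈ Ω, ∑ y ∈ Ω, J x y * (f x ^ 2 * (θ x - θ y) ^ 2) ≤
      (64 * κ)⁻¹ * (8 * ∑ x ∈ Ω, ∑ y ∈ Ω, J₁ x y * (f x - f y) ^ 2 +
        4 * E * ∑ x ∈ Ω, w x * f x ^ 2))
    (hcomp : ∀ f : X → ℝ, ∑ x ∈ Ω, ∑ y ∈ Ω, J₁ x y * (f x - f y) ^ 2 ≤
      κ * ∑ x ∈ Ω, ∑ y ∈ Ω, J x y * (f x - f y) ^ 2 + 4 * E * ∑ x ∈ Ω, w x * f x ^ 2)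
    (hsub : ∀ x ∈ Ω, (Real.exp (θ x) - 1) ^ 2 * v x * ∑ y ∈ Ω, J x y * (v x - v y) ≤
      -(lam * (w x * ((Real.exp (θ x) - 1) * v x) ^ 2))) :
    ∑ x ∈ Ω, w x * ((Real.exp (θ x) - 1) * v x) ^ 2 ≤ ∑ x ∈ Ω, w x := by
  set ψ : X → ℝ := fun x => Real.exp (θ x) - 1 with hψ
  set g : X → ℝ := fun x => ψ x * v x with hg
  set En := ∑ x ∈ Ω, ∑ y ∈ Ω, J x y * (g x - g y) ^ 2 with hEn
  set m₂ := ∑ x ∈ Ω, w x * g x ^ 2 with hm₂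
  set W := ∑ x ∈ Ω, w x with hW
  have hEn0 : 0 ≤ En := Finset.sum_nonneg fun x _ => Finset.sum_nonneg fun y _ =>
    mul_nonneg (hJ x y) (sq_nonneg _)
  have hm0 : 0 ≤ m₂ := Finset.sum_nonneg fun x _ => mul_nonneg (hw x) (sq_nonneg _)
  have hW0 : 0 ≤ W := Finset.sum_nonneg fun x _ => hw x
  have hκinv : 0 < (64 * κ)⁻¹ := by positivity
  have hκinv1 : (64 * κ)⁻¹ ≤ 1 / 64 := by
    rw [one_div]; exact inv_anti₀ (by norm_num) (by linarith)
  have hκκ : (64 * κ)⁻¹ * κ = 1 / 64 := by field_simp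
  have hDg : ∑ x ∈ Ω, ∑ y ∈ Ω, J x y * (g x ^ 2 * (θ x - θ y) ^ 2) ≤
      1 / 8 * En + 9 / 16 * E * m₂ := by
    refine (hθ g).trans ?_
    calc (64 * κ)⁻¹ * (8 * ∑ x ∈ Ω, ∑ y ∈ Ω, J₁ x y * (g x - g y) ^ 2 + 4 * E * m₂)
        ≤ (64 * κ)⁻¹ * (8 * (κ * En + 4 * E * m₂) + 4 * E * m₂) := by
          gcongr
          exact hcomp g
      _ = 8 * ((64 * κ)⁻¹ * κ) * En + (64 * κ)⁻¹ * (36 * E * m₂) := by ring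
      _ ≤ 8 * (1 / 64) * En + 1 / 64 * (36 * E * m₂) := by
          rw [hκκ]; gcongr
      _ = _ := by ring
  have hD1 : ∑ x ∈ Ω, ∑ y ∈ Ω, J x y * (θ x - θ y) ^ 2 ≤ 1 / 16 * E * W := by
    have h1 := hθ (fun _ => 1)
    simp only [one_pow, one_mul, sub_self, mul_one, zero_pow two_ne_zero, mul_zero,
      Finset.sum_const_zero, zero_add] at h1
    refine h1.trans ?_
    calc (64 * κ)⁻¹ * (4 * E * W) ≤ 1 / 64 * (4 * E * W) := by gcongr
      _ = _ := by ring
  have hS : ∑ x ∈ Ω, ∑ y ∈ Ω, J x y * (ψ x ^ 2 * v x * (v x - v y)) ≤ -(lam * m₂) := by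
    rw [hm₂, Finset.mul_sum, ← Finset.sum_neg_distrib]
    refine Finset.sum_le_sum fun x hx => le_trans (le_of_eq ?_) (hsub x hx)
    rw [Finset.mul_sum]
    exact Finset.sum_congr rfl fun y _ => by ring
  have hcross : ∑ x ∈ Ω, ∑ y ∈ Ω, J x y * (v x * v y * (ψ x - ψ y) ^ 2) ≤
      8 * ∑ x ∈ Ω, ∑ y ∈ Ω, J x y * (g x ^ 2 * (θ x - θ y) ^ 2) +
        8 * ∑ x ∈ Ω, ∑ y ∈ Ω, J x y * (θ x - θ y) ^ 2 := by
    have h1 : ∑ x ∈ Ω, ∑ y ∈ Ω, J x y * (v x * v y * (ψ x - ψ y) ^ 2) ≤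
        ∑ x ∈ Ω, ∑ y ∈ Ω, (8 * (J x y * (g x ^ 2 * (θ x - θ y) ^ 2)) +
          8 * (J x y * (θ x - θ y) ^ 2)) := by
      refine sum_sum_le_of_symm fun x _ y _ => ?_
      rw [hs y x]
      by_cases h0 : J x y = 0
      · simp [h0]
      · have h2 := mul_le_mul_of_nonneg_left (exp_weight_pointwise (hθ1 x y h0) (hv0 x) (hv1 x)
          (hv0 y) (hv1 y)) (hJ x y)
        have e1 : J x y * (v x * v y * (ψ x - ψ y) ^ 2) + J x y * (v y * v x * (ψ y - ψ x) ^ 2) =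
          2 * (J x y * (v x * v y * ((Real.exp (θ x) - 1) - (Real.exp (θ y) - 1)) ^ 2)) := by
            simp only [hψ]; ring
        rw [e1]
        refine (mul_le_mul_of_nonneg_left h2 (by norm_num)).trans (le_of_eq ?_)
        simp only [hg, hψ]
        ring
    simpa only [Finset.sum_add_distrib, ← Finset.mul_sum] using h1
  have hid := energy_weight (Ω := Ω) hs v ψ
  simp only [Finset.sum_add_distrib, ← Finset.mul_sum] at hid
  have htot : En + 2 * (lam * m₂) ≤ 8 * (1 / 8 * En + 9 / 16 * E * m₂) + 8 * (1 / 16 * E * W) := by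
    have : En = ∑ x ∈ Ω, ∑ y ∈ Ω, J x y * (ψ x * v x - ψ y * v y) ^ 2 := rfl
    linarith
  have hlam0 : 0 < lam := by linarith
  have h1 : 5 * E * m₂ ≤ lam * m₂ := by gcongr
  have h2 : 5 * E * W ≤ lam * W := by gcongr
  have h3 : 0 ≤ E * m₂ := by positivity
  have h4 : 0 ≤ E * W := by positivity
  have h5 : lam * m₂ ≤ lam * W := by nlinarith
  exact le_of_mul_le_mul_left h5 hlam0

namespace MarkovOperator

open KernelOp WeightedGraph

variable {X : Type*} {K₁ K₂ : MarkovOperator X} {G : WeightedGraph X} {df β c a₁ a₂ : ℝ}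

open Classical in
/-- `L²` decay of subsolutions for the truncated walk `K₂`, by means of cutoffs adapted to `K₁`. -/
theorem exists_weighted_bound (h : G.Regular df c) (hβ : 0 < β) (hJ₁ : K₁.JumpBound G df β a₁)
    (hJ₂ : K₂.JumpBound G df β a₂) {C : ℝ} (hC : 0 < C) (hT : K₁.Tight G β C) :
    ∃ s₀ η L : ℝ, 1 ≤ s₀ ∧ 0 < η ∧ 0 < L ∧ ∀ s, s₀ ≤ s → ∀ (R : ℝ) (N : ℕ), 20 * s * N ≤ R →
      ∀ (x₀ : X) (lam : ℝ), L * s ^ (-β) ≤ lam → ∀ v : X → ℝ, (∀ x, 0 ≤ v x) → (∀ x, v x ≤ 1) →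
      (∀ x, G.d x₀ x ≤ R → (1 + lam) * v x ≤ ∑ y ∈ h.ballFinset x s, K₂.prob x y * v y) →
      (Real.exp (η * N) - 1) ^ 2 * ∑ x ∈ h.ballFinset x₀ (R / 2), G.mass x * v x ^ 2 ≤
        G.vol x₀ (2 * R) := by
  obtain ⟨s₀, C₀, hs₀, hC₀, hcut⟩ := hT.exists_cutoff hC hβ
  obtain ⟨T, hT0, htail⟩ := hJ₁.exists_tail_bound h hβ
  have ha₁ := hJ₁.one_le
  have ha₂ := hJ₂.one_le
  set κ := a₁ * a₂ with hκ
  have hκ1 : 1 ≤ κ := by nlinarith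
  -- Chosen so that `κ η² = (64 κ)⁻¹`, the smallness required by `exp_weight_bound`.
  set η := 1 / (8 * κ) with hη
  have hη0 : 0 < η := by positivity
  have hη1 : η ≤ 1 := by rw [hη, div_le_one (by positivity)]; linarith
  refine ⟨s₀, η / 2, 5 * max T C₀, hs₀, by positivity, by positivity,
    fun s hs R N hN x₀ lam hlam v hv0 hv1 hsub => ?_⟩
  have hs1 : 1 ≤ s := hs₀.trans hs
  have hs0 : 0 < s := by linarith
  rcases Nat.eq_zero_or_pos N with rfl | hNpos
  · simp only [Nat.cast_zero, mul_zero, Real.exp_zero, sub_self, zero_pow two_ne_zero, zero_mul]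
    rw [h.vol_eq_sum]
    exact Finset.sum_nonneg fun x _ => (h.mass_pos x).le
  have hN1 : (1 : ℝ) ≤ N := by exact_mod_cast hNpos
  have hsR : 20 * s ≤ R := le_trans (by nlinarith) hN
  set E := max T C₀ * s ^ (-β) with hEdef
  have hsβ : 0 < s ^ (-β) := by positivity
  have hE0 : 0 < E := by positivity
  set Ω := h.ballFinset x₀ (2 * R) with hΩ
  -- The `N` annuli lie between the radii `R / 2` and `R`; `20 s N ≤ R` is exactly the room needed
  -- at spacing `10 s`.
  set b : ℕ → ℝ := fun k => R / 2 + 5 * s + 10 * s * k with hb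
  choose hh hh0 hh1 hsupp hmid hsol using fun k => hcut s hs x₀ (b k)
  have hbgap : ∀ k l : ℕ, k < l → b k + 10 * s ≤ b l := by
    intro k l hkl
    have : (k : ℝ) + 1 ≤ l := by exact_mod_cast hkl
    simp only [hb]
    nlinarith
  have hbN : ∀ k ∈ Finset.range N, b k + 3 * s ≤ R := by
    intro k hk
    have : (k : ℝ) + 1 ≤ N := by exact_mod_cast Finset.mem_range.1 hk
    simp only [hb]
    nlinarith
  set Φ : X → ℝ := fun x => ∑ k ∈ Finset.range N, stepFn G x₀ b hh k x with hΦ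
  set θ : X → ℝ := fun x => η * Φ x with hθdef
  set J₁ : X → X → ℝ := fun x y => G.mass x * K₁.prob x y with hJ₁def
  set J : X → X → ℝ := fun x y => if G.d x y ≤ s then G.mass x * K₂.prob x y else 0 with hJdef
  have hm := fun x => (h.mass_pos x).le
  have hJ₁0 : ∀ x y, 0 ≤ J₁ x y := fun x y => mul_nonneg (hm x) (K₁.prob_nonneg x y)
  have hJ₁s : ∀ x y, J₁ x y = J₁ y x := fun x y => hJ₁.symm x y
  have hJ0 : ∀ x y, 0 ≤ J x y := fun x y => by
    simp only [hJdef]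
    split_ifs
    · exact mul_nonneg (hm x) (K₂.prob_nonneg x y)
    · exact le_rfl
  have hJs : ∀ x y, J x y = J y x := fun x y => by
    simp only [hJdef, G.d_comm y x, hJ₂.symm x y]
  have hΔ : ∀ x y, G.d x y ≤ s → |Φ x - Φ y| ≤ 1 ∧
      (Φ x - Φ y) ^ 2 ≤ ∑ k ∈ Finset.range N, (hh k x - hh k y) ^ 2 := fun x y hxy =>
    stepFn_sum_sub hs0 hbgap hh0 hsupp hmid (Finset.range N) hxy
  have hsupp' : ∀ k ∈ Finset.range N, ∀ x, hh k x ≠ 0 → x ∈ Ω := by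
    intro k hk x hx
    rw [hΩ, h.mem_ballFinset]
    have := (le_abs_self _).trans (hsupp k x hx)
    linarith [hbN k hk]
  have hcutJ : ∀ f : X → ℝ, ∑ k ∈ Finset.range N, ∑ x ∈ Ω, ∑ y ∈ Ω,
      J₁ x y * (f x ^ 2 * (hh k x - hh k y) ^ 2) ≤
      8 * ∑ x ∈ Ω, ∑ y ∈ Ω, J₁ x y * (f x - f y) ^ 2 +
        4 * E * ∑ x ∈ Ω, G.mass x * f x ^ 2 := by
    refine fun f => sum_energy_cutoff hJ₁0 hJ₁s hh0 hh1 ?_ hm hE0.le ?_ f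
    · intro x k _ l _ hk hl
      have h1 := abs_le.1 (hsupp k x hk)
      have h2 := abs_le.1 (hsupp l x hl)
      by_contra hne
      rcases lt_or_gt_of_ne hne with hlt | hlt
      · linarith [hbgap k l hlt, h1.2, h2.1]
      · linarith [hbgap l k hlt, h1.1, h2.2]
    · intro k hk x _
      have h1 := hsol k Ω (hsupp' k hk) x
      have h2 : ∑ y ∈ Ω, J₁ x y * (hh k x - hh k y) =
          G.mass x * (hh k x * ∑ y ∈ Ω, K₁.prob x y - ∑ y ∈ Ω, K₁.prob x y * hh k y) := by
        rw [Finset.mul_sum, ← Finset.sum_sub_distrib, Finset.mul_sum]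
        exact Finset.sum_congr rfl fun y _ => by simp only [hJ₁def]; ring
      rw [h2, mul_comm]
      refine mul_le_mul_of_nonneg_right ?_ (hm x)
      have h3 := mul_le_of_le_one_right (hh0 k x) (sum_prob_le_one (K := K₁) Ω x)
      have h4 : C₀ * s ^ (-β) ≤ E := by rw [hEdef]; gcongr; exact le_max_right _ _
      linarith
  have key : ∑ x ∈ Ω, G.mass x * ((Real.exp (θ x) - 1) * v x) ^ 2 ≤ ∑ x ∈ Ω, G.mass x := by
    refine exp_weight_bound (J₁ := J₁) (J := J) (κ := κ) (E := E) (lam := lam) hJ0 hJs hm hκ1 hE0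
      (by rw [hEdef]; linarith) hv0 hv1 ?_ ?_ ?_ ?_
    · intro x y hxy
      have hd : G.d x y ≤ s := by
        by_contra hd
        exact hxy (by simp only [hJdef]; rw [if_neg hd])
      have e : θ x - θ y = η * (Φ x - Φ y) := by simp only [hθdef]; ring
      rw [e, abs_mul, abs_of_pos hη0]
      exact mul_le_one₀ hη1 (abs_nonneg _) (hΔ x y hd).1
    · intro f
      calc ∑ x ∈ Ω, ∑ y ∈ Ω, J x y * (f x ^ 2 * (θ x - θ y) ^ 2)
          ≤ ∑ x ∈ Ω, ∑ y ∈ Ω, (κ * η ^ 2) *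
              ∑ k ∈ Finset.range N, J₁ x y * (f x ^ 2 * (hh k x - hh k y) ^ 2) := by
            refine Finset.sum_le_sum fun x _ => Finset.sum_le_sum fun y _ => ?_
            rw [← Finset.mul_sum, ← Finset.mul_sum]
            by_cases hd : G.d x y ≤ s
            · have e : θ x - θ y = η * (Φ x - Φ y) := by simp only [hθdef]; ring
              have h1 : J x y ≤ κ * J₁ x y := by
                simp only [hJdef, hJ₁def]
                rw [if_pos hd]
                have h2 := hJ₂.prob_le_mul hJ₁ x y
                have h3 := mul_le_mul_of_nonneg_left h2 (hm x)
                calc G.mass x * K₂.prob x y ≤ G.mass x * (a₂ * a₁ * K₁.prob x y) := h3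
                  _ = _ := by rw [hκ]; ring
              calc J x y * (f x ^ 2 * (θ x - θ y) ^ 2)
                  = η ^ 2 * (J x y * (f x ^ 2 * (Φ x - Φ y) ^ 2)) := by rw [e]; ring
                _ ≤ η ^ 2 * ((κ * J₁ x y) *
                    (f x ^ 2 * ∑ k ∈ Finset.range N, (hh k x - hh k y) ^ 2)) := by
                    have := hJ₁0 x y
                    gcongr
                    exact (hΔ x y hd).2
                _ = _ := by ring
            · have : J x y = 0 := by simp only [hJdef]; rw [if_neg hd]
              rw [this, zero_mul]
              have := hJ₁0 x y
              have h3 : 0 ≤ ∑ k ∈ Finset.range N, (hh k x - hh k y) ^ 2 :=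
                Finset.sum_nonneg fun k _ => sq_nonneg _
              positivity
        _ = (κ * η ^ 2) * ∑ k ∈ Finset.range N, ∑ x ∈ Ω, ∑ y ∈ Ω,
              J₁ x y * (f x ^ 2 * (hh k x - hh k y) ^ 2) := by
            exact sum_sum_mul_sum _ _ _ _
        _ ≤ (κ * η ^ 2) * _ := mul_le_mul_of_nonneg_left (hcutJ f) (by positivity)
        _ = _ := by
            congr 1
            rw [hη]; field_simp; norm_num
    · intro f
      -- Jumps of length at most `s` are compared through `κ`; for longer ones `(f x - f y)² ≤ 2 f
      -- x² + 2 f y²`, and their rate is at most `E`.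
      have h1 : ∑ x ∈ Ω, ∑ y ∈ Ω, J₁ x y * (f x - f y) ^ 2 ≤
          ∑ x ∈ Ω, ∑ y ∈ Ω, (κ * (J x y * (f x - f y) ^ 2) +
            4 * (G.mass x * f x ^ 2 * (if s < G.d x y then K₁.prob x y else 0))) := by
        refine sum_sum_le_of_symm fun x _ y _ => ?_
        by_cases hd : G.d x y ≤ s
        · have hle : J₁ x y ≤ κ * J x y := by
            simp only [hJdef, hJ₁def]
            rw [if_pos hd]
            calc G.mass x * K₁.prob x y ≤ G.mass x * (a₁ * a₂ * K₂.prob x y) :=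
                  mul_le_mul_of_nonneg_left (hJ₁.prob_le_mul hJ₂ x y) (hm x)
              _ = _ := by rw [hκ]; ring
          have hd' : G.d y x ≤ s := by rwa [G.d_comm]
          rw [if_neg (not_lt.2 hd), if_neg (not_lt.2 hd'), hJ₁s y x, hJs y x]
          have := mul_le_mul_of_nonneg_right hle (sq_nonneg (f x - f y))
          nlinarith [this]
        · have hd1 : s < G.d x y := not_le.1 hd
          have hd2 : s < G.d y x := by rwa [G.d_comm]
          rw [if_pos hd1, if_pos hd2]
          have e1 : G.mass x * f x ^ 2 * K₁.prob x y = J₁ x y * f x ^ 2 := by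
            simp only [hJ₁def]; ring
          have e2 : G.mass y * f y ^ 2 * K₁.prob y x = J₁ x y * f y ^ 2 := by
            rw [hJ₁s x y]; simp only [hJ₁def]; ring
          have e3 : J x y = 0 := by simp only [hJdef]; rw [if_neg hd]
          rw [e1, e2, hJ₁s y x, hJs y x, e3]
          have := mul_nonneg (hJ₁0 x y) (sq_nonneg (f x + f y))
          nlinarith [this]
      refine h1.trans ?_
      simp only [Finset.sum_add_distrib, ← Finset.mul_sum]
      rw [mul_assoc 4 E]
      gcongr
      rw [Finset.mul_sum]
      refine Finset.sum_le_sum fun x _ => ?_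
      have h2 := sum_prob_long_le (by positivity) (htail x s hs1) Ω
      have h3 : T * s ^ (-β) ≤ E := by rw [hEdef]; gcongr; exact le_max_left _ _
      rw [mul_comm E]
      exact mul_le_mul_of_nonneg_left (h2.trans h3) (mul_nonneg (hm x) (sq_nonneg _))
    · intro x _
      by_cases hxR : G.d x₀ x ≤ R
      · have hsubset : h.ballFinset x s ⊆ Ω := by
          intro y hy
          rw [h.mem_ballFinset] at hy
          rw [hΩ, h.mem_ballFinset]
          linarith [G.d_triangle x₀ x y]
        have h1 : ∑ y ∈ Ω, J x y * (v x - v y) =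
            G.mass x * (v x * ∑ y ∈ h.ballFinset x s, K₂.prob x y -
              ∑ y ∈ h.ballFinset x s, K₂.prob x y * v y) := by
          rw [← Finset.sum_subset hsubset]
          · rw [Finset.mul_sum, ← Finset.sum_sub_distrib, Finset.mul_sum]
            refine Finset.sum_congr rfl fun y hy => ?_
            simp only [hJdef]
            rw [if_pos (h.mem_ballFinset.1 hy)]
            ring
          · intro y _ hy
            rw [h.mem_ballFinset] at hy
            simp only [hJdef]
            rw [if_neg hy, zero_mul]
        have h2 : ∑ y ∈ Ω, J x y * (v x - v y) ≤ G.mass x * (-(lam * v x)) := by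
          rw [h1]
          refine mul_le_mul_of_nonneg_left ?_ (hm x)
          have h3 := mul_le_of_le_one_right (hv0 x)
            (sum_prob_le_one (K := K₂) (h.ballFinset x s) x)
          linarith [hsub x hxR]
        calc (Real.exp (θ x) - 1) ^ 2 * v x * ∑ y ∈ Ω, J x y * (v x - v y)
            ≤ (Real.exp (θ x) - 1) ^ 2 * v x * (G.mass x * (-(lam * v x))) :=
              mul_le_mul_of_nonneg_left h2 (mul_nonneg (sq_nonneg _) (hv0 x))
          _ = _ := by ring
      -- Outside the ball of radius `R` no equation for `v` is available, but there the weight `e^θ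
      -- - 1` vanishes.
      · have : θ x = 0 := by
          simp only [hθdef, hΦ]
          rw [Finset.sum_eq_zero, mul_zero]
          intro k hk
          exact stepFn_eq_zero hs0.le hsupp (by linarith [hbN k hk])
        rw [this, Real.exp_zero, sub_self]
        simp
  rw [h.vol_eq_sum]
  refine le_trans ?_ key
  rw [Finset.mul_sum]
  have hsubset : h.ballFinset x₀ (R / 2) ⊆ Ω := by
    intro y hy
    rw [h.mem_ballFinset] at hy
    rw [hΩ, h.mem_ballFinset]
    linarith
  refine le_trans (le_of_eq ?_) (Finset.sum_le_sum_of_subset_of_nonneg hsubset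
    fun x _ _ => mul_nonneg (hm x) (sq_nonneg _))
  refine Finset.sum_congr rfl fun x hx => ?_
  rw [h.mem_ballFinset] at hx
  have : θ x = η / 2 * N := by
    have e : ∀ k ∈ Finset.range N, stepFn G x₀ b hh k x = 1 / 2 := by
      intro k _
      unfold stepFn
      rw [if_pos]
      simp only [hb]
      have : 0 ≤ 10 * s * (k : ℝ) := by positivity
      linarith
    simp only [hθdef, hΦ]
    rw [Finset.sum_congr rfl e, Finset.sum_const, Finset.card_range, nsmul_eq_mul]
    ring
  rw [this]
  ring

end MarkovOperator

/-! ### Exit time estimates -/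

namespace MarkovOperator

open KernelOp WeightedGraph

variable {X : Type*} {K K₁ K₂ : MarkovOperator X} {G : WeightedGraph X} {df β c a a₁ a₂ : ℝ}

open Classical in
/-- The part of the transition kernel with jumps of size at most `s`. -/
noncomputable def shortPart (K : MarkovOperator X) (G : WeightedGraph X) (s : ℝ) (x y : X) :
    ℝ≥0∞ := if G.d x y ≤ s then K.eprob x y else 0

open Classical in
/-- The part of the transition kernel with jumps of size larger than `s`. -/
noncomputable def longPart (K : MarkovOperator X) (G : WeightedGraph X) (s : ℝ) (x y : X) :
    ℝ≥0∞ := if s < G.d x y then K.eprob x y else 0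

theorem shortPart_add_longPart (s : ℝ) :
    (fun x y => K.shortPart G s x y + K.longPart G s x y) = K.eprob := by
  funext x y
  unfold shortPart longPart
  rcases le_or_gt (G.d x y) s with h | h
  · rw [if_pos h, if_neg (not_lt.2 h), add_zero]
  · rw [if_neg (not_le.2 h), if_pos h, zero_add]

theorem shortPart_le (s : ℝ) (x y : X) : K.shortPart G s x y ≤ K.eprob x y := by
  unfold shortPart
  split_ifs
  · exact le_rfl
  · exact zero_le

theorem tsum_shortPart_le (s : ℝ) (x : X) : ∑' y, K.shortPart G s x y ≤ 1 :=
  (ENNReal.tsum_le_tsum (shortPart_le s x)).trans (tsum_eprob_le x)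

/-- The discount factor with killing rate `lam`. -/
noncomputable def discount (lam : ℝ) : ℝ≥0∞ := ENNReal.ofReal (1 / (1 + lam))

theorem discount_le_one {lam : ℝ} (h : 0 < lam) : discount lam ≤ 1 := by
  unfold discount
  rw [← ENNReal.ofReal_one]
  apply ENNReal.ofReal_le_ofReal
  rw [div_le_one (by linarith)]
  linarith

theorem mul_discount {lam : ℝ} (h : 0 < lam) : ENNReal.ofReal (1 + lam) * discount lam = 1 := by
  unfold discount
  rw [← ENNReal.ofReal_mul (by linarith), mul_one_div_cancel (by linarith), ENNReal.ofReal_one]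

/-- Averages of exit functions of the truncated walk over balls. -/
theorem exists_average_bound (h : G.Regular df c) (hβ : 0 < β) (hJ₁ : K₁.JumpBound G df β a₁)
    (hJ₂ : K₂.JumpBound G df β a₂) {C : ℝ} (hC : 0 < C) (hT : K₁.Tight G β C) :
    ∃ s₀ η L D : ℝ, 1 ≤ s₀ ∧ 0 < η ∧ 0 < L ∧ 0 < D ∧ ∀ s, s₀ ≤ s → ∀ (R : ℝ) (N : ℕ), 1 ≤ N →
      20 * s * N ≤ R → ∀ (x₀ : X) (lam : ℝ), 0 < lam → L * s ^ (-β) ≤ lam → ∀ j n : ℕ, 1 ≤ n →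
      (act (K₂.shortPart G s))^[n] (Set.indicator (G.ball x₀ (R / 4))
        (exitFn (discount lam) (K₂.shortPart G s) (G.ball x₀ R) j)) x₀ ≤
      ENNReal.ofReal (D * ((n : ℝ) ^ (-(df / β)) * R ^ df / (Real.exp (η * N) - 1))) := by
  classical
  obtain ⟨s₀, η, L, hs₀, hη, hL, hw⟩ := exists_weighted_bound h hβ hJ₁ hJ₂ hC hT
  obtain ⟨A, hA, hdiag⟩ := hJ₂.exists_diagonal_bound h hβ
  have hc := h.one_le
  have hdf := h.df_pos
  refine ⟨s₀, η, L, A * c ^ 2 * 2 ^ df, hs₀, hη, hL, by positivity,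
    fun s hs R N hN hNR x₀ lam hlam0 hlam j n hn => ?_⟩
  have hs1 : 1 ≤ s := hs₀.trans hs
  have hN1 : (1 : ℝ) ≤ N := by exact_mod_cast hN
  have hR : 20 ≤ R := le_trans (by nlinarith) hNR
  set e := exitFn (discount lam) (K₂.shortPart G s) (G.ball x₀ R) j with he
  have he1 : ∀ x, e x ≤ 1 := exitFn_le_one (discount_le_one hlam0) (tsum_shortPart_le s) j
  have hetop : ∀ x, e x ≠ ∞ := fun x => ne_top_of_le_ne_top ENNReal.one_ne_top (he1 x)
  set v : X → ℝ := fun x => (e x).toReal with hv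
  have hv0 : ∀ x, 0 ≤ v x := fun x => ENNReal.toReal_nonneg
  have hv1 : ∀ x, v x ≤ 1 := fun x =>
    ENNReal.toReal_le_of_le_ofReal zero_le_one (by simpa using he1 x)
  have hev : ∀ x, e x = ENNReal.ofReal (v x) := fun x => (ENNReal.ofReal_toReal (hetop x)).symm
  have hsub : ∀ x, G.d x₀ x ≤ R →
      (1 + lam) * v x ≤ ∑ y ∈ h.ballFinset x s, K₂.prob x y * v y := by
    intro x hx
    have h1 : act (K₂.shortPart G s) e x =
        ENNReal.ofReal (∑ y ∈ h.ballFinset x s, K₂.prob x y * v y) := by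
      rw [act, tsum_eq_sum (s := h.ballFinset x s), ENNReal.ofReal_sum_of_nonneg]
      · refine Finset.sum_congr rfl fun y hy => ?_
        rw [shortPart, if_pos (h.mem_ballFinset.1 hy), eprob, hev,
          ENNReal.ofReal_mul (K₂.prob_nonneg x y)]
      · exact fun y _ => mul_nonneg (K₂.prob_nonneg x y) (hv0 y)
      · intro y hy
        rw [shortPart, if_neg fun hy' => hy (h.mem_ballFinset.2 hy'), zero_mul]
    have h2 : e x ≤ discount lam * act (K₂.shortPart G s) e x := exitFn_subsolution j hx
    have h3 : ENNReal.ofReal (1 + lam) * e x ≤ act (K₂.shortPart G s) e x := by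
      calc ENNReal.ofReal (1 + lam) * e x
          ≤ ENNReal.ofReal (1 + lam) * (discount lam * act (K₂.shortPart G s) e x) := by gcongr
        _ = _ := by rw [← mul_assoc, mul_discount hlam0, one_mul]
    rw [h1, hev, ← ENNReal.ofReal_mul (by linarith)] at h3
    exact (ENNReal.ofReal_le_ofReal_iff (Finset.sum_nonneg fun y _ =>
      mul_nonneg (K₂.prob_nonneg x y) (hv0 y))).1 h3
  have hkey := hw s hs R N hNR x₀ lam hlam v hv0 hv1 hsub
  set B := h.ballFinset x₀ (R / 2) with hB
  set q := Real.exp (η * N) - 1 with hq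
  have hq0 : 0 < q := by
    have : 1 < Real.exp (η * N) := Real.one_lt_exp_iff.2 (by positivity)
    linarith
  have hm := fun x => (h.mass_pos x).le
  have hvol2 : G.vol x₀ (2 * R) ≤ c * 2 ^ df * R ^ df := by
    have := h.vol_le x₀ (2 * R) (by linarith)
    rwa [Real.mul_rpow (by norm_num) (by linarith), ← mul_assoc] at this
  -- Cauchy–Schwarz passes from the weighted `L²` bound to an `L¹` bound, to be paired with the
  -- on-diagonal estimate.
  have hsumB : ∑ x ∈ B, G.mass x * v x ≤ c * 2 ^ df * R ^ df / q := by
    have h1 : (∑ x ∈ B, G.mass x * v x) ^ 2 ≤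
        (∑ x ∈ B, G.mass x) * ∑ x ∈ B, G.mass x * v x ^ 2 :=
      Finset.sum_sq_le_sum_mul_sum_of_sq_le_mul B (fun x _ => hm x)
        (fun x _ => mul_nonneg (hm x) (sq_nonneg _)) (fun x _ => le_of_eq (by ring))
    have h2 : ∑ x ∈ B, G.mass x ≤ c * 2 ^ df * R ^ df := by
      refine le_trans ?_ hvol2
      rw [h.vol_eq_sum]
      refine Finset.sum_le_sum_of_subset_of_nonneg (fun y hy => ?_) fun x _ _ => hm x
      rw [hB, h.mem_ballFinset] at hy
      rw [h.mem_ballFinset]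
      linarith
    rw [le_div_iff₀ hq0]
    refine abs_le_of_sq_le_sq' ?_ (by positivity) |>.2
    calc ((∑ x ∈ B, G.mass x * v x) * q) ^ 2 = (∑ x ∈ B, G.mass x * v x) ^ 2 * q ^ 2 := by ring
      _ ≤ ((∑ x ∈ B, G.mass x) * ∑ x ∈ B, G.mass x * v x ^ 2) * q ^ 2 := by gcongr
      _ = (∑ x ∈ B, G.mass x) * (q ^ 2 * ∑ x ∈ B, G.mass x * v x ^ 2) := by ring
      _ ≤ (c * 2 ^ df * R ^ df) * (c * 2 ^ df * R ^ df) := by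
          refine mul_le_mul h2 (hkey.trans hvol2) ?_ (by positivity)
          exact mul_nonneg (sq_nonneg _) (Finset.sum_nonneg fun x _ =>
            mul_nonneg (hm x) (sq_nonneg _))
      _ = _ := by ring
  have hsumB' : ∑ x ∈ B, v x ≤ c * (c * 2 ^ df * R ^ df / q) := by
    refine le_trans ?_ (mul_le_mul_of_nonneg_left hsumB (by linarith))
    rw [Finset.mul_sum]
    refine Finset.sum_le_sum fun x _ => ?_
    have h1 := h.inv_le_mass x
    rw [inv_le_iff_one_le_mul₀' (by linarith)] at h1
    nlinarith [hv0 x]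
  calc (act (K₂.shortPart G s))^[n] (Set.indicator (G.ball x₀ (R / 4)) e) x₀
      ≤ (act K₂.eprob)^[n] (Set.indicator (B : Set X) e) x₀ := by
        refine iter_mono (shortPart_le s) (fun y => ?_) n x₀
        refine Set.indicator_le_indicator_of_subset (fun y hy => ?_) (fun _ => zero_le) y
        rw [hB, Finset.mem_coe, h.mem_ballFinset]
        rw [mem_ball] at hy
        linarith
    _ = ∑' y, (act K₂.eprob)^[n] (dirac y) x₀ * Set.indicator (B : Set X) e y := iter_eq_tsum _ n x₀
    _ ≤ ∑' y, ENNReal.ofReal (A * (n : ℝ) ^ (-(df / β))) * Set.indicator (B : Set X) e y :=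
        ENNReal.tsum_le_tsum fun y => mul_le_mul' (hdiag n hn x₀ y) le_rfl
    _ = ENNReal.ofReal (A * (n : ℝ) ^ (-(df / β))) * ENNReal.ofReal (∑ x ∈ B, v x) := by
        rw [ENNReal.tsum_mul_left, tsum_eq_sum (s := B),
          ENNReal.ofReal_sum_of_nonneg fun x _ => hv0 x]
        · congr 1
          refine Finset.sum_congr rfl fun y hy => ?_
          rw [Set.indicator_of_mem (Finset.mem_coe.2 hy), hev]
        · intro y hy
          rw [Set.indicator_of_notMem (fun hy' => hy (Finset.mem_coe.1 hy'))]
    _ ≤ ENNReal.ofReal (A * (n : ℝ) ^ (-(df / β))) *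
          ENNReal.ofReal (c * (c * 2 ^ df * R ^ df / q)) := by gcongr
    _ = _ := by
        rw [← ENNReal.ofReal_mul (by positivity)]
        congr 1
        ring

theorem exists_exp_dominates {C p η : ℝ} (hη : 0 < η) (r : ℝ) (hr : 0 < r) :
    ∃ y₀ : ℝ, ∀ y, y₀ ≤ y → C * y ^ p ≤ Real.exp (η * y ^ r) - 1 := by
  have h1 := (tendsto_rpow_mul_exp_neg_mul_atTop_nhds_zero (p / r) η hη).comp
    (tendsto_rpow_atTop hr)
  have h2 : Filter.Tendsto (fun y : ℝ => Real.exp (-η * y ^ r)) Filter.atTop (nhds 0) := by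
    have := (tendsto_rpow_mul_exp_neg_mul_atTop_nhds_zero 0 η hη).comp (tendsto_rpow_atTop hr)
    simpa [Function.comp_def] using this
  have h3 := (h1.const_mul C).add h2
  rw [mul_zero, add_zero] at h3
  have h4 := h3.eventually (gt_mem_nhds (zero_lt_one : (0 : ℝ) < 1))
  obtain ⟨y₀, hy₀⟩ := Filter.eventually_atTop.1 (h4.and (Filter.eventually_gt_atTop (0 : ℝ)))
  refine ⟨y₀, fun y hy => ?_⟩
  obtain ⟨h5, h6⟩ := hy₀ y hy
  simp only [Function.comp_apply] at h5
  rw [← Real.rpow_mul h6.le, mul_div_cancel₀ _ hr.ne'] at h5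
  have h7 := Real.exp_pos (η * y ^ r)
  have h8 : Real.exp (-η * y ^ r) * Real.exp (η * y ^ r) = 1 := by
    rw [← Real.exp_add]; simp
  have h9 := mul_lt_mul_of_pos_right h5 h7
  have h10 : (C * (y ^ p * Real.exp (-η * y ^ r)) + Real.exp (-η * y ^ r)) * Real.exp (η * y ^ r)
      = C * y ^ p + 1 := by
    linear_combination (C * y ^ p + 1) * h8
  linarith

end MarkovOperator

/-! ### The exit estimate by induction over scales -/

namespace MarkovOperator

open KernelOp WeightedGraph

variable {X : Type*} {K K₁ K₂ : MarkovOperator X} {G : WeightedGraph X} {df β c a a₁ a₂ : ℝ}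

/-- The discounted exit estimate at scale `R`. -/
def ExitBound (K : MarkovOperator X) (G : WeightedGraph X) (β M R : ℝ) : Prop :=
  ∀ (x₀ : X) (lam : ℝ), 0 < lam → ∀ j : ℕ,
    exitFn (discount lam) K.eprob (G.ball x₀ R) j x₀ ≤
      ENNReal.ofReal (M * (lam * R ^ β) ^ (-(1 / 2) : ℝ))

theorem mem_ball_self {x : X} {R : ℝ} (hR : 0 ≤ R) : x ∈ G.ball x R := by
  rw [mem_ball, G.d_self]; exact hR

/-- Take killing rate `1 / n`: removing the discount over `n` steps costs only `(1 + 1/n)^n ≤ 3`. -/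
theorem ExitBound.exit_le {M R : ℝ} (h : K.ExitBound G β M R) (hM : 0 < M) (hR : 0 < R) {n : ℕ}
    (hn : 1 ≤ n) (x₀ : X) :
    exitFn 1 K.eprob (G.ball x₀ R) n x₀ ≤ ENNReal.ofReal (3 * M * (n / R ^ β) ^ (1 / 2 : ℝ)) := by
  have hn0 : (0 : ℝ) < n := by exact_mod_cast hn
  have hlam : (0 : ℝ) < 1 / n := by positivity
  have h1 := exitFn_one_le (p := K.eprob) (B := G.ball x₀ R) (t := discount (1 / n))
    (a := ENNReal.ofReal (1 + 1 / n)) ?_ (mul_discount hlam).ge n x₀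
  · refine h1.trans ((mul_le_mul' le_rfl (h x₀ _ hlam n)).trans ?_)
    rw [← ENNReal.ofReal_pow (by positivity), ← ENNReal.ofReal_mul (by positivity)]
    apply ENNReal.ofReal_le_ofReal
    have h2 : (1 + 1 / (n : ℝ)) ^ n ≤ 3 := by
      have h3 : 1 + 1 / (n : ℝ) ≤ Real.exp (1 / n) := by
        linarith [Real.add_one_le_exp (1 / (n : ℝ))]
      calc (1 + 1 / (n : ℝ)) ^ n ≤ Real.exp (1 / n) ^ n := by gcongr
        _ = Real.exp 1 := by
            rw [← Real.exp_nat_mul, mul_one_div_cancel hn0.ne']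
        _ ≤ 3 := Real.exp_one_lt_d9.le.trans (by norm_num)
    have h4 : (1 / (n : ℝ) * R ^ β) ^ (-(1 / 2) : ℝ) = (n / R ^ β) ^ (1 / 2 : ℝ) := by
      rw [Real.rpow_neg (by positivity), ← Real.inv_rpow (by positivity)]
      congr 1
      field_simp
    rw [h4, mul_assoc 3]
    gcongr
  · rw [← ENNReal.ofReal_one]
    apply ENNReal.ofReal_le_ofReal
    linarith

/-- Leaving takes at least one step, so the discount alone gives `1 / (1 + lam)`. Only the regime
`lam R^β > (M (1 + lam))²` needs an argument. -/
theorem exitFn_discount_trivial {M R lam : ℝ} (hM : 0 < M) (hR : 0 < R) (hlam : 0 < lam)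
    (h : lam * R ^ β ≤ (M * (1 + lam)) ^ 2) (x₀ : X) (j : ℕ) :
    exitFn (discount lam) K.eprob (G.ball x₀ R) j x₀ ≤
      ENNReal.ofReal (M * (lam * R ^ β) ^ (-(1 / 2) : ℝ)) := by
  refine (exitFn_le_discount (discount_le_one hlam) tsum_eprob_le j
    (mem_ball_self hR.le)).trans (ENNReal.ofReal_le_ofReal ?_)
  have h1 : ((M * (1 + lam)) ^ 2) ^ (-(1 / 2) : ℝ) ≤ (lam * R ^ β) ^ (-(1 / 2) : ℝ) :=
    Real.rpow_le_rpow_of_nonpos (by positivity) h (by norm_num)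
  have h2 : ((M * (1 + lam)) ^ 2) ^ (-(1 / 2) : ℝ) = (M * (1 + lam))⁻¹ := by
    rw [← Real.rpow_natCast, ← Real.rpow_mul (by positivity), ← Real.rpow_neg_one]
    norm_num
  rw [h2] at h1
  calc 1 / (1 + lam) = M * (M * (1 + lam))⁻¹ := by field_simp
    _ ≤ _ := by gcongr

/-- A time comparable to `R ^ β / M ^ 2` before which leaving the ball of radius `R / 4` is
unlikely. -/
theorem exists_time_of_exitBound (h : G.Regular df c) (hβ : 0 < β) (hJ : K.JumpBound G df β a)
    {κ : ℝ} (hκ : 0 < κ) : ∃ R₁ c₁ : ℝ, 4 ≤ R₁ ∧ 0 < c₁ ∧ ∀ M R : ℝ, 0 < M → R₁ ≤ R →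
      K.ExitBound G β M (R / 4) → ∃ n : ℕ, 1 ≤ n ∧ c₁ * (R ^ β / M ^ 2) ≤ n ∧
        ∀ x₀, exitFn 1 K.eprob (G.ball x₀ (R / 4)) n x₀ ≤ ENNReal.ofReal κ := by
  obtain ⟨T, hT, htail⟩ := hJ.exists_tail_bound h hβ
  set c₁ := (κ / (3 * 2 ^ β)) ^ 2 with hc₁
  have hc₁0 : 0 < c₁ := by positivity
  refine ⟨4 * max 1 ((T / κ) ^ (1 / β)), c₁ / 2, by linarith [le_max_left 1 ((T / κ) ^ (1 / β))],
    by positivity, fun M R hM hR hE => ?_⟩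
  have hR4 : max 1 ((T / κ) ^ (1 / β)) ≤ R / 4 := by linarith
  have hR1 : 1 ≤ R / 4 := (le_max_left _ _).trans hR4
  have hR0 : 0 < R := by linarith
  set t := c₁ * (R ^ β / M ^ 2) with ht
  have ht0 : 0 < t := by positivity
  rcases le_or_gt 1 t with h1 | h1
  · have hn1 : 1 ≤ ⌊t⌋₊ := Nat.le_floor (by simpa using h1)
    have hnt : (⌊t⌋₊ : ℝ) ≤ t := Nat.floor_le ht0.le
    refine ⟨⌊t⌋₊, hn1, ?_, fun x₀ => ?_⟩
    · have h2 : t < ⌊t⌋₊ + 1 := Nat.lt_floor_add_one t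
      have h3 : (1 : ℝ) ≤ ⌊t⌋₊ := by exact_mod_cast hn1
      have : c₁ / 2 * (R ^ β / M ^ 2) = t / 2 := by rw [ht]; ring
      rw [this]
      linarith
    · refine (hE.exit_le hM (by linarith) hn1 x₀).trans (ENNReal.ofReal_le_ofReal ?_)
      have h2 : (⌊t⌋₊ / (R / 4) ^ β : ℝ) ≤ (κ / (3 * M)) ^ 2 := by
        refine (div_le_div_of_nonneg_right hnt (by positivity)).trans (le_of_eq ?_)
        rw [ht, hc₁, Real.div_rpow hR0.le (by norm_num)]
        have : (4 : ℝ) ^ β = 2 ^ β * 2 ^ β := by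
          rw [← Real.mul_rpow (by norm_num) (by norm_num)]; norm_num
        rw [this]
        field_simp
      have h3 : (⌊t⌋₊ / (R / 4) ^ β : ℝ) ^ (1 / 2 : ℝ) ≤ κ / (3 * M) := by
        refine (Real.rpow_le_rpow (by positivity) h2 (by norm_num)).trans (le_of_eq ?_)
        rw [← Real.rpow_natCast, ← Real.rpow_mul (by positivity)]
        norm_num
      calc 3 * M * (⌊t⌋₊ / (R / 4) ^ β : ℝ) ^ (1 / 2 : ℝ) ≤ 3 * M * (κ / (3 * M)) := by gcongr
        _ = κ := by field_simp
  -- When the desired time is below `1` a single step is used; leaving in one step needs a jump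
  -- longer than `R / 4`, unlikely once `R ≥ R₁`.
  · refine ⟨1, le_rfl, ?_, fun x₀ => ?_⟩
    · have : c₁ / 2 * (R ^ β / M ^ 2) = t / 2 := by rw [ht]; ring
      rw [this]
      push_cast
      linarith
    · rw [exitFn_succ (mem_ball_self (by linarith)), one_mul]
      have h2 := htail x₀ (R / 4) hR1
      refine le_trans (ENNReal.tsum_le_tsum fun y => ?_) (h2.trans (ENNReal.ofReal_le_ofReal ?_))
      · by_cases hy : R / 4 < G.d x₀ y
        · rw [exitFn_of_notMem (by rw [mem_ball]; linarith), if_pos hy, mul_one]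
        · rw [exitFn_zero (by rw [mem_ball]; linarith), mul_zero]
          exact zero_le
      · have h3 : T / κ ≤ (R / 4) ^ β := by
          have := Real.rpow_le_rpow (by positivity) ((le_max_right _ _).trans hR4) hβ.le
          rwa [← Real.rpow_mul (by positivity), one_div_mul_cancel hβ.ne', Real.rpow_one] at this
        rw [Real.rpow_neg (by linarith), ← div_eq_mul_inv, div_le_iff₀ (by positivity)]
        rw [div_le_iff₀ hκ] at h3
        linarith

set_option maxHeartbeats 1000000 in
/-- The exit estimate at all scales. -/
theorem exists_exitBound (h : G.Regular df c) (hβ : 0 < β) (hJ₁ : K₁.JumpBound G df β a₁)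
    (hJ₂ : K₂.JumpBound G df β a₂) {C : ℝ} (hC : 0 < C) (hT : K₁.Tight G β C) :
    ∃ M : ℝ, 0 < M ∧ ∀ R : ℝ, 0 < R → K₂.ExitBound G β M R := by
  classical
  obtain ⟨s₀, η, L, D, hs₀, hη, hL, hD, havg⟩ := exists_average_bound h hβ hJ₁ hJ₂ hC hT
  obtain ⟨T, hT0, htail⟩ := hJ₂.exists_tail_bound h hβ
  -- The factor `2^{-β/2}` compensates the loss in passing from scale `R` to `R / 2`; the `3` is for
  -- the three error terms, each to be at most a third of the target.
  set κ : ℝ := 2 ^ (-(β / 2)) / 3 with hκ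
  have hκ0 : 0 < κ := by positivity
  obtain ⟨R₁, c₁, hR₁, hc₁, htime⟩ := exists_time_of_exitBound h hβ hJ₂ hκ0
  set ν := df / β with hν
  have hdf := h.df_pos
  have hν0 : 0 < ν := by positivity
  obtain ⟨y₀, hy₀⟩ := exists_exp_dominates (C := 3 * D * (1 / c₁) ^ ν) (p := ν + 1 / 2)
    (η := η / 40) (by positivity) (1 / (2 * β)) (by positivity)
  -- All conditions on `M` are lower bounds by constants fixed before `M`; in particular `c₁` and
  -- `R₁` do not depend on it, so the induction preserves the same `M`.
  obtain ⟨M, hM⟩ : ∃ M : ℝ, 1 ≤ M ∧ R₁ ^ β ≤ M ∧ s₀ ^ β ≤ M ∧ 20 ^ β ≤ M ∧ L ≤ M ∧ 3 * T ≤ M ∧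
      y₀ ≤ M := by
    refine ⟨max 1 (max (R₁ ^ β) (max (s₀ ^ β) (max (20 ^ β) (max L (max (3 * T) y₀))))), ?_⟩
    simp only [le_max_iff, le_refl, true_or, or_true, and_self]
  obtain ⟨hM1, hMR, hMs, hM20, hML, hMT, hMy⟩ := hM
  have hM0 : 0 < M := by linarith
  refine ⟨M, hM0, ?_⟩
  have main : ∀ R : ℝ, 0 < R → K₂.ExitBound G β M (R / 2) → K₂.ExitBound G β M (R / 4) →
      K₂.ExitBound G β M R := by
    intro R hR hE2 hE4 x₀ lam hlam j
    rcases le_or_gt (lam * R ^ β) ((M * (1 + lam)) ^ 2) with htriv | hbig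
    · exact exitFn_discount_trivial hM0 hR hlam htriv x₀ j
    set Λ := lam * R ^ β with hΛ
    have hRβ : 0 < R ^ β := by positivity
    have hΛM : M ^ 2 < Λ := lt_of_le_of_lt (by nlinarith [sq_nonneg M, mul_pos hM0 hlam]) hbig
    have hΛ0 : 0 < Λ := by positivity
    have hRβM : M ^ 2 < R ^ β := by
      have h1 : M ^ 2 * lam < Λ := lt_of_le_of_lt (by nlinarith [sq_nonneg M, sq_nonneg lam]) hbig
      rw [hΛ, mul_comm] at h1
      exact lt_of_mul_lt_mul_left h1 hlam.le
    have hRlam : M ^ 2 * lam < R ^ β := by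
      have h1 : lam * (M ^ 2 * lam) < lam * R ^ β :=
        lt_of_le_of_lt (by nlinarith [sq_nonneg M, mul_nonneg (sq_nonneg M) hlam.le]) hbig
      exact lt_of_mul_lt_mul_left h1 hlam.le
    -- The truncation length is `s = R / z`, so `s^{-β} = Λ^{1/2} / R^β` lies below `lam = Λ / R^β`
    -- by a factor `Λ^{1/2}`, while about `z / 20` annuli still fit, making the exponential gain
    -- beat any power of `Λ`.
    set z := Λ ^ (1 / (2 * β)) with hz
    have hz0 : 0 < z := by positivity
    set y := z ^ β with hy
    have hy0 : 0 < y := by positivity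
    have hyΛ : y = Λ ^ (1 / 2 : ℝ) := by
      rw [hy, hz, ← Real.rpow_mul hΛ0.le]
      congr 1
      field_simp
    have hysq : y ^ 2 = Λ := by
      rw [hyΛ, ← Real.rpow_natCast, ← Real.rpow_mul hΛ0.le]; norm_num
    have hyM : M < y := by
      refine lt_of_pow_lt_pow_left₀ 2 hy0.le ?_
      rwa [hysq]
    have hyinv : Λ ^ (-(1 / 2) : ℝ) = 1 / y := by
      rw [Real.rpow_neg hΛ0.le, ← hyΛ, one_div]
    have hz20 : 20 ≤ z := by
      rw [← Real.rpow_le_rpow_iff (by norm_num) hz0.le hβ]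
      exact hM20.trans hyM.le
    have hRR₁ : R₁ ≤ R := by
      rw [← Real.rpow_le_rpow_iff (by linarith) hR.le hβ]
      nlinarith
    set s := R / z with hs
    have hs0 : 0 < s := by positivity
    have hsβ : s ^ β = R ^ β / y := Real.div_rpow hR.le hz0.le β
    have hss₀ : s₀ ≤ s := by
      rw [← Real.rpow_le_rpow_iff (by linarith) hs0.le hβ]
      refine hMs.trans ?_
      rw [hsβ, le_div_iff₀ hy0]
      refine le_of_sq_le_sq ?_ (by positivity)
      rw [mul_pow, hysq, hΛ]
      calc M ^ 2 * (lam * R ^ β) = M ^ 2 * lam * R ^ β := by ring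
        _ ≤ R ^ β * R ^ β := mul_le_mul_of_nonneg_right hRlam.le hRβ.le
        _ = (R ^ β) ^ 2 := by ring
    have hs1 : 1 ≤ s := hs₀.trans hss₀
    have hsneg : s ^ (-β) = y / R ^ β := by
      rw [Real.rpow_neg hs0.le, hsβ, inv_div]
    have hlamΛ : lam = y ^ 2 / R ^ β := by rw [hysq, hΛ]; field_simp
    have hLs : L * s ^ (-β) ≤ lam := by
      rw [hsneg, hlamΛ, ← mul_div_assoc]
      gcongr
      nlinarith
    set N := ⌊z / 20⌋₊ with hN
    have hN1 : 1 ≤ N := Nat.le_floor (by rw [Nat.cast_one, le_div_iff₀ (by norm_num)]; linarith)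
    have hNz : (N : ℝ) ≤ z / 20 := Nat.floor_le (by positivity)
    have hzN : z / 40 ≤ N := by
      have h1 : z / 20 < N + 1 := Nat.lt_floor_add_one _
      have h2 : (1 : ℝ) ≤ N := by exact_mod_cast hN1
      linarith
    have hNR : 20 * s * N ≤ R := by
      calc 20 * s * N ≤ 20 * s * (z / 20) := by gcongr
        _ = R := by rw [hs]; field_simp
    have hsR : s ≤ R / 4 := by
      rw [hs]
      exact div_le_div_of_nonneg_left hR.le (by norm_num) (by linarith)
    obtain ⟨n, hn1, hnR, hexit⟩ := htime M R hM0 hRR₁ hE4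
    set e := exitFn (discount lam) (K₂.shortPart G s) (G.ball x₀ R) j with he
    -- A long jump before the killing time has probability of order `T s^{-β} / lam = T / y`.
    have htrunc : exitFn (discount lam) K₂.eprob (G.ball x₀ R) j x₀ ≤
        e x₀ + ENNReal.ofReal (T / y) := by
      have h1 := exitFn_add_le (p := K₂.shortPart G s) (q := K₂.longPart G s)
        (t := discount lam) (B := G.ball x₀ R) (W := ENNReal.ofReal (T / y))
        (fun x => by
          have := congrFun (shortPart_add_longPart (K := K₂) (G := G) s) x
          simp only [funext_iff] at this
          simp only [this]
          exact tsum_eprob_le x) (discount_le_one hlam) (fun x => ?_) j x₀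
      · rwa [shortPart_add_longPart] at h1
      · have h2 : ∑' y, K₂.longPart G s x y ≤ ENNReal.ofReal (T * s ^ (-β)) := htail x s hs1
        calc discount lam * (ENNReal.ofReal (T / y) + ∑' y, K₂.longPart G s x y)
            ≤ discount lam * (ENNReal.ofReal (T / y) + ENNReal.ofReal (T * s ^ (-β))) := by gcongr
          _ = discount lam * (ENNReal.ofReal (1 + lam) * ENNReal.ofReal (T / y)) := by
              rw [← ENNReal.ofReal_add (by positivity) (by positivity),
                ← ENNReal.ofReal_mul (by positivity)]
              congr 2
              rw [hsneg, hlamΛ]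
              field_simp
          _ = ENNReal.ofReal (T / y) := by
              rw [← mul_assoc, mul_comm (discount lam), mul_discount hlam, one_mul]
    have hsplit : e x₀ ≤ (act (K₂.shortPart G s))^[n] (Set.indicator (G.ball x₀ (R / 4)) e) x₀ +
        ENNReal.ofReal (M * (lam * (R / 2) ^ β) ^ (-(1 / 2) : ℝ)) *
          exitFn 1 (K₂.shortPart G s) (G.ball x₀ (R / 4)) n x₀ := by
      refine subsolution_le (N := G.ball x₀ (R / 2)) ?_ ?_ ?_ n (mem_ball_self (by positivity))
      · intro x hx y hy
        rw [mem_ball] at hx hy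
        rw [shortPart, if_neg]
        intro hxy
        linarith [G.d_triangle x₀ x y]
      · intro x hx
        rw [mem_ball] at hx
        refine (exitFn_subsolution j (by rw [mem_ball]; linarith)).trans ?_
        exact mul_le_of_le_one_left' (discount_le_one hlam)
      · intro x hx
        -- Around a point of the ball of radius `R / 2` a ball of that radius stays inside the large
        -- one, so the estimate at scale `R / 2` applies.
        rw [mem_ball] at hx
        refine (exitFn_mono (discount_le_one hlam) tsum_eprob_le (shortPart_le s)
          (B' := G.ball x (R / 2)) ?_ j x).trans (hE2 x lam hlam j)
        intro w hw
        rw [mem_ball] at hw ⊢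
        linarith [G.d_triangle x₀ x w]
    have hterm3 : ENNReal.ofReal (M * (lam * (R / 2) ^ β) ^ (-(1 / 2) : ℝ)) *
        exitFn 1 (K₂.shortPart G s) (G.ball x₀ (R / 4)) n x₀ ≤ ENNReal.ofReal (M / 3 / y) := by
      have h1 : exitFn 1 (K₂.shortPart G s) (G.ball x₀ (R / 4)) n x₀ ≤ ENNReal.ofReal κ :=
        (exitFn_mono le_rfl tsum_eprob_le (shortPart_le s) subset_rfl n x₀).trans (hexit x₀)
      refine (mul_le_mul' le_rfl h1).trans ?_
      rw [← ENNReal.ofReal_mul (by positivity)]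
      apply ENNReal.ofReal_le_ofReal
      apply le_of_eq
      have h2 : (lam * (R / 2) ^ β) ^ (-(1 / 2) : ℝ) = 1 / y * 2 ^ (β / 2) := by
        have e1 : lam * (R / 2) ^ β = Λ / 2 ^ β := by
          rw [Real.div_rpow hR.le (by norm_num), hΛ]; ring
        rw [e1, Real.div_rpow hΛ0.le (by positivity), hyinv, ← Real.rpow_mul (by norm_num),
          div_eq_mul_inv, ← Real.rpow_neg (by norm_num)]
        congr 2
        ring
      have h3 : (2 : ℝ) ^ (β / 2) * 2 ^ (-(β / 2)) = 1 := by
        rw [← Real.rpow_add (by norm_num)]; simp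
      rw [h2, hκ]
      linear_combination (M / 3 / y) * h3
    have hterm2 : (act (K₂.shortPart G s))^[n] (Set.indicator (G.ball x₀ (R / 4)) e) x₀ ≤
        ENNReal.ofReal (M / 3 / y) := by
      refine (havg s hss₀ R N hN1 hNR x₀ lam hlam hLs j n hn1).trans
        (ENNReal.ofReal_le_ofReal ?_)
      have hn0 : (0 : ℝ) < n := by exact_mod_cast hn1
      -- The time `n` is only of order `R^β / M²`, but `M² < Λ` turns this loss into a power of `Λ`
      -- with constants independent of `M`.
      have h1 : (n : ℝ) ^ (-(df / β)) * R ^ df ≤ (1 / c₁) ^ ν * Λ ^ ν := by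
        have e1 : R ^ df = (R ^ β) ^ ν := by
          rw [← Real.rpow_mul hR.le, hν, mul_div_cancel₀ _ hβ.ne']
        rw [← hν, Real.rpow_neg hn0.le, ← Real.inv_rpow hn0.le, e1,
          ← Real.mul_rpow (by positivity) hRβ.le, ← Real.mul_rpow (by positivity) hΛ0.le]
        refine Real.rpow_le_rpow (by positivity) ?_ hν0.le
        have h2 : R ^ β ≤ n * (M ^ 2 / c₁) := by
          have : R ^ β = c₁ * (R ^ β / M ^ 2) * (M ^ 2 / c₁) := by field_simp
          rw [this]
          gcongr
        calc (n : ℝ)⁻¹ * R ^ β ≤ (n : ℝ)⁻¹ * (n * (M ^ 2 / c₁)) := by gcongr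
          _ = M ^ 2 / c₁ := by field_simp
          _ ≤ Λ / c₁ := by gcongr
          _ = _ := by ring
      have h2 : 3 * D * (1 / c₁) ^ ν * Λ ^ (ν + 1 / 2) ≤ Real.exp (η * N) - 1 := by
        refine (hy₀ Λ (by nlinarith)).trans ?_
        rw [← hz]
        refine sub_le_sub_right (Real.exp_le_exp.2 ?_) 1
        linarith [mul_le_mul_of_nonneg_left hzN hη.le]
      have h3 : Λ ^ (ν + 1 / 2) = Λ ^ ν * y := by
        rw [Real.rpow_add hΛ0, hyΛ]
      rw [h3] at h2
      have hpos : 0 < 3 * D * (1 / c₁) ^ ν * (Λ ^ ν * y) := by positivity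
      calc D * ((n : ℝ) ^ (-(df / β)) * R ^ df / (Real.exp (η * N) - 1))
          ≤ D * (((1 / c₁) ^ ν * Λ ^ ν) / (3 * D * (1 / c₁) ^ ν * (Λ ^ ν * y))) := by gcongr
        _ = 1 / 3 / y := by
            have hp1 : (1 / c₁) ^ ν ≠ 0 := by positivity
            have hp2 : Λ ^ ν ≠ 0 := by positivity
            field_simp
        _ ≤ _ := by gcongr
    have hterm1 : ENNReal.ofReal (T / y) ≤ ENNReal.ofReal (M / 3 / y) := by
      apply ENNReal.ofReal_le_ofReal
      gcongr
      linarith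
    calc exitFn (discount lam) K₂.eprob (G.ball x₀ R) j x₀
        ≤ e x₀ + ENNReal.ofReal (T / y) := htrunc
      _ ≤ (ENNReal.ofReal (M / 3 / y) + ENNReal.ofReal (M / 3 / y)) +
          ENNReal.ofReal (M / 3 / y) :=
          add_le_add (hsplit.trans (add_le_add hterm2 hterm3)) hterm1
      _ = ENNReal.ofReal (M * Λ ^ (-(1 / 2) : ℝ)) := by
          rw [← ENNReal.ofReal_add (by positivity) (by positivity),
            ← ENNReal.ofReal_add (by positivity) (by positivity), hyinv]
          congr 1
          ring
  -- For `R ≤ 1` the trivial regime covers every killing rate, which starts the induction.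
  have hscale : ∀ k : ℕ, ∀ R : ℝ, 0 < R → R ≤ 2 ^ k → K₂.ExitBound G β M R := by
    intro k
    induction k with
    | zero =>
      intro R hR hR1 x₀ lam hlam j
      refine exitFn_discount_trivial hM0 hR hlam ?_ x₀ j
      have h1 : R ^ β ≤ 1 := Real.rpow_le_one hR.le (by simpa using hR1) hβ.le
      have h2 : (1 + lam) ≤ M * (1 + lam) := by nlinarith
      nlinarith
    | succ k ih =>
      intro R hR hRk
      rw [pow_succ] at hRk
      exact main R hR (ih _ (by positivity) (by linarith)) (ih _ (by positivity) (by linarith))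
  intro R hR
  obtain ⟨k, hk⟩ := pow_unbounded_of_one_lt R (by norm_num : (1 : ℝ) < 2)
  exact hscale k R hR hk.le

end MarkovOperator

/-! ### Off-diagonal upper bound -/

namespace MarkovOperator

open KernelOp WeightedGraph

variable {X : Type*} {K : MarkovOperator X} {G : WeightedGraph X} {df β c a : ℝ}

theorem one_le_mul_emass (h : G.Regular df c) (x : X) : 1 ≤ ENNReal.ofReal c * G.emass x := by
  have hc := h.one_le
  rw [emass, ← ENNReal.ofReal_mul (by linarith), ← ENNReal.ofReal_one]
  apply ENNReal.ofReal_le_ofReal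
  have := h.inv_le_mass x
  rwa [inv_le_iff_one_le_mul₀' (by linarith)] at this

theorem emass_le (h : G.Regular df c) (x : X) : G.emass x ≤ ENNReal.ofReal c :=
  ENNReal.ofReal_le_ofReal (h.mass_le x)

theorem symm_shortPart (h : G.Regular df c) (hK : K.IsSymmetric G) (s : ℝ) :
    Symm G.emass (K.shortPart G s) := by
  intro x y
  unfold shortPart
  rw [G.d_comm y x]
  split_ifs
  · exact symm_eprob h hK x y
  · simp

/-- Multiplicative iteration of exit probabilities for walks with bounded jumps. -/
theorem exitFn_shortPart_le_pow {ρ : ℝ} (hρ : 0 < ρ) {m : ℕ} {Q : ℝ≥0∞}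
    (hQ : ∀ z, exitFn 1 K.eprob (G.ball z ρ) m z ≤ Q) (x₀ : X) (r : ℝ) (k : ℕ) {z : X}
    (hz : G.d x₀ z ≤ r - 2 * k * ρ) :
    exitFn 1 (K.shortPart G ρ) (G.ball x₀ r) m z ≤ Q ^ k := by
  induction k generalizing z with
  | zero => simpa using exitFn_le_one le_rfl (tsum_shortPart_le ρ) m z
  | succ k ih =>
    push_cast at hz
    have hk : 0 ≤ (k : ℝ) * ρ := by positivity
    have h1 := exitFn_le_mul (p := K.shortPart G ρ) (B := G.ball x₀ r) (B' := G.ball z ρ)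
      (N := G.ball z (2 * ρ)) (S := Q ^ k) ?_ ?_ m ?_ le_rfl (mem_ball_self (x := z) (by positivity))
    · refine h1.trans ?_
      rw [pow_succ]
      gcongr
      exact (exitFn_mono le_rfl tsum_eprob_le (shortPart_le ρ) subset_rfl m z).trans (hQ z)
    · intro x hx y hy
      rw [mem_ball] at hx hy
      rw [shortPart, if_neg]
      intro hxy
      linarith [G.d_triangle z x y]
    · intro x hx
      rw [mem_ball] at hx ⊢
      linarith [G.d_triangle x₀ z x]
    · intro x hx _
      rw [mem_ball] at hx
      exact ih (by linarith [G.d_triangle x₀ z x])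

/-- Meyer's decomposition: at each of the `n` steps a jump longer than `ρ` contributes at most `E`
times the total mass of the kernel at the remaining time, which is at most `c²` by conservation. -/
theorem iter_le_short_add (h : G.Regular df c) (hK : K.IsSymmetric G) {ρ : ℝ} {E : ℝ≥0∞}
    (hE : ∀ x y, K.longPart G ρ x y ≤ E) (n : ℕ) (x y : X) :
    (act K.eprob)^[n] (dirac y) x ≤ (act (K.shortPart G ρ))^[n] (dirac y) x +
      n * (E * ENNReal.ofReal c * ENNReal.ofReal c) := by
  induction n generalizing x with
  | zero => simp
  | succ n ih =>
    rw [Function.iterate_succ_apply', Function.iterate_succ_apply']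
    have h1 : act K.eprob ((act K.eprob)^[n] (dirac y)) x =
        act (K.shortPart G ρ) ((act K.eprob)^[n] (dirac y)) x +
        act (K.longPart G ρ) ((act K.eprob)^[n] (dirac y)) x := by
      rw [← act_add_left, shortPart_add_longPart]
    rw [h1]
    have h2 : act (K.shortPart G ρ) ((act K.eprob)^[n] (dirac y)) x ≤
        act (K.shortPart G ρ) ((act (K.shortPart G ρ))^[n] (dirac y)) x +
          n * (E * ENNReal.ofReal c * ENNReal.ofReal c) := by
      refine (act_mono_right ih x).trans ?_
      rw [act_add_right]
      gcongr
      exact act_const_le (tsum_shortPart_le ρ) _ x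
    have h3 : act (K.longPart G ρ) ((act K.eprob)^[n] (dirac y)) x ≤
        E * ENNReal.ofReal c * ENNReal.ofReal c := by
      calc act (K.longPart G ρ) ((act K.eprob)^[n] (dirac y)) x
          ≤ ∑' z, (E * ENNReal.ofReal c) * (G.emass z * (act K.eprob)^[n] (dirac y) z) := by
            refine ENNReal.tsum_le_tsum fun z => ?_
            calc K.longPart G ρ x z * (act K.eprob)^[n] (dirac y) z
                ≤ E * ((ENNReal.ofReal c * G.emass z) * (act K.eprob)^[n] (dirac y) z) :=
                  mul_le_mul' (hE x z) (le_mul_of_one_le_left' (one_le_mul_emass h z))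
              _ = _ := by ring
        _ = (E * ENNReal.ofReal c) * G.emass y := by
            rw [ENNReal.tsum_mul_left, pairing_one_iter h hK]
        _ ≤ _ := by gcongr; exact emass_le h y
    calc _ ≤ (act (K.shortPart G ρ) ((act (K.shortPart G ρ))^[n] (dirac y)) x +
          n * (E * ENNReal.ofReal c * ENNReal.ofReal c)) +
          E * ENNReal.ofReal c * ENNReal.ofReal c := add_le_add h2 h3
      _ = _ := by push_cast; ring

/-- The intermediate point is farther than `r` from `x` or from `y`. In the first case the first
stretch leaves the ball at `x`; in the second, time reversal at the cost of `c²` makes the other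
stretch leave the ball at `y`. The remaining factor is bounded by `U`. -/
theorem short_iter_le (h : G.Regular df c) (hK : K.IsSymmetric G) {ρ r : ℝ} {n₁ n₂ : ℕ}
    {U q : ℝ≥0∞} {x y : X} (hr : 2 * r < G.d x y)
    (hU₁ : ∀ z, (act K.eprob)^[n₁] (dirac z) x ≤ U) (hU₂ : ∀ z, (act K.eprob)^[n₂] (dirac y) z ≤ U)
    (hq₁ : exitFn 1 (K.shortPart G ρ) (G.ball x r) n₁ x ≤ q)
    (hq₂ : exitFn 1 (K.shortPart G ρ) (G.ball y r) n₂ y ≤ q) :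
    (act (K.shortPart G ρ))^[n₁ + n₂] (dirac y) x ≤
      (1 + ENNReal.ofReal c * ENNReal.ofReal c) * (U * q) := by
  set A := K.shortPart G ρ with hA
  have hs := symm_iter (symm_shortPart h hK ρ) n₂
  have hle : ∀ n f z, (act A)^[n] f z ≤ (act K.eprob)^[n] f z := fun n f z =>
    iter_mono (shortPart_le ρ) (fun _ => le_rfl) n z
  have hflip : ∀ z, (act A)^[n₂] (dirac y) z ≤
      ENNReal.ofReal c * ENNReal.ofReal c * (act A)^[n₂] (dirac z) y := by
    intro z
    calc (act A)^[n₂] (dirac y) z ≤ (ENNReal.ofReal c * G.emass z) * (act A)^[n₂] (dirac y) z :=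
          le_mul_of_one_le_left' (one_le_mul_emass h z)
      _ = ENNReal.ofReal c * (G.emass z * (act A)^[n₂] (dirac y) z) := by ring
      _ = ENNReal.ofReal c * (G.emass y * (act A)^[n₂] (dirac z) y) := by rw [hs z y]
      _ ≤ ENNReal.ofReal c * (ENNReal.ofReal c * (act A)^[n₂] (dirac z) y) := by
          gcongr; exact emass_le h y
      _ = _ := by ring
  rw [Function.iterate_add_apply, iter_eq_tsum]
  calc ∑' z, (act A)^[n₁] (dirac z) x * (act A)^[n₂] (dirac y) z
      ≤ ∑' z, (U * ((act A)^[n₁] (dirac z) x * Set.indicator (G.ball x r)ᶜ 1 z) +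
          (U * (ENNReal.ofReal c * ENNReal.ofReal c)) *
            ((act A)^[n₂] (dirac z) y * Set.indicator (G.ball y r)ᶜ 1 z)) := by
        refine ENNReal.tsum_le_tsum fun z => ?_
        by_cases hz : z ∈ (G.ball x r)ᶜ
        · rw [Set.indicator_of_mem hz, Pi.one_apply, mul_one, mul_comm U]
          refine le_trans ?_ le_self_add
          gcongr
          exact (hle _ _ _).trans (hU₂ z)
        · have hz' : z ∈ (G.ball y r)ᶜ := by
            simp only [Set.mem_compl_iff, mem_ball, not_le, not_lt] at hz ⊢
            have := G.d_triangle x z y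
            rw [G.d_comm z y] at this
            linarith
          rw [Set.indicator_of_mem hz', Pi.one_apply, mul_one, mul_assoc U]
          refine le_trans ?_ le_add_self
          exact mul_le_mul' ((hle _ _ _).trans (hU₁ z)) (hflip z)
    _ = U * (act A)^[n₁] (Set.indicator (G.ball x r)ᶜ 1) x +
          (U * (ENNReal.ofReal c * ENNReal.ofReal c)) *
            (act A)^[n₂] (Set.indicator (G.ball y r)ᶜ 1) y := by
        rw [ENNReal.tsum_add, ENNReal.tsum_mul_left, ENNReal.tsum_mul_left, ← iter_eq_tsum,
          ← iter_eq_tsum]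
    _ ≤ U * q + (U * (ENNReal.ofReal c * ENNReal.ofReal c)) * q := by
        gcongr
        · exact (iter_indicator_compl_le (tsum_shortPart_le ρ) n₁ x).trans hq₁
        · exact (iter_indicator_compl_le (tsum_shortPart_le ρ) n₂ y).trans hq₂
    _ = _ := by ring

/-- The off-diagonal upper bound. -/
theorem exists_offDiagonal_bound (h : G.Regular df c) (hβ : 0 < β) (hJ : K.JumpBound G df β a)
    {M : ℝ} (hM : 0 < M) (hE : ∀ R : ℝ, 0 < R → K.ExitBound G β M R) :
    ∃ C, 0 < C ∧ ∀ n : ℕ, 1 ≤ n → ∀ x y, x ≠ y →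
      (act K.eprob)^[n] (dirac y) x ≤ ENNReal.ofReal (C * (n * G.d x y ^ (-(df + β)))) := by
  obtain ⟨A, hA, hdiag⟩ := hJ.exists_diagonal_bound h hβ
  have hc := h.one_le
  have hc0 : 0 < c := by linarith
  have ha := hJ.one_le
  have hdf := h.df_pos
  set ν := df / β with hν
  have hν0 : 0 < ν := by positivity
  have hβν : β * (1 + ν) = df + β := by rw [hν]; field_simp; ring
  set γ := df + β with hγ
  have hγ0 : 0 < γ := by positivity
  -- Each exit contributes `(n / ρ^β)^{1/2}`; with `q` of them the power is at least `1 + ν`, just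
  -- what turns `n^{-ν}` into `n ρ^{-(df+β)}`.
  set q := ⌈2 * (1 + ν)⌉₊ with hq
  have hq2 : 2 * (1 + ν) ≤ q := Nat.le_ceil _
  have hq1 : (1 : ℝ) ≤ q := by linarith
  set C₁ := A + a * c * c + (1 + c * c) * (A * 3 ^ ν * (3 * M) ^ q) with hC₁
  have hC₁0 : 0 < C₁ := by positivity
  refine ⟨C₁ * (5 * q) ^ γ, by positivity, fun n hn x y hxy => ?_⟩
  have hD : 1 ≤ G.d x y := one_le_d hxy
  -- `q` exits at scale `ρ` need radius `2 q ρ`, and two such balls around `x` and `y` are disjoint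
  -- since `4 q ρ` is `4/5` of the distance.
  set ρ := G.d x y / (5 * q) with hρ
  have hρ0 : 0 < ρ := by positivity
  have hρD : ρ ≤ G.d x y := div_le_self (by linarith) (by linarith)
  have hn0 : (0 : ℝ) < n := by exact_mod_cast hn
  suffices hmain : (act K.eprob)^[n] (dirac y) x ≤ ENNReal.ofReal (C₁ * (n * ρ ^ (-γ))) by
    refine hmain.trans (ENNReal.ofReal_le_ofReal (le_of_eq ?_))
    rw [hρ, Real.div_rpow (by linarith) (by positivity), Real.rpow_neg (by positivity : (0 : ℝ) ≤ 5 * q),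
      div_inv_eq_mul]
    ring
  have hργ : ρ ^ (-γ) = (ρ ^ β) ^ (-(1 + ν)) := by
    rw [← Real.rpow_mul hρ0.le, ← hβν]; congr 1; ring
  have hnν : (n : ℝ) ^ (-ν) = n * (n : ℝ) ^ (-(1 + ν)) := by
    conv_rhs => rw [← Real.rpow_one_add' hn0.le (by linarith)]
    congr 1; ring
  have hC₁A : A ≤ C₁ := by
    have : 0 ≤ a * c * c + (1 + c * c) * (A * 3 ^ ν * (3 * M) ^ q) := by positivity
    rw [hC₁]; linarith
  have hlong : ∀ x y, K.longPart G ρ x y ≤ ENNReal.ofReal (a * ρ ^ (-γ)) := by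
    intro x y
    unfold longPart
    split_ifs with hd
    · refine ENNReal.ofReal_le_ofReal ((hJ.prob_le x y).trans ?_)
      refine mul_le_mul_of_nonneg_left ?_ (by linarith)
      exact Real.rpow_le_rpow_of_nonpos hρ0 (by linarith) (by linarith)
    · exact zero_le
  rcases le_or_gt (n : ℝ) (ρ ^ β) with hnρ | hnρ
  · have hsplit := iter_le_short_add h hJ.symm hlong n x y
    have hshort : (act (K.shortPart G ρ))^[n] (dirac y) x ≤
        ENNReal.ofReal ((1 + c * c) * (A * 3 ^ ν * (3 * M) ^ q) * (n * ρ ^ (-γ))) := by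
      rcases Nat.lt_or_ge n 2 with h2 | h2
      · obtain rfl : n = 1 := by omega
        rw [Function.iterate_one, act_dirac, shortPart, if_neg]
        · exact zero_le
        · rw [not_le, hρ]
          exact div_lt_self (by linarith) (by linarith)
      · have hn12 : n / 2 + (n - n / 2) = n := by omega
        have hpow : ∀ m : ℕ, 1 ≤ m → n ≤ 3 * m →
            (m : ℝ) ^ (-ν) ≤ 3 ^ ν * (n : ℝ) ^ (-ν) := by
          intro m hm hnm
          have h3 : (n : ℝ) / 3 ≤ m := by
            rw [div_le_iff₀ (by norm_num), mul_comm]; exact_mod_cast hnm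
          refine (Real.rpow_le_rpow_of_nonpos (by positivity) h3 (by linarith)).trans
            (le_of_eq ?_)
          rw [Real.div_rpow hn0.le (by norm_num), Real.rpow_neg (by norm_num : (0 : ℝ) ≤ 3),
            div_inv_eq_mul, mul_comm]
        have hU : ∀ m : ℕ, 1 ≤ m → n ≤ 3 * m → ∀ x y, (act K.eprob)^[m] (dirac y) x ≤
            ENNReal.ofReal (A * (3 ^ ν * (n : ℝ) ^ (-ν))) := by
          intro m hm hnm x y
          refine (hdiag m hm x y).trans (ENNReal.ofReal_le_ofReal ?_)
          gcongr
          exact hpow m hm hnm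
        have hexit : ∀ m : ℕ, m ≤ n → ∀ z, exitFn 1 (K.shortPart G ρ) (G.ball z (2 * q * ρ)) m z ≤
            ENNReal.ofReal (3 * M * (n / ρ ^ β) ^ (1 / 2 : ℝ)) ^ q := by
          intro m hm z
          refine (exitFn_mono_time hm z).trans (exitFn_shortPart_le_pow hρ0
            (fun w => (hE ρ hρ0).exit_le hM hρ0 hn w) z _ q ?_)
          rw [G.d_self, sub_self]
        have h3 := short_iter_le h hJ.symm (ρ := ρ) (r := 2 * q * ρ) (n₁ := n / 2)
          (n₂ := n - n / 2) (x := x) (y := y) ?_ (fun z => hU _ (by omega) (by omega) x z)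
          (fun z => hU _ (by omega) (by omega) z y) (hexit _ (by omega) x)
          (hexit _ (by omega) y)
        · rw [hn12] at h3
          refine h3.trans ?_
          have hx0 : 0 ≤ (n : ℝ) / ρ ^ β := by positivity
          rw [← ENNReal.ofReal_pow (by positivity), ← ENNReal.ofReal_mul (by positivity),
            ← ENNReal.ofReal_mul (by positivity), ← ENNReal.ofReal_one,
            ← ENNReal.ofReal_add zero_le_one (by positivity), ← ENNReal.ofReal_mul (by positivity)]
          apply ENNReal.ofReal_le_ofReal
          have h4 : ((n / ρ ^ β) ^ (1 / 2 : ℝ)) ^ q ≤ ((n : ℝ) / ρ ^ β) ^ (1 + ν) := by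
            rw [← Real.rpow_natCast, ← Real.rpow_mul hx0]
            refine Real.rpow_le_rpow_of_exponent_ge (by positivity) ?_ (by linarith)
            rw [div_le_one (by positivity)]
            exact hnρ
          have h5 : (n : ℝ) ^ (-ν) * ((n : ℝ) / ρ ^ β) ^ (1 + ν) = n * ρ ^ (-γ) := by
            rw [hργ, hnν, Real.div_rpow hn0.le (by positivity), Real.rpow_neg hn0.le,
              Real.rpow_neg (by positivity)]
            have : (n : ℝ) ^ (1 + ν) ≠ 0 := by positivity
            field_simp
          calc (1 + c * c) * (A * (3 ^ ν * (n : ℝ) ^ (-ν)) *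
                (3 * M * (n / ρ ^ β) ^ (1 / 2 : ℝ)) ^ q)
              = (1 + c * c) * (A * 3 ^ ν * (3 * M) ^ q) *
                ((n : ℝ) ^ (-ν) * ((n / ρ ^ β) ^ (1 / 2 : ℝ)) ^ q) := by rw [mul_pow]; ring
            _ ≤ (1 + c * c) * (A * 3 ^ ν * (3 * M) ^ q) *
                ((n : ℝ) ^ (-ν) * ((n : ℝ) / ρ ^ β) ^ (1 + ν)) := by gcongr
            _ = _ := by rw [h5]
        · rw [hρ]
          have e1 : 2 * (2 * (q : ℝ) * (G.d x y / (5 * q))) = 4 / 5 * G.d x y := by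
            field_simp; norm_num
          rw [e1]
          linarith
    refine (hsplit.trans (add_le_add_left hshort _)).trans ?_
    have e2 : (n : ℝ≥0∞) * (ENNReal.ofReal (a * ρ ^ (-γ)) * ENNReal.ofReal c * ENNReal.ofReal c) =
        ENNReal.ofReal (a * c * c * (n * ρ ^ (-γ))) := by
      rw [← ENNReal.ofReal_natCast, ← ENNReal.ofReal_mul (by positivity),
        ← ENNReal.ofReal_mul (by positivity), ← ENNReal.ofReal_mul (by positivity)]
      congr 1; ring
    rw [e2, ← ENNReal.ofReal_add (by positivity) (by positivity)]
    apply ENNReal.ofReal_le_ofReal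
    rw [← add_mul]
    gcongr
    rw [hC₁]
    linarith
  -- For `n > ρ^β` the on-diagonal bound is already the smaller one.
  · refine (hdiag n hn x y).trans (ENNReal.ofReal_le_ofReal ?_)
    rw [hnν, hργ]
    have h1 : (n : ℝ) ^ (-(1 + ν)) ≤ (ρ ^ β) ^ (-(1 + ν)) :=
      Real.rpow_le_rpow_of_nonpos (by positivity) hnρ.le (by linarith)
    gcongr

end MarkovOperator

/-! ### Lower bound -/

namespace KernelOp

variable {X : Type*} {p A b : X → X → ℝ≥0∞}

/-- Survival of the walk killed at the jumps in `b`: each step loses at most `t`. -/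
theorem one_le_iter_one_add {t : ℝ≥0∞} (hp : ∀ x, ∑' y, p x y = 1)
    (hsplit : ∀ x y, p x y = A x y + b x y) (hb : ∀ x, ∑' y, b x y ≤ t) (m : ℕ) (x : X) :
    1 ≤ (act A)^[m] (fun _ => 1) x + m * t := by
  have hA1 : ∀ x, ∑' y, A x y ≤ 1 := fun x =>
    (ENNReal.tsum_le_tsum fun y => by rw [hsplit]; exact le_self_add).trans (hp x).le
  induction m generalizing x with
  | zero => simp
  | succ m ih =>
    rw [Function.iterate_succ_apply']
    calc 1 = act A (fun _ => 1) x + ∑' y, b x y := by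
          simp only [act, mul_one]
          rw [← ENNReal.tsum_add, ← hp x]
          exact tsum_congr fun y => hsplit x y
      _ ≤ act A (fun z => (act A)^[m] (fun _ => 1) z + m * t) x + t :=
          add_le_add (act_mono_right ih x) (hb x)
      _ ≤ (act A ((act A)^[m] (fun _ => 1)) x + m * t) + t := by
          rw [act_add_right]
          gcongr
          exact act_const_le hA1 _ x
      _ = _ := by push_cast; ring

/-- Duhamel's expansion of `(A + b)^n`, keeping only the terms with at most one factor `b`. -/
theorem iter_add_sum_le {κ : ℝ≥0∞} {f g : X → ℝ≥0∞} (hsplit : ∀ x y, p x y = A x y + b x y)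
    (n : ℕ) (hb : ∀ i < n, ∀ z, κ * g z ≤ act b ((act A)^[i] f) z) (z : X) :
    (act A)^[n] f z + ∑ m ∈ Finset.range n, κ * (act A)^[m] g z ≤ (act p)^[n] f z := by
  induction n generalizing z with
  | zero => simp
  | succ n ih =>
    have ih' := ih fun i hi => hb i (by omega)
    have hAp : ∀ x y, A x y ≤ p x y := fun x y => by rw [hsplit]; exact le_self_add
    rw [Finset.sum_range_succ', Function.iterate_succ_apply' (act p)]
    have e1 : act p ((act p)^[n] f) z = act A ((act p)^[n] f) z + act b ((act p)^[n] f) z := by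
      rw [← act_add_left]
      exact tsum_congr fun y => by simp only [← hsplit]
    rw [e1, ← add_assoc]
    refine add_le_add ?_ ?_
    · refine le_trans (le_of_eq ?_) (act_mono_right ih' z)
      rw [act_add_right, act_sum, Function.iterate_succ_apply']
      congr 1
      refine Finset.sum_congr rfl fun m _ => ?_
      rw [act_const_mul, Function.iterate_succ_apply']
    · refine (hb n (by omega) z).trans (act_mono_right (fun y => ?_) z)
      exact iter_mono hAp (fun _ => le_rfl) n y

end KernelOp

namespace MarkovOperator

open KernelOp WeightedGraph

variable {X : Type*} {K K₁ K₂ : MarkovOperator X} {G : WeightedGraph X} {df β c a : ℝ}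

/-- The lower bound in terms of a large radius `r`. -/
theorem exists_lower_bound_radius (h : G.Regular df c) (hβ : 0 < β) (hJ : K.JumpBound G df β a)
    {M : ℝ} (hM : 0 < M) (hE : ∀ R : ℝ, 0 < R → K.ExitBound G β M R) :
    ∃ B C : ℝ, 1 ≤ B ∧ 0 < C ∧ ∀ n : ℕ, 1 ≤ n → ∀ (x y : X) (r : ℝ), 1 ≤ r →
      B * n ≤ r ^ β → G.d x y ≤ r → C * (n * r ^ (-(df + β))) ≤ K.kernel G n x y := by
  classical
  have hc := h.one_le
  have hc0 : 0 < c := by linarith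
  have ha := hJ.one_le
  have ha0 : 0 < a := by linarith
  have hdf := h.df_pos
  set γ := df + β with hγ
  have hγ0 : 0 < γ := by positivity
  refine ⟨max 4 ((12 * M) ^ 2), a⁻¹ * c⁻¹ * 4 ^ (-γ) / 4, by linarith [le_max_left 4 ((12 * M) ^ 2)],
    by positivity, fun n hn x y r hr hnr hxy => ?_⟩
  have hr0 : 0 < r := by linarith
  have hn0 : (0 : ℝ) < n := by exact_mod_cast hn
  set ε := a⁻¹ * c⁻¹ * (1 + 3 * r) ^ (-γ) with hε
  have hε0 : 0 < ε := by positivity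
  -- The jumps singled out can take any point within `r` of `x` to any point within `r` of `y`,
  -- hence the range `3 r`. Making `b` flat keeps `A = K - b` symmetric.
  set b : X → X → ℝ≥0∞ := fun x y => if G.d x y ≤ 3 * r then ENNReal.ofReal ε * G.emass y else 0
    with hb
  have hbp : ∀ x y, b x y ≤ K.eprob x y := by
    intro x y
    simp only [hb]
    split_ifs with hd
    · rw [emass, eprob, ← ENNReal.ofReal_mul hε0.le]
      apply ENNReal.ofReal_le_ofReal
      refine le_trans ?_ (hJ.le_prob x y)
      have h1 : (1 + 3 * r) ^ (-γ) ≤ (1 + G.d x y) ^ (-γ) :=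
        Real.rpow_le_rpow_of_nonpos (by linarith [G.d_nonneg x y]) (by linarith) (by linarith)
      calc ε * G.mass y ≤ ε * c := by gcongr; exact h.mass_le y
        _ = a⁻¹ * (1 + 3 * r) ^ (-γ) := by rw [hε]; field_simp
        _ ≤ _ := by gcongr
    · exact zero_le
  have hsb : Symm G.emass b := by
    intro x z
    simp only [hb, G.d_comm z x]
    split_ifs
    · ring
    · simp
  set A : X → X → ℝ≥0∞ := fun x y => K.eprob x y - b x y with hA
  have hsplit : ∀ x y, K.eprob x y = A x y + b x y := fun x y =>
    (tsub_add_cancel_of_le (hbp x y)).symm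
  have hAp : ∀ x y, A x y ≤ K.eprob x y := fun x y => tsub_le_self
  have hA1 : ∀ x, ∑' y, A x y ≤ 1 := fun x => (ENNReal.tsum_le_tsum (hAp x)).trans (tsum_eprob_le x)
  have hsA : Symm G.emass A := by
    intro x y
    simp only [hA]
    rw [ENNReal.mul_sub fun _ _ => emass_ne_top x, ENNReal.mul_sub fun _ _ => emass_ne_top y,
      symm_eprob h hJ.symm x y, hsb x y]
  have hbsum : ∀ x, ∑' y, b x y ≤ ENNReal.ofReal (r ^ (-β)) := by
    intro x
    have e1 : ∑' z, b x z = ENNReal.ofReal ε * ENNReal.ofReal (G.vol x (3 * r)) := by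
      rw [← h.tsum_emass_ball, ← ENNReal.tsum_mul_left]
      exact tsum_congr fun z => by simp only [hb]; split_ifs <;> simp
    rw [e1, ← ENNReal.ofReal_mul hε0.le]
    apply ENNReal.ofReal_le_ofReal
    have h1 : (1 + 3 * r) ^ (-γ) ≤ (3 * r) ^ (-γ) :=
      Real.rpow_le_rpow_of_nonpos (by positivity) (by linarith) (by linarith)
    have h2 : (3 * r) ^ (-γ) * (3 * r) ^ df = (3 * r) ^ (-β) := by
      rw [← Real.rpow_add (by positivity)]; congr 1; rw [hγ]; ring
    have h3 : (3 * r) ^ (-β) ≤ r ^ (-β) :=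
      Real.rpow_le_rpow_of_nonpos hr0 (by linarith) (by linarith)
    calc ε * G.vol x (3 * r) ≤ ε * (c * (3 * r) ^ df) := by
          gcongr; exact h.vol_le x _ (by linarith)
      _ = a⁻¹ * ((1 + 3 * r) ^ (-γ) * (3 * r) ^ df) := by rw [hε]; field_simp
      _ ≤ 1 * ((3 * r) ^ (-γ) * (3 * r) ^ df) := by
          gcongr
          exact inv_le_one_of_one_le₀ ha
      _ ≤ _ := by rw [one_mul, h2]; exact h3
  -- Up to time `n` the walk driven by `A` is killed with probability at most `1/4` and leaves the
  -- ball with probability at most `1/4`; these are the roles of `4` and `(12 M)²` in `B`.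
  have hhalf : ∀ m ≤ n, ∀ w, ENNReal.ofReal (1 / 2) ≤
      (act A)^[m] (Set.indicator (G.ball w r) 1) w := by
    intro m hm w
    have h1 := one_le_iter_one_add tsum_eprob hsplit hbsum m w
    have h2 : (act A)^[m] (fun _ => 1) w = (act A)^[m] (Set.indicator (G.ball w r) 1) w +
        (act A)^[m] (Set.indicator (G.ball w r)ᶜ 1) w := by
      have e : (fun _ : X => (1 : ℝ≥0∞)) = fun z =>
          Set.indicator (G.ball w r) 1 z + Set.indicator (G.ball w r)ᶜ 1 z := by
        funext z
        by_cases hz : z ∈ G.ball w r <;> simp [hz]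
      rw [← iter_add]
      exact congrArg (fun F => (act A)^[m] F w) e
    have h3 : (act A)^[m] (Set.indicator (G.ball w r)ᶜ 1) w ≤ ENNReal.ofReal (1 / 4) := by
      refine (iter_indicator_compl_le hA1 m w).trans ((exitFn_mono le_rfl tsum_eprob_le hAp
        subset_rfl m w).trans ((exitFn_mono_time hm w).trans
        (((hE r hr0).exit_le hM hr0 hn w).trans (ENNReal.ofReal_le_ofReal ?_))))
      have h4 : (n : ℝ) / r ^ β ≤ (1 / (12 * M)) ^ 2 := by
        rw [div_le_iff₀ (by positivity)]
        have h5 : (12 * M) ^ 2 * n ≤ r ^ β :=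
          le_trans (mul_le_mul_of_nonneg_right (le_max_right _ _) hn0.le) hnr
        calc (n : ℝ) = (1 / (12 * M)) ^ 2 * ((12 * M) ^ 2 * n) := by field_simp
          _ ≤ _ := by gcongr
      have h6 : ((n : ℝ) / r ^ β) ^ (1 / 2 : ℝ) ≤ 1 / (12 * M) := by
        refine (Real.rpow_le_rpow (by positivity) h4 (by norm_num)).trans (le_of_eq ?_)
        rw [← Real.rpow_natCast, ← Real.rpow_mul (by positivity)]
        norm_num
      calc 3 * M * ((n : ℝ) / r ^ β) ^ (1 / 2 : ℝ) ≤ 3 * M * (1 / (12 * M)) := by gcongr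
        _ = 1 / 4 := by field_simp; norm_num
    have h4 : (m : ℝ≥0∞) * ENNReal.ofReal (r ^ (-β)) ≤ ENNReal.ofReal (1 / 4) := by
      rw [← ENNReal.ofReal_natCast, ← ENNReal.ofReal_mul (by positivity)]
      apply ENNReal.ofReal_le_ofReal
      have h5 : 4 * (n : ℝ) ≤ r ^ β :=
        le_trans (mul_le_mul_of_nonneg_right (le_max_left _ _) hn0.le) hnr
      have h6 : (m : ℝ) ≤ n := by exact_mod_cast hm
      rw [Real.rpow_neg hr0.le, ← div_eq_mul_inv, div_le_iff₀ (by positivity)]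
      linarith
    have h5 : ENNReal.ofReal (1 / 2) + ENNReal.ofReal (1 / 2) ≤
        (act A)^[m] (Set.indicator (G.ball w r) 1) w + ENNReal.ofReal (1 / 2) := by
      calc ENNReal.ofReal (1 / 2) + ENNReal.ofReal (1 / 2) = 1 := by
            rw [← ENNReal.ofReal_add (by norm_num) (by norm_num)]; norm_num
        _ ≤ ((act A)^[m] (Set.indicator (G.ball w r) 1) w + ENNReal.ofReal (1 / 4)) +
            ENNReal.ofReal (1 / 4) := by
            refine h1.trans (add_le_add ?_ h4)
            rw [h2]
            gcongr
        _ = _ := by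
            rw [add_assoc, ← ENNReal.ofReal_add (by norm_num) (by norm_num)]
            norm_num
    exact (ENNReal.add_le_add_iff_right ENNReal.ofReal_ne_top).1 h5
  set κ := ENNReal.ofReal ε * G.emass y * ENNReal.ofReal (1 / 2) with hκ
  have hjump : ∀ i < n, ∀ z, κ * Set.indicator (G.ball x r) 1 z ≤
      act b ((act A)^[i] (dirac y)) z := by
    intro i hi z
    by_cases hz : z ∈ G.ball x r
    · rw [Set.indicator_of_mem hz, Pi.one_apply, mul_one]
      rw [mem_ball] at hz
      calc κ ≤ ENNReal.ofReal ε * G.emass y * (act A)^[i] (Set.indicator (G.ball y r) 1) y := by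
            rw [hκ]; gcongr; exact hhalf i hi.le y
        _ = ∑' w, ENNReal.ofReal ε * (G.emass y * (act A)^[i] (dirac w) y) *
              Set.indicator (G.ball y r) 1 w := by
            rw [iter_eq_tsum, ← ENNReal.tsum_mul_left]
            exact tsum_congr fun w => by ring
        _ ≤ _ := by
            refine ENNReal.tsum_le_tsum fun w => ?_
            by_cases hw : w ∈ G.ball y r
            · rw [Set.indicator_of_mem hw, Pi.one_apply, mul_one]
              rw [mem_ball] at hw
              have hd : G.d z w ≤ 3 * r := by
                have h1 := G.d_triangle z x w
                have h2 := G.d_triangle x y w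
                rw [G.d_comm z x] at h1
                linarith
              simp only [hb]
              rw [if_pos hd]
              have := symm_iter hsA i y w
              rw [this, mul_assoc]
            · rw [Set.indicator_of_notMem hw, mul_zero]
              exact zero_le
    · rw [Set.indicator_of_notMem hz, mul_zero]
      exact zero_le
  have hfinal := iter_add_sum_le hsplit n hjump x
  have hlow : ENNReal.ofReal (n * (ε * G.mass y * (1 / 2) * (1 / 2))) ≤
      (act K.eprob)^[n] (dirac y) x := by
    refine le_trans ?_ (le_add_self.trans hfinal)
    calc ENNReal.ofReal (n * (ε * G.mass y * (1 / 2) * (1 / 2)))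
        = ∑ m ∈ Finset.range n, κ * ENNReal.ofReal (1 / 2) := by
          have hm := (h.mass_pos y).le
          rw [Finset.sum_const, Finset.card_range, nsmul_eq_mul, hκ, emass,
            ← ENNReal.ofReal_mul hε0.le, ← ENNReal.ofReal_mul (by positivity),
            ← ENNReal.ofReal_mul (by positivity), ← ENNReal.ofReal_natCast,
            ← ENNReal.ofReal_mul (by positivity)]
      _ ≤ _ := Finset.sum_le_sum fun m hm =>
          mul_le_mul' le_rfl (hhalf m (Finset.mem_range.1 hm).le x)
  have hmy := h.mass_pos y
  rw [iter_dirac_eq h, ENNReal.ofReal_le_ofReal_iff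
    (mul_nonneg (kernel_nonneg h n x y) hmy.le)] at hlow
  have h1 : n * (ε / 4) ≤ K.kernel G n x y := by
    refine le_of_mul_le_mul_right ?_ hmy
    calc n * (ε / 4) * G.mass y = n * (ε * G.mass y * (1 / 2) * (1 / 2)) := by ring
      _ ≤ _ := hlow
  refine le_trans ?_ h1
  have h2 : 4 ^ (-γ) * r ^ (-γ) ≤ (1 + 3 * r) ^ (-γ) := by
    rw [← Real.mul_rpow (by norm_num) hr0.le]
    exact Real.rpow_le_rpow_of_nonpos (by positivity) (by linarith) (by linarith)
  calc a⁻¹ * c⁻¹ * 4 ^ (-γ) / 4 * (n * r ^ (-γ))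
      = n * (a⁻¹ * c⁻¹ * (4 ^ (-γ) * r ^ (-γ)) / 4) := by ring
    _ ≤ n * (a⁻¹ * c⁻¹ * (1 + 3 * r) ^ (-γ) / 4) := by gcongr
    _ = _ := by rw [hε]

theorem hkpProfile_pos {n : ℕ} (hn : 1 ≤ n) {r : ℝ} (hr : 0 ≤ r) : 0 < hkpProfile df β n r := by
  have hn0 : (0 : ℝ) < n := by exact_mod_cast hn
  unfold hkpProfile
  split_ifs with h0
  · positivity
  · have : 0 < r := lt_of_le_of_ne hr (Ne.symm h0)
    exact lt_min (by positivity) (by positivity)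

/-- Apply the radius form with `r` a fixed multiple of `max (d x y) (n^{1/β})`: the two alternatives
give the two entries of the minimum. -/
theorem exists_lower_bound (h : G.Regular df c) (hβ : 0 < β) (hJ : K.JumpBound G df β a)
    {M : ℝ} (hM : 0 < M) (hE : ∀ R : ℝ, 0 < R → K.ExitBound G β M R) :
    ∃ C : ℝ, 0 < C ∧ ∀ n : ℕ, 1 ≤ n → ∀ x y : X,
      C * hkpProfile df β n (G.d x y) ≤ K.kernel G n x y := by
  obtain ⟨B, C, hB, hC, hlow⟩ := exists_lower_bound_radius h hβ hJ hM hE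
  have hdf := h.df_pos
  set γ := df + β with hγ
  have hγ0 : 0 < γ := by positivity
  set b := B ^ (1 / β) with hb
  have hb1 : 1 ≤ b := Real.one_le_rpow hB (by positivity)
  have hbβ : b ^ β = B := by
    rw [hb, ← Real.rpow_mul (by linarith), one_div_mul_cancel hβ.ne', Real.rpow_one]
  refine ⟨C * b ^ (-γ), by positivity, fun n hn x y => ?_⟩
  have hn0 : (0 : ℝ) < n := by exact_mod_cast hn
  have hn1 : (1 : ℝ) ≤ n := by exact_mod_cast hn
  set u := (n : ℝ) ^ (1 / β) with hu
  have hu1 : 1 ≤ u := Real.one_le_rpow hn1 (by positivity)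
  have huβ : u ^ β = n := by
    rw [hu, ← Real.rpow_mul (by linarith), one_div_mul_cancel hβ.ne', Real.rpow_one]
  have hun : n * u ^ (-γ) = 1 / (n : ℝ) ^ (df / β) := by
    rw [hu, ← Real.rpow_mul hn0.le, one_div ((n : ℝ) ^ (df / β)), ← Real.rpow_neg hn0.le]
    have e : -(df / β) = 1 + 1 / β * -γ := by rw [hγ]; field_simp; ring
    rw [e, Real.rpow_add hn0, Real.rpow_one]
  set D := G.d x y with hD
  have hD0 : 0 ≤ D := G.d_nonneg x y
  have hmax0 : 0 < max D u := lt_max_of_lt_right (by linarith)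
  have key := hlow n hn x y (b * max D u)
    (by nlinarith [le_max_right D u]) ?_ (by nlinarith [le_max_left D u])
  · refine le_trans ?_ key
    rw [Real.mul_rpow (by positivity) hmax0.le]
    have hprof : hkpProfile df β n D ≤ n * (max D u) ^ (-γ) := by
      unfold hkpProfile
      split_ifs with h0
      · rw [h0, max_eq_right (by linarith), hun]
      · have hDpos : 0 < D := lt_of_le_of_ne hD0 (Ne.symm h0)
        rcases le_total D u with hle | hle
        · rw [max_eq_right hle, hun]
          exact min_le_left _ _
        · rw [max_eq_left hle, Real.rpow_neg hD0, ← div_eq_mul_inv]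
          exact min_le_right _ _
    calc C * b ^ (-γ) * hkpProfile df β n D ≤ C * b ^ (-γ) * (n * (max D u) ^ (-γ)) := by gcongr
      _ = _ := by ring
  · rw [Real.mul_rpow (by positivity) hmax0.le, hbβ]
    gcongr
    rw [← huβ]
    gcongr
    exact le_max_right _ _

/-- Transfer of the heat kernel estimate between two walks with comparable jump kernels. -/
theorem SatisfiesHKP.of_comparable (hcount : G.ComparableToCounting) (hdf : 0 < df)
    (hV : G.VolumeGrowth df) (hβ : 0 < β) (hK₁ : K₁.IsSymmetric G) (hK₂ : K₂.IsSymmetric G)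
    (hJ₁ : K₁.SatisfiesJ G df β) (hJ₂ : K₂.SatisfiesJ G df β) (hP : K₁.SatisfiesHKP G df β) :
    K₂.SatisfiesHKP G df β := by
  obtain ⟨c, h⟩ := exists_regular hcount hdf hV
  obtain ⟨a₁, hB₁⟩ := exists_jumpBound h hK₁ hJ₁
  obtain ⟨a₂, hB₂⟩ := exists_jumpBound h hK₂ hJ₂
  obtain ⟨C, hC, hT⟩ := hP.exists_tight h hβ
  obtain ⟨M, hM, hE⟩ := exists_exitBound h hβ hB₁ hB₂ hC hT
  obtain ⟨A, hA, hdiag⟩ := hB₂.exists_diagonal_bound h hβ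
  obtain ⟨U, hU, hoff⟩ := exists_offDiagonal_bound h hβ hB₂ hM hE
  obtain ⟨L, hL, hlow⟩ := exists_lower_bound h hβ hB₂ hM hE
  have hc0 : 0 < c := by linarith [h.one_le]
  refine ⟨max L⁻¹ (c * max A U), by positivity, fun n hn x y => ⟨?_, ?_⟩⟩
  · refine le_trans ?_ (hlow n hn x y)
    refine mul_le_mul_of_nonneg_right ?_ (hkpProfile_pos hn (G.d_nonneg x y)).le
    rw [inv_le_comm₀ (by positivity) hL]
    exact le_max_left _ _
  · have hn0 : (0 : ℝ) < n := by exact_mod_cast hn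
    have conv : ∀ t : ℝ, 0 ≤ t → (KernelOp.act K₂.eprob)^[n] (KernelOp.dirac y) x ≤
        ENNReal.ofReal t → K₂.kernel G n x y ≤ c * t := by
      intro t ht hle
      rw [iter_dirac_eq h, ENNReal.ofReal_le_ofReal_iff ht] at hle
      have h1 := h.inv_le_mass y
      rw [inv_le_iff_one_le_mul₀' hc0] at h1
      have h2 := kernel_nonneg (K := K₂) h n x y
      calc K₂.kernel G n x y ≤ K₂.kernel G n x y * (c * G.mass y) := le_mul_of_one_le_right h2 h1
        _ = c * (K₂.kernel G n x y * G.mass y) := by ring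
        _ ≤ c * t := by gcongr
    have e1 : (n : ℝ) ^ (-(df / β)) = 1 / (n : ℝ) ^ (df / β) := by
      rw [Real.rpow_neg hn0.le, one_div]
    have h1 : K₂.kernel G n x y ≤ c * max A U * (1 / (n : ℝ) ^ (df / β)) := by
      refine (conv _ (by positivity) (hdiag n hn x y)).trans ?_
      rw [e1, ← mul_assoc]
      gcongr
      exact le_max_left _ _
    refine le_trans ?_ (mul_le_mul_of_nonneg_right (le_max_right _ _)
      (hkpProfile_pos hn (G.d_nonneg x y)).le)
    unfold hkpProfile
    split_ifs with h0
    · exact h1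
    · have hxy : x ≠ y := by
        rintro rfl
        exact h0 (G.d_self x)
      have hd : 0 < G.d x y := by linarith [one_le_d (G := G) hxy]
      rw [mul_min_of_nonneg _ _ (by positivity)]
      refine le_min h1 ?_
      refine (conv _ (by positivity) (hoff n hn x y hxy)).trans ?_
      rw [Real.rpow_neg hd.le, ← div_eq_mul_inv, ← mul_assoc]
      gcongr
      exact le_max_right _ _

end MarkovOperator

theorem theorem1p2 {X : Type*} [Infinite X] (G : WeightedGraph X)
    (hcount : G.ComparableToCounting)
    (df : ℝ) (hdf : 0 < df) (hV : G.VolumeGrowth df)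
    (β : ℝ) (hβ : 2 ≤ β)
    (K₁ K₂ : MarkovOperator X)
    (hK₁ : K₁.IsSymmetric G) (hK₂ : K₂.IsSymmetric G)
    (hJ₁ : K₁.SatisfiesJ G df β) (hJ₂ : K₂.SatisfiesJ G df β) :
    K₁.SatisfiesHKP G df β ↔ K₂.SatisfiesHKP G df β :=
  ⟨MarkovOperator.SatisfiesHKP.of_comparable hcount hdf hV (by linarith) hK₁ hK₂ hJ₁ hJ₂,
    MarkovOperator.SatisfiesHKP.of_comparable hcount hdf hV (by linarith) hK₂ hK₁ hJ₂ hJ₁⟩
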